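/- **Setting.** Let $\tilde W$ be a Coxeter group with simple reflections $(s_i)_{i\in B}$, let $\Omega$ be a group acting on $\tilde W$ by automorphisms each of which preserves the set of simple reflections, and let $W=\Omega\ltimes\tilde W$ be the corresponding twisted Coxeter group. For $w=\delta\tilde w\in W$ let $\ell(w):=\ell(\tilde w)$ be its length. $W$ acts on the real reflection representation $V=\bigoplus_{i}\mathbb R\alpha_i$, with $\Omega$ permuting the simple roots; the roots $\mathfrak R=\tilde W\{\alpha_i\}_i$ are split into positive and negative ones. For $w\in W$ a root is called *stable* if its orbit under $\{w^k\}_{k\in\mathbb Z}$ consists solely of positive or solely of negative roots; $\mathfrak R^w_{\mathrm{st}}$ denotes the set of stable roots and $\mathfrak R^w$ the set of roots fixed by $w$. The element $w$ is *convex* if $\mathfrak R^w_{\mathrm{st}}$ is a standard parabolic subsystem, i.e. equals $\tilde W_J\{\alpha_j\}_{j\in J}$ for some $J\subseteq B$, where $\tilde W_J=\langle s_j\rangle_{j\in J}$; it is *firmly convex* if moreover $\mathfrak R^w=\mathfrak R^w_{\mathrm{st}}$. For $\tau,u,u'\in W$ with $\tau u\tau^{-1}=u'$ and $\ell(u)=\ell(u')$,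 this conjugation is a *strong conjugation* if $\ell(\tau u)=\ell(u)+\ell(\tau)$ or $\ell(u\tau^{-1})=\ell(u)+\ell(\tau^{-1})$, and a *cyclic shift* if $\ell(\tau u)=\ell(u)-\ell(\tau)$ or $\ell(u\tau^{-1})=\ell(u)-\ell(\tau^{-1})$. We call it *direct* if $\ell(\tau u)=\ell(u)+\ell(\tau)$ or $\ell(u\tau^{-1})=\ell(u)-\ell(\tau^{-1})$. For a subgroup $K\subseteq W$ let $\mathrm{Tran}^\times_K(w,w')$ be the set of sequences $\tau_n,\dots,\tau_0$ in $K$ such that, with $w_0=w$ and $w_{j+1}=\tau_jw_j\tau_j^{-1}$, one has $w_{n+1}=w'$ and each of these conjugations is a strong conjugation or a cyclic shift. We write $w\overset{\times}{\sim}w'$ *by $K$* if this set is nonempty. Let $\mathrm{Br}^+=\Omega\ltimes\mathrm{Br}^+_{\tilde W}$ and $\mathrm{Br}=\Omega\ltimes\mathrm{Br}_{\tilde W}$ be the twisted Artin–Tits braid monoid and braid group. For $w=\delta\tilde w$ let $b_w=\delta b_{\tilde w}$ be the corresponding reduced braid (where $b_{\tilde w}$ is given by any reduced word of $\tilde w$).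 For a standard parabolic subgroup $W'=\tilde W_J\subseteq\tilde W$ let $\mathrm{Br}^+_{W'}\subseteq\mathrm{Br}^+$ and $\mathrm{Br}_{W'}\subseteq\mathrm{Br}$ be the submonoid and the subgroup generated by $\{b_{s_j}\}_{j\in J}$. **Proposition.** Let $w,w'\in W$. (i) If $w\overset{\times}{\sim}w'$ via a sequence $\tau_n,\dots,\tau_0$ of elements of $W$, then $(\tau_n\cdots\tau_0)(\mathfrak R^w_{\mathrm{st}})=\mathfrak R^{w'}_{\mathrm{st}}$. In particular, if $w\overset{\times}{\sim}w'$ by $W$, both $w$ and $w'$ are convex and one of them is firmly convex, then so is the other. (ii) Suppose that $\tilde W$ is finite and let $W'\subseteq\tilde W$ be a standard parabolic subgroup. Then every element of $$\mathrm{Tran}_{W'}(b_w,b_{w'}):=\{\tau\in\mathrm{Br}^+_{W'}:\tau b_w=b_{w'}\tau\}$$ is of the form $b_{\tau_n}\cdots b_{\tau_0}$ for some sequence $\tau_n,\dots,\tau_0$ in $\mathrm{Tran}^\times_{W'}(w,w')$. More precisely, $(\tau_n,\dots,\tau_0)\mapsto b_{\tau_n}\cdots b_{\tau_0}$ maps the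 set of those sequences in $\mathrm{Tran}^\times_{W'}(w,w')$ all of whose steps are direct into, and onto, $\mathrm{Tran}_{W'}(b_w,b_{w'})$. In particular, $w\overset{\times}{\sim}w'$ by $W'$ if and only if $b_w$ and $b_{w'}$ are conjugate under the subgroup $\mathrm{Br}_{W'}$ of $\mathrm{Br}$. -/

import Mathlib

/-! ## The geometric representation of a Coxeter matrix -/

noncomputable section

namespace CoxeterMatrix

variable {B : Type*} (M : CoxeterMatrix B)

/-- The simple root `α i` in the space `V` with basis indexed by `B`. -/
def simpleRoot (_M : CoxeterMatrix B) (i : B) : B →₀ ℝ := Finsupp.single i 1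

/-- The linear form `v ↦ 2 (α i, v)`, where `(α i, α j) = - cos (π / M i j)`. The value
`M i j = 0` encodes `∞`, and then `(α i, α j) = - cos 0 = -1`. -/
def simpleCoroot (i : B) : Module.Dual ℝ (B →₀ ℝ) :=
  Finsupp.linearCombination ℝ (fun j => -2 * Real.cos (Real.pi / (M i j : ℝ)))

theorem simpleCoroot_simpleRoot (i j : B) :
    M.simpleCoroot i (M.simpleRoot j) = -2 * Real.cos (Real.pi / (M i j : ℝ)) := by
  simp [simpleCoroot, simpleRoot]

theorem simpleCoroot_simpleRoot_self (i : B) : M.simpleCoroot i (M.simpleRoot i) = 2 := by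
  simp [simpleCoroot_simpleRoot]

/-- The simple reflection `v ↦ v - 2 (α i, v) α i` of `V`. -/
def simpleReflection (i : B) : (B →₀ ℝ) ≃ₗ[ℝ] (B →₀ ℝ) :=
  Module.reflection (M.simpleCoroot_simpleRoot_self i)

theorem simpleReflection_apply (i : B) (v : B →₀ ℝ) :
    M.simpleReflection i v = v - M.simpleCoroot i v • M.simpleRoot i := by
  simp [simpleReflection, Module.reflection_apply]

theorem simpleReflection_mul_self (i : B) : M.simpleReflection i * M.simpleReflection i = 1 := by
  ext1 v
  exact Module.involutive_reflection (M.simpleCoroot_simpleRoot_self i) v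

theorem trace_eq (i j : B) :
    2 * Real.cos (2 * (Real.pi / (M i j : ℝ))) =
      M.simpleCoroot i (M.simpleRoot j) * M.simpleCoroot j (M.simpleRoot i) - 2 := by
  rw [simpleCoroot_simpleRoot, simpleCoroot_simpleRoot, M.symmetric j i, Real.cos_two_mul]
  ring

open Polynomial.Chebyshev in
theorem simpleReflection_isLiftable : M.IsLiftable M.simpleReflection := by
  intro i j
  rcases eq_or_ne i j with rfl | hij
  · simp [simpleReflection_mul_self]
  have h1 : M i j ≠ 1 := M.off_diagonal i j hij
  rcases Nat.eq_zero_or_pos (M i j) with h0 | hpos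
  · simp [h0]
  rcases eq_or_ne (M i j) 2 with h2 | h2
  · ext1 v
    have e1 : M.simpleCoroot i (M.simpleRoot j) = 0 := by
      simp [simpleCoroot_simpleRoot, h2]
    have e2 : M.simpleCoroot j (M.simpleRoot i) = 0 := by
      simp [simpleCoroot_simpleRoot, M.symmetric j i, h2]
    have e3 := M.simpleCoroot_simpleRoot_self i
    have e4 := M.simpleCoroot_simpleRoot_self j
    rw [h2, pow_two]
    simp only [LinearEquiv.mul_apply, simpleReflection_apply, map_sub, map_smul, e1, e2, e3, e4,
      LinearEquiv.coe_one, id_eq]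
    module
  have h3 : 3 ≤ M i j := by omega
  have hm : (3 : ℝ) ≤ (M i j : ℝ) := by exact_mod_cast h3
  have hθ : Real.sin (2 * (Real.pi / (M i j : ℝ))) ≠ 0 := by
    apply ne_of_gt
    apply Real.sin_pos_of_pos_of_lt_pi
    · have := Real.pi_pos
      positivity
    · rw [← mul_div_assoc, div_lt_iff₀ (by linarith)]
      nlinarith [Real.pi_pos]
  ext1 v
  simp only [simpleReflection]
  rw [Module.reflection_mul_reflection_pow_apply (M.simpleCoroot_simpleRoot_self i)
    (M.simpleCoroot_simpleRoot_self j) (M i j) v _ (M.trace_eq i j)]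
  have hS (n : ℤ) := S_two_mul_real_cos (2 * (Real.pi / (M i j : ℝ))) n
  rcases Nat.even_or_odd' (M i j) with ⟨k, hk | hk⟩
  · have hz : (S ℝ ((k : ℤ) - 1)).eval (2 * Real.cos (2 * (Real.pi / (M i j : ℝ)))) = 0 := by
      have := hS ((k : ℤ) - 1)
      have hkθ : ((((k : ℤ) - 1 : ℤ) : ℝ) + 1) * (2 * (Real.pi / (M i j : ℝ))) = Real.pi := by
        have : (M i j : ℝ) = 2 * k := by exact_mod_cast hk
        have hne : (k : ℝ) ≠ 0 := by
          intro h
          rw [this, h] at hm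
          norm_num at hm
        push_cast
        rw [this]
        field_simp
        ring
      rw [hkθ, Real.sin_pi] at this
      exact (mul_eq_zero.mp this).resolve_right hθ
    have d1 : ((M i j : ℤ) - 2) / 2 = (k : ℤ) - 1 := by omega
    have d2 : ((M i j : ℤ) - 1) / 2 = (k : ℤ) - 1 := by omega
    rw [d1, d2, hz]
    simp
  · have hz : (S ℝ (k : ℤ)).eval (2 * Real.cos (2 * (Real.pi / (M i j : ℝ)))) +
        (S ℝ ((k : ℤ) - 1)).eval (2 * Real.cos (2 * (Real.pi / (M i j : ℝ)))) = 0 := by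
      have a1 := hS (k : ℤ)
      have a2 := hS ((k : ℤ) - 1)
      have hkθ : (((k : ℤ) : ℝ) + 1) * (2 * (Real.pi / (M i j : ℝ))) =
          2 * Real.pi - ((((k : ℤ) - 1 : ℤ) : ℝ) + 1) * (2 * (Real.pi / (M i j : ℝ))) := by
        have : (M i j : ℝ) = 2 * k + 1 := by exact_mod_cast hk
        have hne : (2 * (k : ℝ) + 1) ≠ 0 := by positivity
        push_cast
        rw [this]
        field_simp
        ring
      rw [hkθ, Real.sin_two_pi_sub] at a1
      have : ((S ℝ (k : ℤ)).eval (2 * Real.cos (2 * (Real.pi / (M i j : ℝ)))) +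
        (S ℝ ((k : ℤ) - 1)).eval (2 * Real.cos (2 * (Real.pi / (M i j : ℝ))))) *
          Real.sin (2 * (Real.pi / (M i j : ℝ))) = 0 := by
        rw [add_mul, a1, a2]
        ring
      exact (mul_eq_zero.mp this).resolve_right hθ
    have d1 : ((M i j : ℤ) - 2) / 2 = (k : ℤ) - 1 := by omega
    have d2 : ((M i j : ℤ) - 1) / 2 = (k : ℤ) := by omega
    have d3 : ((M i j : ℤ) - 3) / 2 = (k : ℤ) - 1 := by omega
    have d4 : (M i j : ℤ) / 2 = (k : ℤ) := by omega
    rw [d1, d2, d3, d4, hz]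
    simp

open Polynomial.Chebyshev in
/-- The product of two simple reflections of `V` has order divisible by `M i j`. -/
theorem dvd_of_simpleReflection_pow (i j : B) (k : ℕ)
    (h : (M.simpleReflection i * M.simpleReflection j) ^ k = 1) : M i j ∣ k := by
  rcases eq_or_ne i j with rfl | hij
  · simp
  have h1 : M i j ≠ 1 := M.off_diagonal i j hij
  have key := Module.reflection_mul_reflection_pow_apply_self (M.simpleCoroot_simpleRoot_self i)
    (M.simpleCoroot_simpleRoot_self j) k _ (M.trace_eq i j)
  have h' : (Module.reflection (M.simpleCoroot_simpleRoot_self i) *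
    Module.reflection (M.simpleCoroot_simpleRoot_self j)) ^ k = 1 := h
  rw [h'] at key
  have ki := DFunLike.congr_fun key i
  have kj := DFunLike.congr_fun key j
  have c := M.simpleCoroot_simpleRoot j i
  rw [M.symmetric j i] at c
  rw [c] at ki kj
  simp only [LinearEquiv.coe_one, id_eq, simpleRoot, Finsupp.coe_add, Finsupp.coe_smul,
    Pi.add_apply, Pi.smul_apply, Finsupp.single_eq_same, Finsupp.single_eq_of_ne hij,
    Finsupp.single_eq_of_ne hij.symm, smul_eq_mul, mul_one, mul_zero, add_zero, zero_add]
    at ki kj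
  rcases eq_or_ne (M i j) 0 with h0 | h0
  · rw [h0] at kj
    simp [S_eval_two] at kj
    simp [kj]
  rcases eq_or_ne (M i j) 2 with h2 | h2
  · have ht : 2 * (Real.pi / ((2 : ℕ) : ℝ)) = Real.pi := by push_cast; ring
    rw [h2, ht] at ki
    simp only [Real.cos_pi, mul_neg, mul_one, S_eval_neg_two, Int.negOnePow_sub,
      Int.negOnePow_one] at ki
    rw [h2, ← even_iff_two_dvd]
    by_contra hk
    have : (k : ℤ).negOnePow = -1 := by
      rw [Int.negOnePow_odd _ (by exact_mod_cast Nat.not_even_iff_odd.mp hk)]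
    rw [this] at ki
    push_cast at ki
    norm_num at ki
  have h3 : 3 ≤ M i j := by omega
  have hm : (3 : ℝ) ≤ (M i j : ℝ) := by exact_mod_cast h3
  have hm0 : (M i j : ℝ) ≠ 0 := by linarith
  have hθ : Real.sin (2 * (Real.pi / (M i j : ℝ))) ≠ 0 := by
    apply ne_of_gt
    apply Real.sin_pos_of_pos_of_lt_pi
    · have := Real.pi_pos
      positivity
    · rw [← mul_div_assoc, div_lt_iff₀ (by linarith)]
      nlinarith [Real.pi_pos]
  have hc : Real.cos (Real.pi / (M i j : ℝ)) ≠ 0 := by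
    intro hc
    apply hθ
    rw [Real.sin_two_mul, hc, mul_zero]
  have hz : (S ℝ ((k : ℤ) - 1)).eval (2 * Real.cos (2 * (Real.pi / (M i j : ℝ)))) = 0 := by
    have := kj.symm
    simpa [hc] using this
  rw [hz, add_zero] at ki
  have a1 := S_two_mul_real_cos (2 * (Real.pi / (M i j : ℝ))) (k : ℤ)
  have a2 := S_two_mul_real_cos (2 * (Real.pi / (M i j : ℝ))) ((k : ℤ) - 1)
  rw [hz, zero_mul] at a2
  rw [← ki, one_mul] at a1
  obtain ⟨n, hn⟩ := Real.sin_eq_zero_iff.mp a2.symm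
  have hn' : (k : ℝ) * (2 * (Real.pi / (M i j : ℝ))) = n * Real.pi := by
    rw [hn]
    push_cast
    ring
  have e : (((k : ℤ) : ℝ) + 1) * (2 * (Real.pi / (M i j : ℝ))) =
      2 * (Real.pi / (M i j : ℝ)) + n * Real.pi := by
    rw [← hn']
    push_cast
    ring
  rw [e, Real.sin_add_int_mul_pi] at a1
  have hn2 : Even n := by
    by_contra hodd
    rw [(Int.not_even_iff_odd.mp hodd).neg_one_zpow] at a1
    apply hθ
    linarith
  obtain ⟨r, rfl⟩ := hn2
  have hk : (k : ℝ) = r * (M i j : ℝ) := by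
    have hpi := Real.pi_ne_zero
    field_simp at hn'
    push_cast at hn'
    linarith
  have hk' : (k : ℤ) = r * (M i j : ℤ) := by exact_mod_cast hk
  exact Int.natCast_dvd_natCast.mp ⟨r, by rw [hk', mul_comm]⟩

end CoxeterMatrix

namespace CoxeterSystem

variable {B Wt : Type*} {M : CoxeterMatrix B} [Group Wt] (cs : CoxeterSystem M Wt)

/-- The reflection representation of a Coxeter group on `V`. -/
def geomRep : Wt →* ((B →₀ ℝ) ≃ₗ[ℝ] (B →₀ ℝ)) :=
  cs.lift ⟨M.simpleReflection, M.simpleReflection_isLiftable⟩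

theorem geomRep_simple (i : B) : cs.geomRep (cs.simple i) = M.simpleReflection i :=
  cs.lift_apply_simple _ i

theorem dvd_of_simple_mul_simple_pow (i j : B) (k : ℕ)
    (h : (cs.simple i * cs.simple j) ^ k = 1) : M i j ∣ k := by
  apply M.dvd_of_simpleReflection_pow
  rw [← cs.geomRep_simple, ← cs.geomRep_simple, ← map_mul, ← map_pow, h, map_one]

theorem simple_injective' : Function.Injective cs.simple := by
  intro i j h
  by_contra hij
  have h1 : (cs.simple i * cs.simple j) ^ 1 = 1 := by simp [h]
  exact M.off_diagonal i j hij (Nat.dvd_one.mp (cs.dvd_of_simple_mul_simple_pow i j 1 h1))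

end CoxeterSystem

/-! ## Twisted Coxeter groups -/

/-- The data of a twisted Coxeter group `Ω ⋉ Wt`: a Coxeter system on `Wt` with Coxeter matrix `M`,
and an action of the group `Ω` on `Wt` by automorphisms, each of which preserves the set of simple
reflections. -/
structure TwistedCoxeterSystem {B : Type*} (M : CoxeterMatrix B) (Wt Ω : Type*) [Group Wt]
    [Group Ω] where
  /-- The Coxeter system on the untwisted part. -/
  cs : CoxeterSystem M Wt
  /-- The action of the twists. -/
  act : Ω →* MulAut Wt
  /-- Twists preserve the set of simple reflections. -/
  exists_act_simple : ∀ (δ : Ω) (i : B), ∃ j : B, act δ (cs.simple i) = cs.simple j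

namespace TwistedCoxeterSystem

variable {B Wt Ω : Type*} {M : CoxeterMatrix B} [Group Wt] [Group Ω]
  (T : TwistedCoxeterSystem M Wt Ω)

/-- The twisted Coxeter group. The element `δ * w̃` of `W` is `inr δ * inl w̃`. -/
abbrev W : Type _ := Wt ⋊[T.act] Ω

/-- The image of an index of a simple reflection under a twist. -/
def permFun (δ : Ω) (i : B) : B := (T.exists_act_simple δ i).choose

theorem act_simple (δ : Ω) (i : B) : T.act δ (T.cs.simple i) = T.cs.simple (T.permFun δ i) :=
  (T.exists_act_simple δ i).choose_spec

theorem permFun_one (i : B) : T.permFun 1 i = i := by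
  apply T.cs.simple_injective'
  rw [← act_simple, map_one, MulAut.one_apply]

theorem permFun_mul (δ ε : Ω) (i : B) : T.permFun (δ * ε) i = T.permFun δ (T.permFun ε i) := by
  apply T.cs.simple_injective'
  rw [← act_simple, map_mul, MulAut.mul_apply, act_simple, act_simple]

/-- The permutation of the index set of the simple reflections given by a twist. -/
def perm : Ω →* Equiv.Perm B where
  toFun δ :=
    { toFun := T.permFun δ
      invFun := T.permFun δ⁻¹
      left_inv := fun i => by rw [← permFun_mul, inv_mul_cancel, permFun_one]
      right_inv := fun i => by rw [← permFun_mul, mul_inv_cancel, permFun_one] }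
  map_one' := by
    ext i
    exact T.permFun_one i
  map_mul' δ ε := by
    ext i
    exact T.permFun_mul δ ε i

theorem act_simple' (δ : Ω) (i : B) : T.act δ (T.cs.simple i) = T.cs.simple (T.perm δ i) :=
  T.act_simple δ i

theorem dvd_perm (δ : Ω) (i j : B) : M (T.perm δ i) (T.perm δ j) ∣ M i j := by
  apply T.cs.dvd_of_simple_mul_simple_pow
  rw [← act_simple', ← act_simple', ← map_mul, ← map_pow, T.cs.simple_mul_simple_pow, map_one]

theorem matrix_perm (δ : Ω) (i j : B) : M (T.perm δ i) (T.perm δ j) = M i j := by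
  apply Nat.dvd_antisymm (T.dvd_perm δ i j)
  have h := T.dvd_perm δ⁻¹ (T.perm δ i) (T.perm δ j)
  rwa [← Equiv.Perm.mul_apply, ← Equiv.Perm.mul_apply, ← map_mul, inv_mul_cancel, map_one] at h

/-! ### Roots -/

/-- The linear action of the twists on `V`, permuting the simple roots. -/
def twistRep : Ω →* ((B →₀ ℝ) ≃ₗ[ℝ] (B →₀ ℝ)) where
  toFun δ := Finsupp.domLCongr (T.perm δ)
  map_one' := by
    ext v j
    rw [map_one]
    simp
    rfl
  map_mul' δ ε := by
    ext v j
    rw [map_mul]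
    simp
    rfl

theorem twistRep_simpleRoot (δ : Ω) (i : B) :
    T.twistRep δ (M.simpleRoot i) = M.simpleRoot (T.perm δ i) := by
  simp [twistRep, CoxeterMatrix.simpleRoot]

theorem simpleCoroot_twistRep (δ : Ω) (i : B) (v : B →₀ ℝ) :
    M.simpleCoroot (T.perm δ i) (T.twistRep δ v) = M.simpleCoroot i v := by
  induction v using Finsupp.induction_linear with
  | zero => simp
  | add f g hf hg => rw [map_add, map_add, map_add, hf, hg]
  | single j a => simp [twistRep, CoxeterMatrix.simpleCoroot, T.matrix_perm]

theorem twistRep_simpleReflection (δ : Ω) (i : B) (v : B →₀ ℝ) :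
    T.twistRep δ (M.simpleReflection i v) = M.simpleReflection (T.perm δ i) (T.twistRep δ v) := by
  rw [CoxeterMatrix.simpleReflection_apply, CoxeterMatrix.simpleReflection_apply,
    simpleCoroot_twistRep, map_sub, map_smul, twistRep_simpleRoot]

/-- The reflection representation of the twisted Coxeter group on `V`. -/
def rep : T.W →* ((B →₀ ℝ) ≃ₗ[ℝ] (B →₀ ℝ)) :=
  SemidirectProduct.lift T.cs.geomRep T.twistRep (by
    intro δ
    apply T.cs.ext_simple
    intro i
    ext1 v
    simp only [MonoidHom.comp_apply, MulEquiv.coe_toMonoidHom, T.act_simple',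
      CoxeterSystem.geomRep_simple, MulAut.conj_apply, LinearEquiv.mul_apply,
      T.twistRep_simpleReflection]
    rw [← LinearEquiv.mul_apply, ← LinearEquiv.mul_apply, mul_assoc, mul_inv_cancel, mul_one])

/-- The roots: the images of the simple roots under the Coxeter group. -/
def roots : Set (B →₀ ℝ) :=
  {β | ∃ (x : Wt) (i : B), β = T.cs.geomRep x (M.simpleRoot i)}

/-- The positive roots: those with nonnegative coordinates in the basis of simple roots. -/
def posRoots : Set (B →₀ ℝ) := {β ∈ T.roots | ∀ i, 0 ≤ β i}

/-- The negative roots: those with nonpositive coordinates in the basis of simple roots. -/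
def negRoots : Set (B →₀ ℝ) := {β ∈ T.roots | ∀ i, β i ≤ 0}

/-- The stable roots of `w`: the roots whose `w`-orbit consists solely of positive roots or solely
of negative roots. -/
def stableRoots (w : T.W) : Set (B →₀ ℝ) :=
  {β ∈ T.roots | (∀ k : ℤ, T.rep (w ^ k) β ∈ T.posRoots) ∨ (∀ k : ℤ, T.rep (w ^ k) β ∈ T.negRoots)}

/-- The roots fixed by `w`. -/
def fixedRoots (w : T.W) : Set (B →₀ ℝ) := {β ∈ T.roots | T.rep w β = β}

/-- The standard parabolic subgroup of the untwisted part generated by the simple reflections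
indexed by `J`. -/
def untwistedParabolic (J : Set B) : Subgroup Wt := Subgroup.closure (T.cs.simple '' J)

/-- The standard parabolic subsystem of roots corresponding to `J`. -/
def parabolicRoots (J : Set B) : Set (B →₀ ℝ) :=
  {β | ∃ x ∈ T.untwistedParabolic J, ∃ j ∈ J, β = T.cs.geomRep x (M.simpleRoot j)}

/-- An element is convex if its stable roots form a standard parabolic subsystem. -/
def IsConvex (w : T.W) : Prop := ∃ J : Set B, T.stableRoots w = T.parabolicRoots J

/-- An element is firmly convex if it is convex and all of its stable roots are fixed. -/
def IsFirmlyConvex (w : T.W) : Prop := T.IsConvex w ∧ T.fixedRoots w = T.stableRoots w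

/-! ### Mixed shifts -/

/-- The length of an element `w̃ * δ = δ * (δ⁻¹ w̃ δ)` of `W`: the Coxeter length of its untwisted
part. -/
def length (w : T.W) : ℕ := T.cs.length w.left

/-- `w' = τ w τ⁻¹` is a (single) strong conjugation of `w` by `τ`. -/
def IsStrongConj (τ w w' : T.W) : Prop :=
  τ * w * τ⁻¹ = w' ∧ T.length w = T.length w' ∧
    (T.length (τ * w) = T.length w + T.length τ ∨
      T.length (w * τ⁻¹) = T.length w + T.length τ⁻¹)

/-- `w' = τ w τ⁻¹` is a (single) cyclic shift of `w` by `τ`. -/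
def IsCyclicShift (τ w w' : T.W) : Prop :=
  τ * w * τ⁻¹ = w' ∧ T.length w = T.length w' ∧
    (T.length (τ * w) + T.length τ = T.length w ∨
      T.length (w * τ⁻¹) + T.length τ⁻¹ = T.length w)

/-- A list `[τₙ, …, τ₀]` satisfies `IsChain R` from `w` to `w'` if there are elements
`w = w₀, …, wₙ₊₁ = w'` with `R τⱼ wⱼ wⱼ₊₁` for all `j`. -/
def IsChain {G : Type*} (R : G → G → G → Prop) : List G → G → G → Prop
  | [], w, w' => w = w'
  | τ :: L, w, w' => ∃ u, IsChain R L w u ∧ R τ u w'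

/-- The set `Tran_K^×(w, w')` of sequences `[τₙ, …, τ₀]` of elements of `K` which conjugate `w` to
`w'` through a sequence of cyclic shifts and strong conjugations. -/
def mixedTran (K : Subgroup T.W) (w w' : T.W) : Set (List T.W) :=
  {L | (∀ τ ∈ L, τ ∈ K) ∧
    IsChain (fun τ u u' => T.IsStrongConj τ u u' ∨ T.IsCyclicShift τ u u') L w w'}

/-- `w` and `w'` are related by a sequence of mixed shifts by `K`. -/
def MixedShift (K : Subgroup T.W) (w w' : T.W) : Prop := (T.mixedTran K w w').Nonempty

/-- The strong conjugations and cyclic shifts of `u` by `τ` for which either `τ u` or `(u τ⁻¹) τ` is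
a reduced product. -/
def IsDirectMixedShift (τ u u' : T.W) : Prop :=
  (T.IsStrongConj τ u u' ∧ T.length (τ * u) = T.length u + T.length τ) ∨
    (T.IsCyclicShift τ u u' ∧ T.length (u * τ⁻¹) + T.length τ⁻¹ = T.length u)

/-- The sequences in `Tran_K^×(w, w')` all of whose steps are direct. -/
def directMixedTran (K : Subgroup T.W) (w w' : T.W) : Set (List T.W) :=
  {L ∈ T.mixedTran K w w' | IsChain T.IsDirectMixedShift L w w'}

/-- The standard parabolic subgroup of `W` generated by the simple reflections indexed by `J`. -/
def parabolic (J : Set B) : Subgroup T.W :=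
  (T.untwistedParabolic J).map SemidirectProduct.inl

end TwistedCoxeterSystem

/-! ## Braid monoids and braid groups -/

namespace CoxeterMatrix

variable {B : Type*} (M : CoxeterMatrix B)

/-- The braid relations: the alternating words in `i` and `j` of length `M i j` agree. If
`M i j = 0`, which encodes `∞`, both words are empty and there is no relation. -/
def BraidRel (a b : FreeMonoid B) : Prop :=
  ∃ i j : B, a = FreeMonoid.ofList (CoxeterSystem.braidWord M i j) ∧
    b = FreeMonoid.ofList (CoxeterSystem.braidWord M j i)

/-- The Artin-Tits braid monoid. -/
abbrev BraidMonoid : Type _ := PresentedMonoid M.BraidRel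

/-- The relators of the Artin-Tits braid group. -/
def braidRelators : Set (FreeGroup B) :=
  {r | ∃ i j : B, r = ((CoxeterSystem.braidWord M i j).map FreeGroup.of).prod *
    ((CoxeterSystem.braidWord M j i).map FreeGroup.of).prod⁻¹}

/-- The Artin-Tits braid group. -/
abbrev BraidGroup : Type _ := PresentedGroup M.braidRelators

theorem braidGroup_rel (i j : B) :
    ((CoxeterSystem.braidWord M i j).map (PresentedGroup.of (rels := M.braidRelators))).prod =
      ((CoxeterSystem.braidWord M j i).map (PresentedGroup.of (rels := M.braidRelators))).prod := by
  have h : PresentedGroup.mk M.braidRelators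
      (((CoxeterSystem.braidWord M i j).map FreeGroup.of).prod *
        ((CoxeterSystem.braidWord M j i).map FreeGroup.of).prod⁻¹) = 1 :=
    PresentedGroup.one_of_mem ⟨i, j, rfl⟩
  rw [map_mul, map_inv, mul_inv_eq_one, map_list_prod, map_list_prod, List.map_map,
    List.map_map] at h
  exact h

/-- The natural homomorphism from the braid monoid to the braid group. -/
def braidMonoidToGroup : M.BraidMonoid →* M.BraidGroup :=
  PresentedMonoid.lift (PresentedGroup.of (rels := M.braidRelators)) (by
    rintro _ _ ⟨i, j, rfl, rfl⟩
    simp only [FreeMonoid.lift_ofList]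
    exact M.braidGroup_rel i j)

end CoxeterMatrix

theorem CoxeterSystem.map_alternatingWord {B B' : Type*} (f : B → B') (i j : B) (m : ℕ) :
    (CoxeterSystem.alternatingWord i j m).map f =
      CoxeterSystem.alternatingWord (f i) (f j) m := by
  induction m generalizing i j with
  | zero => simp [CoxeterSystem.alternatingWord]
  | succ m ih => simp [CoxeterSystem.alternatingWord_succ, ih]

namespace TwistedCoxeterSystem

variable {B Wt Ω : Type*} {M : CoxeterMatrix B} [Group Wt] [Group Ω]
  (T : TwistedCoxeterSystem M Wt Ω)

theorem map_braidWord (δ : Ω) (i j : B) :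
    (CoxeterSystem.braidWord M i j).map (T.perm δ) =
      CoxeterSystem.braidWord M (T.perm δ i) (T.perm δ j) := by
  rw [CoxeterSystem.map_alternatingWord, CoxeterSystem.braidWord, T.matrix_perm]

/-- The action of a twist on the braid monoid, permuting the generators. -/
def braidMonoidMap (δ : Ω) : M.BraidMonoid →* M.BraidMonoid :=
  PresentedMonoid.lift (fun i => PresentedMonoid.of M.BraidRel (T.perm δ i)) (by
    rintro _ _ ⟨i, j, rfl, rfl⟩
    have key (i j : B) : FreeMonoid.lift (fun i => PresentedMonoid.of M.BraidRel (T.perm δ i))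
        (FreeMonoid.ofList (CoxeterSystem.braidWord M i j)) =
        PresentedMonoid.mk M.BraidRel
          (FreeMonoid.ofList (CoxeterSystem.braidWord M (T.perm δ i) (T.perm δ j))) := by
      rw [← T.map_braidWord, FreeMonoid.ofList_map, ← MonoidHom.comp_apply]
      have h : FreeMonoid.lift (fun i => PresentedMonoid.of M.BraidRel (T.perm δ i)) =
          (PresentedMonoid.mk M.BraidRel).comp (FreeMonoid.map (T.perm δ)) :=
        FreeMonoid.hom_eq (fun _ => rfl)
      rw [h]
    rw [key, key]
    exact PresentedMonoid.mk_eq_mk_of_rel ⟨_, _, rfl, rfl⟩)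

/-- The action of a twist on the braid group, permuting the generators. -/
def braidGroupMap (δ : Ω) : M.BraidGroup →* M.BraidGroup :=
  PresentedGroup.toGroup (f := fun i => PresentedGroup.of (T.perm δ i)) (by
    rintro _ ⟨i, j, rfl⟩
    have key (i j : B) : FreeGroup.lift
          (fun i => PresentedGroup.of (rels := M.braidRelators) (T.perm δ i))
        ((CoxeterSystem.braidWord M i j).map FreeGroup.of).prod =
        ((CoxeterSystem.braidWord M (T.perm δ i) (T.perm δ j)).map
          (PresentedGroup.of (rels := M.braidRelators))).prod := by
      rw [← T.map_braidWord, map_list_prod, List.map_map, List.map_map]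
      congr 2
    rw [map_mul, map_inv, key, key, mul_inv_eq_one]
    exact M.braidGroup_rel _ _)

theorem braidMonoidMap_of (δ : Ω) (i : B) :
    T.braidMonoidMap δ (PresentedMonoid.of M.BraidRel i) =
      PresentedMonoid.of M.BraidRel (T.perm δ i) := rfl

theorem braidGroupMap_of (δ : Ω) (i : B) :
    T.braidGroupMap δ (PresentedGroup.of i) = PresentedGroup.of (T.perm δ i) := by
  simp [braidGroupMap]

theorem braidMonoidMap_one : T.braidMonoidMap 1 = MonoidHom.id _ := by
  apply PresentedMonoid.ext
  intro i
  simp [braidMonoidMap_of]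

theorem braidMonoidMap_mul (δ ε : Ω) :
    T.braidMonoidMap (δ * ε) = (T.braidMonoidMap δ).comp (T.braidMonoidMap ε) := by
  apply PresentedMonoid.ext
  intro i
  simp [braidMonoidMap_of]

theorem braidGroupMap_one : T.braidGroupMap 1 = MonoidHom.id _ := by
  apply PresentedGroup.ext
  intro i
  simp [braidGroupMap_of]

theorem braidGroupMap_mul (δ ε : Ω) :
    T.braidGroupMap (δ * ε) = (T.braidGroupMap δ).comp (T.braidGroupMap ε) := by
  apply PresentedGroup.ext
  intro i
  simp [braidGroupMap_of]

/-- The action of the twists on the braid group. -/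
def braidGroupAct : Ω →* MulAut M.BraidGroup where
  toFun δ :=
    { T.braidGroupMap δ with
      invFun := T.braidGroupMap δ⁻¹
      left_inv := fun x => by
        change ((T.braidGroupMap δ⁻¹).comp (T.braidGroupMap δ)) x = x
        rw [← braidGroupMap_mul, inv_mul_cancel, braidGroupMap_one, MonoidHom.id_apply]
      right_inv := fun x => by
        change ((T.braidGroupMap δ).comp (T.braidGroupMap δ⁻¹)) x = x
        rw [← braidGroupMap_mul, mul_inv_cancel, braidGroupMap_one, MonoidHom.id_apply] }
  map_one' := by
    ext x
    exact DFunLike.congr_fun T.braidGroupMap_one x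
  map_mul' δ ε := by
    ext x
    exact DFunLike.congr_fun (T.braidGroupMap_mul δ ε) x

/-- The twisted braid group `Ω ⋉ Br`. -/
abbrev TwistedBraidGroup : Type _ := M.BraidGroup ⋊[T.braidGroupAct] Ω

/-- The twisted braid monoid `Ω ⋉ Br⁺`. The pair `⟨b, δ⟩` stands for the product `b * δ`. -/
@[ext]
structure TwistedBraidMonoid (T : TwistedCoxeterSystem M Wt Ω) where
  /-- The element of the untwisted braid monoid. -/
  left : M.BraidMonoid
  /-- The twist. -/
  right : Ω

instance : Monoid T.TwistedBraidMonoid where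
  mul a b := ⟨a.left * T.braidMonoidMap a.right b.left, a.right * b.right⟩
  one := ⟨1, 1⟩
  mul_assoc a b c := by
    apply TwistedBraidMonoid.ext
    · change a.left * T.braidMonoidMap a.right b.left *
        T.braidMonoidMap (a.right * b.right) c.left =
          a.left * T.braidMonoidMap a.right (b.left * T.braidMonoidMap b.right c.left)
      rw [braidMonoidMap_mul, map_mul, mul_assoc, MonoidHom.comp_apply]
    · exact mul_assoc a.right b.right c.right
  one_mul a := by
    apply TwistedBraidMonoid.ext
    · change 1 * T.braidMonoidMap 1 a.left = a.left
      rw [braidMonoidMap_one, one_mul, MonoidHom.id_apply]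
    · exact one_mul a.right
  mul_one a := by
    apply TwistedBraidMonoid.ext
    · change a.left * T.braidMonoidMap a.right 1 = a.left
      rw [map_one, mul_one]
    · exact mul_one a.right

/-- The inclusion of the untwisted braid monoid into the twisted one. -/
def braidInl : M.BraidMonoid →* T.TwistedBraidMonoid where
  toFun b := ⟨b, 1⟩
  map_one' := rfl
  map_mul' a b := by
    apply TwistedBraidMonoid.ext
    · change a * b = a * T.braidMonoidMap 1 b
      rw [braidMonoidMap_one, MonoidHom.id_apply]
    · exact (one_mul (1 : Ω)).symm

/-- A reduced word for an element of the untwisted part. -/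
def reducedWord (x : Wt) : List B := (T.cs.exists_isReduced x).choose

/-- The reduced braid `b_x` of an element `x` of the untwisted part: the product in the braid monoid
of the letters of a reduced word for `x`. -/
def reducedBraid (x : Wt) : M.BraidMonoid :=
  PresentedMonoid.mk M.BraidRel (FreeMonoid.ofList (T.reducedWord x))

/-- The reduced braid `b_w` of `w = x * δ` in the twisted braid monoid, namely `b_x * δ`. -/
def braid (w : T.W) : T.TwistedBraidMonoid := ⟨T.reducedBraid w.left, w.right⟩

/-- The image of the reduced braid `b_w` in the twisted braid group. -/
def braidInGroup (w : T.W) : T.TwistedBraidGroup :=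
  ⟨M.braidMonoidToGroup (T.reducedBraid w.left), w.right⟩

/-- The standard parabolic submonoid of the twisted braid monoid, generated by the
generators indexed by `J`. -/
def parabolicBraidMonoid (J : Set B) : Submonoid T.TwistedBraidMonoid :=
  (Submonoid.closure (PresentedMonoid.of M.BraidRel '' J)).map T.braidInl

/-- The standard parabolic subgroup of the twisted braid group, generated by the
generators indexed by `J`. -/
def parabolicBraidGroup (J : Set B) : Subgroup T.TwistedBraidGroup :=
  (Subgroup.closure (PresentedGroup.of (rels := M.braidRelators) '' J)).map SemidirectProduct.inl

/-- The braid transporter `{τ ∈ Br⁺_J : τ b_w = b_w' τ}`. -/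
def braidTran (J : Set B) (w w' : T.W) : Set T.TwistedBraidMonoid :=
  {b | b ∈ T.parabolicBraidMonoid J ∧ b * T.braid w = T.braid w' * b}

/-- The braid `b_{τₙ} ⋯ b_{τ₀}` of a sequence of elements `[τₙ, …, τ₀]`. -/
def braidProd (L : List T.W) : T.TwistedBraidMonoid := (L.map T.braid).prod

end TwistedCoxeterSystem

end

/-! Stable roots. It is enough to treat one step `u' = τ u τ⁻¹` and a root `β` whose `u`-orbit is
positive; negating roots and replacing `u`, `u'` by their inverses covers the other cases. The tool
is that inversions of `y` remain inversions of `x y` when `x y` is a reduced product. If `u = τ⁻¹ (τ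
u)` is reduced, then a negative root `τ u ^ k β` would make `u ^ k β` negative, so `τ` keeps the
whole orbit positive. If instead `τ u = u' τ` is reduced, then negativity of `τ u ^ k β` propagates
to `k + 1`; as `τ` has finitely many inversions, the orbit is periodic, so `τ` makes all of it
negative.

Braids. A direct step is one for which `τ u = u' τ` lifts to `b_τ b_u = b_u' b_τ`, so direct
sequences give transporters. Conversely, let `b b_x = b_x' δ(b)` with `b ≠ 1` positive, let `Δ` be
the Garside element and `b_d b_x = Δ`. Put `ρ = gcd(b, b_d)` and `σ = gcd(b, Δ)`, greatest common
right divisors. Then `δ(σ)` divides both `b b_x` and `Δ`, hence divides `ρ b_x`. If `ρ ≠ 1`, it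
performs a direct strong conjugation. If `ρ = 1`, then `δ(σ)` divides `b_x`, and the same argument
for the complement of `b_x` in `Δ` shows that `σ` performs a direct cyclic shift. The step is
stripped off by cancellation and induction on the length of `b` finishes
(`exists_direct_first_step`, `exists_directMixedTran`).

Conjugacy. An element of the parabolic braid group is a fraction `q m⁻¹` of positive parabolic
elements. Once the common right divisor is removed, `q` and `m` are positive conjugators to `b_x'`
and `b_x` from one common positive element (`exists_of_fraction_conj`). The same holds for
complements, and this forces the common element to divide `Δ`, so it is a reduced braid and the
transporter result applies to `q` and to `m`.

The Garside theory rests on the lattice property of the weak order: joins define residues, on which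
the braid monoid acts (`residueAct`). This action yields cancellation, a divisibility criterion,
greatest common divisors and the embedding of the monoid into the group. -/

namespace CoxeterMatrix

/-! ### Simple reflections and dihedral coefficients. -/

variable {B : Type*} (M : CoxeterMatrix B)

/-- The coefficients `sin (k θ) / sin θ` (or `k` when `θ = 0`), `θ = π / M i j`, by which dihedral
groups act on the plane spanned by two simple roots. -/
theorem exists_dihedral_coefficients {i j : B} (hij : i ≠ j) :
    ∃ U : ℕ → ℝ, U 0 = 0 ∧ U 1 = 1 ∧
      (∀ k, U (k + 2) = 2 * Real.cos (Real.pi / (M i j : ℝ)) * U (k + 1) - U k) ∧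
      ∀ k, (M i j = 0 ∨ k ≤ M i j) → 0 ≤ U k := by
  rcases Nat.eq_zero_or_pos (M i j) with h0 | hpos
  · refine ⟨fun k => k, by simp, by simp, fun k => ?_, fun k _ => by positivity⟩
    simp [h0]
    ring
  have h1 : M i j ≠ 1 := M.off_diagonal i j hij
  have h2 : 2 ≤ M i j := by omega
  obtain ⟨m, hmdef⟩ : ∃ m : ℝ, m = (M i j : ℝ) := ⟨_, rfl⟩
  have hm : (2 : ℝ) ≤ m := by
    rw [hmdef]
    exact_mod_cast h2
  rw [← hmdef]
  have hθ : 0 < Real.sin (Real.pi / m) := by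
    have := Real.pi_pos
    apply Real.sin_pos_of_pos_of_lt_pi
    · positivity
    · rw [div_lt_iff₀ (by linarith)]
      nlinarith
  refine ⟨fun k => Real.sin (k * (Real.pi / m)) / Real.sin (Real.pi / m), by simp, ?_, ?_, ?_⟩
  · simp [hθ.ne']
  · intro k
    have e : Real.sin (((k + 2 : ℕ) : ℝ) * (Real.pi / m)) =
        2 * Real.cos (Real.pi / m) * Real.sin (((k + 1 : ℕ) : ℝ) * (Real.pi / m)) -
          Real.sin ((k : ℝ) * (Real.pi / m)) := by
      have a1 : ((k + 2 : ℕ) : ℝ) * (Real.pi / m) =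
          ((k + 1 : ℕ) : ℝ) * (Real.pi / m) + Real.pi / m := by push_cast; ring
      have a2 : (k : ℝ) * (Real.pi / m) =
          ((k + 1 : ℕ) : ℝ) * (Real.pi / m) - Real.pi / m := by push_cast; ring
      rw [a1, a2, Real.sin_add, Real.sin_sub]
      ring
    beta_reduce
    rw [e]
    ring
  · intro k hk
    have hk' : (k : ℝ) ≤ m := by
      rcases hk with h | h
      · omega
      · rw [hmdef]
        exact_mod_cast h
    apply div_nonneg _ hθ.le
    apply Real.sin_nonneg_of_nonneg_of_le_pi
    · have := Real.pi_pos
      positivity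
    · rw [← mul_div_assoc, div_le_iff₀ (by linarith)]
      nlinarith [Real.pi_pos]

theorem simpleReflection_simpleRoot_self (i : B) :
    M.simpleReflection i (M.simpleRoot i) = -M.simpleRoot i := by
  rw [simpleReflection_apply, simpleCoroot_simpleRoot_self]
  module

theorem simpleReflection_simpleRoot (i j : B) :
    M.simpleReflection i (M.simpleRoot j) =
      M.simpleRoot j + (2 * Real.cos (Real.pi / (M i j : ℝ))) • M.simpleRoot i := by
  rw [simpleReflection_apply, simpleCoroot_simpleRoot]
  module

theorem simpleRoot_nonneg (i : B) : 0 ≤ M.simpleRoot i := by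
  simp [simpleRoot]

theorem simpleRoot_ne_zero (i : B) : M.simpleRoot i ≠ 0 := by
  simp [simpleRoot]

end CoxeterMatrix

/-! ### Length and the sign of roots. -/

namespace CoxeterSystem

variable {B Wt : Type*} {M : CoxeterMatrix B} [Group Wt] (cs : CoxeterSystem M Wt)

theorem geomRep_mul_apply (x y : Wt) (v : B →₀ ℝ) :
    cs.geomRep (x * y) v = cs.geomRep x (cs.geomRep y v) := by
  rw [map_mul, LinearEquiv.mul_apply]

/-- Alternating products of two simple reflections, as long as they are not longer than the
braid relation, send a simple root into the cone spanned by the two simple roots. -/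
theorem geomRep_alternatingWord_simpleRoot {i j : B} (hij : i ≠ j) {k : ℕ}
    (hk : M i j = 0 ∨ k < M i j) :
    ∃ p q : ℝ, 0 ≤ p ∧ 0 ≤ q ∧
      cs.geomRep (cs.wordProd (alternatingWord i j k)) (M.simpleRoot i) =
        p • M.simpleRoot i + q • M.simpleRoot j := by
  obtain ⟨U, U0, U1, hrec, hpos⟩ := M.exists_dihedral_coefficients hij
  have key : ∀ k, cs.geomRep (cs.wordProd (alternatingWord i j k)) (M.simpleRoot i) =
      if Even k then U (k + 1) • M.simpleRoot i + U k • M.simpleRoot j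
        else U k • M.simpleRoot i + U (k + 1) • M.simpleRoot j := by
    intro k
    induction k with
    | zero => simp [alternatingWord, U0, U1]
    | succ k ih =>
      rw [alternatingWord_succ', wordProd_cons, geomRep_mul_apply, ih]
      by_cases hk : Even k
      · have hk' : ¬ Even (k + 1) := by simpa [Nat.even_add_one] using hk
        rw [if_pos hk, if_pos hk, if_neg hk', map_add, map_smul, map_smul, geomRep_simple,
          CoxeterMatrix.simpleReflection_simpleRoot_self,
          CoxeterMatrix.simpleReflection_simpleRoot, M.symmetric j i, hrec]
        module
      · have hk' : Even (k + 1) := by simpa [Nat.even_add_one] using hk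
        rw [if_neg hk, if_neg hk, if_pos hk', map_add, map_smul, map_smul, geomRep_simple,
          CoxeterMatrix.simpleReflection_simpleRoot_self,
          CoxeterMatrix.simpleReflection_simpleRoot, hrec]
        module
  have h1 : 0 ≤ U k := hpos k (by omega)
  have h2 : 0 ≤ U (k + 1) := hpos (k + 1) (by omega)
  rw [key k]
  split_ifs
  · exact ⟨_, _, h2, h1, rfl⟩
  · exact ⟨_, _, h1, h2, rfl⟩

theorem length_mul_simple_lt_or (x : Wt) (i : B) :
    cs.length (x * cs.simple i) < cs.length x ∨ cs.length x < cs.length (x * cs.simple i) := by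
  rcases cs.length_mul_simple x i with h | h <;> omega

/-- The last `M i j` letters form a braid word ending in `j`, which the braid relation rewrites as
one ending in `i`. -/
theorem alternatingWord_of_le_isRightDescent {i j : B} {k : ℕ} (hM : M i j ≠ 0)
    (hk : M i j ≤ k) :
    ∃ ω : List B, ω.length + 1 = k ∧
      cs.wordProd (alternatingWord i j k) = cs.wordProd ω * cs.simple i := by
  obtain ⟨n, rfl⟩ := Nat.exists_eq_add_of_le hk
  clear hk
  have h (n : ℕ) : ∃ ω : List B, ω.length = n ∧
      alternatingWord i j (M i j + n) = ω ++ alternatingWord i j (M i j) := by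
    induction n with
    | zero => exact ⟨[], rfl, rfl⟩
    | succ n ih =>
      obtain ⟨ω, h1, h2⟩ := ih
      refine ⟨(if Even (M i j + n) then j else i) :: ω, by simp [h1], ?_⟩
      rw [← add_assoc, alternatingWord_succ', h2]
      rfl
  obtain ⟨ω, h1, h2⟩ := h n
  obtain ⟨m, hm⟩ := Nat.exists_eq_succ_of_ne_zero hM
  refine ⟨ω ++ alternatingWord i j m, by simp [h1]; omega, ?_⟩
  have e := cs.wordProd_braidWord_eq i j
  have hm' : M j i = m + 1 := by rw [M.symmetric j i, hm]
  rw [braidWord, braidWord, hm', alternatingWord_succ j i, wordProd_concat] at e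
  rw [h2, wordProd_append, e, wordProd_append, mul_assoc]

/-- Lengths of such suffixes are bounded by that of `x`, and the descent `j` supplies one of length
1. Maximality will prevent both `i` and `j` from being right descents of `v`. -/
theorem exists_maximal_alternating_suffix {x : Wt} {i j : B}
    (hj : cs.length (x * cs.simple j) < cs.length x) :
    ∃ (k : ℕ) (v : Wt), 0 < k ∧ x = v * cs.wordProd (alternatingWord i j k) ∧
      cs.length v + k = cs.length x ∧
      ∀ v', x = v' * cs.wordProd (alternatingWord i j (k + 1)) →
        cs.length v' + (k + 1) ≠ cs.length x := by
  classical
  let P : ℕ → Prop := fun k => ∃ v, x = v * cs.wordProd (alternatingWord i j k) ∧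
    cs.length v + k = cs.length x
  have h1 : P 1 := by
    refine ⟨x * cs.simple j, by simp [alternatingWord], ?_⟩
    rcases cs.length_mul_simple x j with h | h <;> omega
  have hx : 1 ≤ cs.length x := by omega
  have hP := Nat.findGreatest_spec (P := P) hx h1
  have hle := Nat.le_findGreatest (P := P) hx h1
  obtain ⟨v, hv, hl⟩ := hP
  refine ⟨_, v, hle, hv, hl, fun v' hv' hl' => ?_⟩
  have := Nat.le_findGreatest (P := P) (n := cs.length x) (by omega) ⟨v', hv', hl'⟩
  omega

/-- If `x s_i` is longer than `x`, then `x` sends the simple root `α i` to a positive root. -/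
theorem geomRep_simpleRoot_nonneg (x : Wt) (i : B)
    (h : cs.length x < cs.length (x * cs.simple i)) : 0 ≤ cs.geomRep x (M.simpleRoot i) := by
  induction hn : cs.length x using Nat.strong_induction_on generalizing x i with
  | _ n ih =>
  subst hn
  by_cases hx : x = 1
  · subst hx
    simpa using M.simpleRoot_nonneg i
  obtain ⟨j, hj⟩ := cs.exists_rightDescent_of_ne_one hx
  have hij : i ≠ j := by
    rintro rfl
    exact absurd h (not_lt_of_gt hj)
  obtain ⟨k, v, hk0, hxv, hl, hmax⟩ := cs.exists_maximal_alternating_suffix (i := i) hj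
  -- A suffix of full dihedral length could be rewritten to end in `i`, and then `x s_i` would be
  -- shorter than `x`.
  have hkM : M i j = 0 ∨ k < M i j := by
    by_contra hcon
    push Not at hcon
    obtain ⟨ω, h1, h2⟩ := cs.alternatingWord_of_le_isRightDescent hcon.1 hcon.2
    have : x * cs.simple i = v * cs.wordProd ω := by
      rw [hxv, h2, mul_assoc, mul_assoc, simple_mul_simple_self, mul_one]
    have h3 := cs.length_mul_le v (cs.wordProd ω)
    have h4 := cs.length_wordProd_le ω
    rw [← this] at h3
    omega
  obtain ⟨k, rfl⟩ := Nat.exists_eq_succ_of_ne_zero hk0.ne'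
  -- If `v` had such a right descent `l`, then either `l` cancels the first letter of the suffix,
  -- which makes `x` too short, or `l` prolongs the suffix, against maximality.
  have hup : ∀ l, (l = i ∨ l = j) → cs.length v < cs.length (v * cs.simple l) := by
    intro l hl'
    by_contra hcon
    have hlt := (cs.length_mul_simple_lt_or v l).resolve_right hcon
    have hcase : l = (if Even k then j else i) ∨ l = (if Even (k + 1) then j else i) := by
      simp only [Nat.even_add_one]
      rcases hl' with rfl | rfl <;> by_cases hE : Even k <;> simp [hE]
    rcases hcase with hc | hc
    · have e : x = (v * cs.simple l) * cs.wordProd (alternatingWord i j k) := by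
        rw [hxv, alternatingWord_succ', wordProd_cons, ← hc, mul_assoc]
      have h3 := cs.length_mul_le (v * cs.simple l) (cs.wordProd (alternatingWord i j k))
      have h4 := cs.length_wordProd_le (alternatingWord i j k)
      rw [length_alternatingWord] at h4
      rw [← e] at h3
      omega
    · apply hmax (v * cs.simple l)
      · rw [alternatingWord_succ' i j (k + 1), wordProd_cons, ← hc, ← mul_assoc,
          simple_mul_simple_cancel_right]
        exact hxv
      · rcases cs.length_mul_simple v l with h | h <;> omega
  obtain ⟨p, q, hp, hq, e⟩ := cs.geomRep_alternatingWord_simpleRoot hij hkM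
  have hi := ih (cs.length v) (by omega) v i (hup i (Or.inl rfl)) rfl
  have hj' := ih (cs.length v) (by omega) v j (hup j (Or.inr rfl)) rfl
  rw [hxv, geomRep_mul_apply, e, map_add, map_smul, map_smul]
  exact add_nonneg (smul_nonneg hp hi) (smul_nonneg hq hj')

theorem geomRep_simpleRoot_nonpos (x : Wt) (i : B)
    (h : cs.length (x * cs.simple i) < cs.length x) : cs.geomRep x (M.simpleRoot i) ≤ 0 := by
  have := cs.geomRep_simpleRoot_nonneg (x * cs.simple i) i
    (by rwa [simple_mul_simple_cancel_right])
  rw [geomRep_mul_apply, geomRep_simple, CoxeterMatrix.simpleReflection_simpleRoot_self,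
    map_neg] at this
  exact neg_nonneg.mp this

theorem geomRep_simpleRoot_ne_zero (x : Wt) (i : B) : cs.geomRep x (M.simpleRoot i) ≠ 0 := by
  simpa using M.simpleRoot_ne_zero i

theorem length_mul_simple_lt_iff (x : Wt) (i : B) :
    cs.length (x * cs.simple i) < cs.length x ↔ cs.geomRep x (M.simpleRoot i) ≤ 0 := by
  refine ⟨cs.geomRep_simpleRoot_nonpos x i, fun h => ?_⟩
  by_contra hcon
  have := cs.geomRep_simpleRoot_nonneg x i ((cs.length_mul_simple_lt_or x i).resolve_left hcon)
  exact cs.geomRep_simpleRoot_ne_zero x i (le_antisymm h this)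

theorem geomRep_simpleRoot_nonneg_or_nonpos (x : Wt) (i : B) :
    0 ≤ cs.geomRep x (M.simpleRoot i) ∨ cs.geomRep x (M.simpleRoot i) ≤ 0 := by
  rcases cs.length_mul_simple_lt_or x i with h | h
  · exact Or.inr (cs.geomRep_simpleRoot_nonpos x i h)
  · exact Or.inl (cs.geomRep_simpleRoot_nonneg x i h)

end CoxeterSystem

/-! ### The invariant form and inversions. -/

namespace CoxeterMatrix

variable {B : Type*} (M : CoxeterMatrix B)

/-- Twice the invariant symmetric bilinear form of the reflection representation. -/
noncomputable def form : (B →₀ ℝ) →ₗ[ℝ] Module.Dual ℝ (B →₀ ℝ) :=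
  Finsupp.linearCombination ℝ M.simpleCoroot

theorem form_simpleRoot (i : B) : M.form (M.simpleRoot i) = M.simpleCoroot i := by
  simp [form, simpleRoot]

theorem form_apply_simpleRoot (i : B) (v : B →₀ ℝ) :
    M.form v (M.simpleRoot i) = M.simpleCoroot i v := by
  induction v using Finsupp.induction_linear with
  | zero => simp
  | add f g hf hg => rw [map_add, LinearMap.add_apply, map_add, hf, hg]
  | single j a =>
    have : (Finsupp.single j a : B →₀ ℝ) = a • M.simpleRoot j := by simp [simpleRoot]
    rw [this, map_smul, map_smul, LinearMap.smul_apply, form_simpleRoot, simpleCoroot_simpleRoot,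
      simpleCoroot_simpleRoot, M.symmetric i j]

theorem form_simpleReflection (i : B) (v w : B →₀ ℝ) :
    M.form (M.simpleReflection i v) (M.simpleReflection i w) = M.form v w := by
  simp only [simpleReflection_apply, map_sub, map_smul, LinearMap.sub_apply, LinearMap.smul_apply,
    form_simpleRoot, form_apply_simpleRoot, simpleCoroot_simpleRoot_self, smul_eq_mul]
  ring

end CoxeterMatrix

namespace CoxeterSystem

variable {B Wt : Type*} {M : CoxeterMatrix B} [Group Wt] (cs : CoxeterSystem M Wt)

theorem form_geomRep (x : Wt) (v w : B →₀ ℝ) :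
    M.form (cs.geomRep x v) (cs.geomRep x w) = M.form v w := by
  induction x using cs.simple_induction_left generalizing v w with
  | one => simp
  | mul_simple_left x i ih =>
    rw [geomRep_mul_apply, geomRep_mul_apply, geomRep_simple, M.form_simpleReflection, ih]

/-- The form is invariant and takes the same value on all simple roots. -/
theorem sq_eq_one_of_geomRep_simpleRoot_eq_smul {x : Wt} {i j : B} {c : ℝ}
    (h : cs.geomRep x (M.simpleRoot i) = c • M.simpleRoot j) : c ^ 2 = 1 := by
  have := cs.form_geomRep x (M.simpleRoot i) (M.simpleRoot i)
  rw [h, map_smul, map_smul, LinearMap.smul_apply, M.form_simpleRoot, M.form_simpleRoot,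
    M.simpleCoroot_simpleRoot_self, M.simpleCoroot_simpleRoot_self, smul_eq_mul, smul_eq_mul] at this
  linarith

/-- A simple reflection permutes the positive roots other than its simple root. -/
theorem simpleReflection_nonneg {x : Wt} {i j : B} (h : 0 ≤ cs.geomRep x (M.simpleRoot i))
    (hne : cs.geomRep x (M.simpleRoot i) ≠ M.simpleRoot j) :
    0 ≤ M.simpleReflection j (cs.geomRep x (M.simpleRoot i)) := by
  have hroot := cs.geomRep_simpleRoot_nonneg_or_nonpos (cs.simple j * x) i
  rw [geomRep_mul_apply, geomRep_simple] at hroot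
  refine hroot.resolve_right fun hneg => hne ?_
  set β := cs.geomRep x (M.simpleRoot i) with hβ
  -- The reflection changes only the coordinate `j`, so every other coordinate is both nonnegative
  -- and nonpositive.
  have hβj : β = β j • M.simpleRoot j := by
    ext k
    by_cases hk : k = j
    · subst hk
      simp [CoxeterMatrix.simpleRoot]
    · have h1 : β k ≤ 0 := by
        have := hneg k
        simpa [M.simpleReflection_apply, CoxeterMatrix.simpleRoot,
          Finsupp.single_eq_of_ne hk] using this
      have h2 : 0 ≤ β k := h k
      simp [CoxeterMatrix.simpleRoot, Finsupp.single_eq_of_ne hk, le_antisymm h1 h2]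
  have hsq := cs.sq_eq_one_of_geomRep_simpleRoot_eq_smul hβj
  have h0 : 0 ≤ β j := h j
  have h1 : β j = 1 := by nlinarith
  rw [hβj, h1, one_smul]

/-- If `x y` is a reduced product, then every inversion of `y` is an inversion of `x y`. -/
theorem geomRep_mul_nonpos_of_length_mul {x y z : Wt} {i : B}
    (hl : cs.length (x * y) = cs.length x + cs.length y)
    (hpos : 0 ≤ cs.geomRep z (M.simpleRoot i))
    (hneg : cs.geomRep y (cs.geomRep z (M.simpleRoot i)) ≤ 0) :
    cs.geomRep (x * y) (cs.geomRep z (M.simpleRoot i)) ≤ 0 := by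
  induction hn : cs.length x generalizing x y with
  | zero =>
    rw [length_eq_zero_iff] at hn
    rwa [hn, one_mul]
  | succ n ih =>
    have hx : x ≠ 1 := by
      rintro rfl
      simp at hn
    -- The last letter `s_j` of `x` is moved over to `y`; both `(x s_j)(s_j y)` and `s_j y` are
    -- again reduced products.
    obtain ⟨j, hj⟩ := cs.exists_rightDescent_of_ne_one hx
    have hj' : cs.length (x * cs.simple j) + 1 = cs.length x := cs.isRightDescent_iff.mp hj
    have hxy : x * cs.simple j * (cs.simple j * y) = x * y := by
      rw [← mul_assoc, simple_mul_simple_cancel_right]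
    have h1 := cs.length_mul_le (x * cs.simple j) (cs.simple j * y)
    rw [hxy] at h1
    have h2 : cs.length (cs.simple j * y) = cs.length y + 1 := by
      rcases cs.length_simple_mul y j with h | h <;> omega
    rw [← hxy]
    apply ih
    · rw [hxy]
      omega
    · have e : cs.geomRep y (cs.geomRep z (M.simpleRoot i)) =
          -cs.geomRep (y * (z * cs.simple i)) (M.simpleRoot i) := by
        rw [geomRep_mul_apply, geomRep_mul_apply, geomRep_simple,
          M.simpleReflection_simpleRoot_self, map_neg, map_neg, neg_neg]
      have hp : 0 ≤ cs.geomRep (y * (z * cs.simple i)) (M.simpleRoot i) := by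
        rw [e] at hneg
        exact neg_nonpos.mp hneg
      rw [geomRep_mul_apply, e, map_neg, geomRep_simple]
      apply neg_nonpos.mpr
      apply cs.simpleReflection_nonneg hp
      -- The only positive root made negative by `s_j` is `α_j`. If it were the negative of the
      -- image of the given root under `y`, then `y⁻¹ α_j` would be negative, whereas `s_j y` is
      -- longer than `y`.
      intro hα
      have hlt : cs.length y⁻¹ < cs.length (y⁻¹ * cs.simple j) := by
        rw [← cs.inv_simple, ← mul_inv_rev, length_inv, length_inv]
        omega
      have h3 := cs.geomRep_simpleRoot_nonneg _ _ hlt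
      rw [← hα, ← geomRep_mul_apply, inv_mul_cancel_left, geomRep_mul_apply, geomRep_simple,
        M.simpleReflection_simpleRoot_self, map_neg] at h3
      exact cs.geomRep_simpleRoot_ne_zero z i (le_antisymm (neg_nonneg.mp h3) hpos)
    · omega

/-- An inversion of `x s_j` is either `α_j` or the image under `s_j` of an inversion of `x`. -/
theorem finite_inversions (x : Wt) :
    {β : B →₀ ℝ | (∃ (z : Wt) (i : B), β = cs.geomRep z (M.simpleRoot i)) ∧ 0 ≤ β ∧
      cs.geomRep x β ≤ 0}.Finite := by
  induction x using cs.simple_induction_right with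
  | one =>
    apply Set.Finite.subset Set.finite_empty
    rintro _ ⟨⟨z, i, rfl⟩, h1, h2⟩
    exact cs.geomRep_simpleRoot_ne_zero z i (le_antisymm (by simpa using h2) h1)
  | mul_simple_right x j ih =>
    apply ((ih.image (M.simpleReflection j)).insert (M.simpleRoot j)).subset
    rintro _ ⟨⟨z, i, rfl⟩, h1, h2⟩
    by_cases hα : cs.geomRep z (M.simpleRoot i) = M.simpleRoot j
    · exact Or.inl hα
    right
    have h3 := cs.simpleReflection_nonneg h1 hα
    rw [geomRep_mul_apply, geomRep_simple] at h2
    refine ⟨_, ⟨⟨cs.simple j * z, i, ?_⟩, h3, h2⟩, ?_⟩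
    · rw [geomRep_mul_apply, geomRep_simple]
    · rw [← LinearEquiv.mul_apply, M.simpleReflection_mul_self]
      rfl

end CoxeterSystem

/-! ### Mixed shifts transport stable roots. -/

namespace TwistedCoxeterSystem

variable {B Wt Ω : Type*} {M : CoxeterMatrix B} [Group Wt] [Group Ω]
  (T : TwistedCoxeterSystem M Wt Ω)

theorem rep_mk_apply (x : Wt) (δ : Ω) (v : B →₀ ℝ) :
    T.rep ⟨x, δ⟩ v = T.cs.geomRep x (T.twistRep δ v) := rfl

theorem rep_mul_apply (u w : T.W) (v : B →₀ ℝ) : T.rep (u * w) v = T.rep u (T.rep w v) := by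
  rw [map_mul, LinearEquiv.mul_apply]

theorem rep_one_apply (v : B →₀ ℝ) : T.rep 1 v = v := by
  rw [map_one]
  rfl

theorem twistRep_geomRep (δ : Ω) (x : Wt) (v : B →₀ ℝ) :
    T.twistRep δ (T.cs.geomRep x v) = T.cs.geomRep (T.act δ x) (T.twistRep δ v) := by
  have h : (SemidirectProduct.inr δ * SemidirectProduct.inl x : T.W) =
      SemidirectProduct.inl (T.act δ x) * SemidirectProduct.inr δ := by
    rw [SemidirectProduct.inl_aut]
    simp
  have h' := DFunLike.congr_fun (congrArg T.rep h) v
  simpa [rep] using h'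

theorem twistRep_nonneg_iff (δ : Ω) (v : B →₀ ℝ) : 0 ≤ T.twistRep δ v ↔ 0 ≤ v := by
  have h (δ : Ω) (v : B →₀ ℝ) (hv : 0 ≤ v) : 0 ≤ T.twistRep δ v := by
    intro i
    simpa [twistRep] using hv _
  refine ⟨fun hv => ?_, h δ v⟩
  have := h δ⁻¹ _ hv
  rwa [← LinearEquiv.mul_apply, ← map_mul, inv_mul_cancel, map_one] at this

theorem geomRep_mem_roots {β : B →₀ ℝ} (hβ : β ∈ T.roots) (x : Wt) :
    T.cs.geomRep x β ∈ T.roots := by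
  obtain ⟨z, i, rfl⟩ := hβ
  exact ⟨x * z, i, by rw [CoxeterSystem.geomRep_mul_apply]⟩

theorem twistRep_mem_roots {β : B →₀ ℝ} (hβ : β ∈ T.roots) (δ : Ω) :
    T.twistRep δ β ∈ T.roots := by
  obtain ⟨z, i, rfl⟩ := hβ
  exact ⟨T.act δ z, T.perm δ i, by rw [twistRep_geomRep, twistRep_simpleRoot]⟩

theorem rep_mem_roots {β : B →₀ ℝ} (hβ : β ∈ T.roots) (w : T.W) : T.rep w β ∈ T.roots :=
  T.geomRep_mem_roots (T.twistRep_mem_roots hβ w.right) w.left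

theorem neg_mem_roots {β : B →₀ ℝ} (hβ : β ∈ T.roots) : -β ∈ T.roots := by
  obtain ⟨z, i, rfl⟩ := hβ
  refine ⟨z * T.cs.simple i, i, ?_⟩
  rw [CoxeterSystem.geomRep_mul_apply, CoxeterSystem.geomRep_simple,
    M.simpleReflection_simpleRoot_self, map_neg]

theorem nonneg_or_nonpos_of_mem_roots {β : B →₀ ℝ} (hβ : β ∈ T.roots) : 0 ≤ β ∨ β ≤ 0 := by
  obtain ⟨z, i, rfl⟩ := hβ
  exact T.cs.geomRep_simpleRoot_nonneg_or_nonpos z i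

theorem not_nonpos_of_mem_roots {β : B →₀ ℝ} (hβ : β ∈ T.roots) (h : 0 ≤ β) : ¬ β ≤ 0 := by
  obtain ⟨z, i, rfl⟩ := hβ
  exact fun h' => T.cs.geomRep_simpleRoot_ne_zero z i (le_antisymm h' h)

theorem length_mk (x : Wt) (δ : Ω) : T.length ⟨x, δ⟩ = T.cs.length x := rfl

theorem act_wordProd (δ : Ω) (ω : List B) :
    T.act δ (T.cs.wordProd ω) = T.cs.wordProd (ω.map (T.perm δ)) := by
  induction ω with
  | nil => simp
  | cons i ω ih =>
    rw [CoxeterSystem.wordProd_cons, map_mul, ih, List.map_cons, CoxeterSystem.wordProd_cons,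
      act_simple']

theorem length_act (δ : Ω) (x : Wt) : T.cs.length (T.act δ x) = T.cs.length x := by
  have h (δ : Ω) (x : Wt) : T.cs.length (T.act δ x) ≤ T.cs.length x := by
    obtain ⟨ω, hω, rfl⟩ := T.cs.exists_isReduced x
    rw [act_wordProd, hω.eq]
    simpa using T.cs.length_wordProd_le (ω.map (T.perm δ))
  apply le_antisymm (h δ x)
  have := h δ⁻¹ (T.act δ x)
  rwa [← MulAut.mul_apply, ← map_mul, inv_mul_cancel, map_one, MulAut.one_apply] at this

theorem length_inv (w : T.W) : T.length w⁻¹ = T.length w := by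
  rw [length, SemidirectProduct.inv_left, length_act, CoxeterSystem.length_inv, length]

/-- Twists preserve length and positivity, so they can be collected on the right, which leaves the
untwisted statement for `x` and `T.act δ y`. -/
theorem rep_mul_nonpos_of_length_mul {u w : T.W} (hl : T.length (u * w) = T.length u + T.length w)
    {β : B →₀ ℝ} (hβ : β ∈ T.roots) (hpos : 0 ≤ β) (hneg : T.rep w β ≤ 0) :
    T.rep (u * w) β ≤ 0 := by
  obtain ⟨x, δ⟩ := u
  obtain ⟨y, ε⟩ := w
  have e : (⟨x, δ⟩ * ⟨y, ε⟩ : T.W) = ⟨x * T.act δ y, δ * ε⟩ := rfl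
  obtain ⟨z, i, hz⟩ := T.twistRep_mem_roots hβ (δ * ε)
  rw [e, rep_mk_apply, hz]
  apply T.cs.geomRep_mul_nonpos_of_length_mul
  · rw [e, length_mk, length_mk, length_mk] at hl
    rw [hl, length_act]
  · rwa [← hz, twistRep_nonneg_iff]
  · rw [← hz, map_mul, LinearEquiv.mul_apply, ← twistRep_geomRep, ← neg_nonneg, ← map_neg,
      twistRep_nonneg_iff, neg_nonneg]
    exact hneg

theorem finite_inversions (w : T.W) : {β ∈ T.roots | 0 ≤ β ∧ T.rep w β ≤ 0}.Finite := by
  apply Set.Finite.subset ((T.cs.finite_inversions w.left).preimage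
    (T.twistRep w.right).injective.injOn)
  rintro β ⟨h1, h2, h3⟩
  exact ⟨T.twistRep_mem_roots h1 _, (T.twistRep_nonneg_iff _ _).mpr h2, h3⟩

theorem mem_stableRoots_iff {w : T.W} {β : B →₀ ℝ} :
    β ∈ T.stableRoots w ↔ β ∈ T.roots ∧
      ((∀ k : ℤ, 0 ≤ T.rep (w ^ k) β) ∨ ∀ k : ℤ, T.rep (w ^ k) β ≤ 0) := by
  refine and_congr_right fun hβ => or_congr (forall_congr' fun k => ?_) (forall_congr' fun k => ?_)
  · exact and_iff_right (T.rep_mem_roots hβ _)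
  · exact and_iff_right (T.rep_mem_roots hβ _)

theorem neg_mem_stableRoots {w : T.W} {β : B →₀ ℝ} (h : β ∈ T.stableRoots w) :
    -β ∈ T.stableRoots w := by
  rw [mem_stableRoots_iff] at h ⊢
  refine ⟨T.neg_mem_roots h.1, h.2.symm.imp (fun h k => ?_) (fun h k => ?_)⟩
  · rw [map_neg]
    exact neg_nonneg.mpr (h k)
  · rw [map_neg]
    exact neg_nonpos.mpr (h k)

theorem stableRoots_inv (w : T.W) : T.stableRoots w⁻¹ = T.stableRoots w := by
  ext β
  rw [mem_stableRoots_iff, mem_stableRoots_iff]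
  refine and_congr_right fun _ => or_congr ?_ ?_ <;>
  · constructor <;> intro h k <;> simpa using h (-k)

theorem rep_zpow_conj_apply (τ u : T.W) (k : ℤ) (β : B →₀ ℝ) :
    T.rep ((τ * u * τ⁻¹) ^ k) (T.rep τ β) = T.rep τ (T.rep (u ^ k) β) := by
  rw [conj_zpow, ← rep_mul_apply, ← rep_mul_apply, inv_mul_cancel_right]

/-- If `τ u` is a reduced product and `β` is a root whose `u`-orbit is positive, then `τ β` is
stable. -/
theorem rep_mem_stableRoots_of_length_add {τ u u' : T.W} (hu' : τ * u * τ⁻¹ = u')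
    (hl : T.length u = T.length u') (hadd : T.length (τ * u) = T.length u + T.length τ)
    {β : B →₀ ℝ} (hβ : β ∈ T.roots) (hpos : ∀ k : ℤ, 0 ≤ T.rep (u ^ k) β) :
    T.rep τ β ∈ T.stableRoots u' := by
  subst hu'
  rw [mem_stableRoots_iff]
  refine ⟨T.rep_mem_roots hβ τ, ?_⟩
  simp only [rep_zpow_conj_apply]
  by_cases hall : ∀ k : ℤ, 0 ≤ T.rep τ (T.rep (u ^ k) β)
  · exact Or.inl hall
  right
  push Not at hall
  obtain ⟨k₀, hk₀⟩ := hall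
  have hroot (k : ℤ) : T.rep (u ^ k) β ∈ T.roots := T.rep_mem_roots hβ _
  have hk₀' := (T.nonneg_or_nonpos_of_mem_roots (T.rep_mem_roots (hroot k₀) τ)).resolve_left hk₀
  -- The product `u' τ = τ u` is reduced, so the inversion `u ^ k β` of `τ` is one of `τ u`.
  have hstep (k : ℤ) (h : T.rep τ (T.rep (u ^ k) β) ≤ 0) :
      T.rep τ (T.rep (u ^ (k + 1)) β) ≤ 0 := by
    have e : τ * u * τ⁻¹ * τ = τ * u := inv_mul_cancel_right _ _
    have := T.rep_mul_nonpos_of_length_mul (u := τ * u * τ⁻¹) (w := τ)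
      (by rw [e, hadd, hl]) (hroot k) (hpos k) h
    rwa [e, rep_mul_apply, ← rep_mul_apply T u, ← zpow_one_add, add_comm] at this
  have hforward (n : ℕ) : T.rep τ (T.rep (u ^ (k₀ + n)) β) ≤ 0 := by
    induction n with
    | zero => simpa using hk₀'
    | succ n ih =>
      have := hstep _ ih
      rwa [add_assoc] at this
  -- From `k₀` on, all members of the orbit are inversions of `τ`, of which there are finitely many.
  have hnot : ¬ Function.Injective fun n : ℕ => T.rep (u ^ (k₀ + n)) β := by
    intro hinj
    refine Set.infinite_range_of_injective hinj ((T.finite_inversions τ).subset ?_)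
    rintro _ ⟨n, rfl⟩
    exact ⟨hroot _, hpos _, hforward n⟩
  obtain ⟨p, hp, hper⟩ : ∃ p : ℕ, 0 < p ∧ T.rep (u ^ (p : ℤ)) β = β := by
    have main (a b : ℕ) (hab : a < b)
        (h : T.rep (u ^ (k₀ + a)) β = T.rep (u ^ (k₀ + b)) β) :
        ∃ p : ℕ, 0 < p ∧ T.rep (u ^ (p : ℤ)) β = β := by
      refine ⟨b - a, by omega, ?_⟩
      have e : u ^ (k₀ + (b : ℤ)) = u ^ (k₀ + (a : ℤ)) * u ^ ((b - a : ℕ) : ℤ) := by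
        rw [← zpow_add]
        congr 1
        omega
      rw [e, rep_mul_apply] at h
      exact ((T.rep _).injective h).symm
    simp only [Function.Injective, not_forall] at hnot
    obtain ⟨a, b, h, hab⟩ := hnot
    rcases lt_or_gt_of_ne hab with h' | h'
    · exact main a b h' h
    · exact main b a h' h.symm
  intro k
  have hper' (n : ℕ) : T.rep (u ^ (k + n * p)) β = T.rep (u ^ k) β := by
    induction n with
    | zero => simp
    | succ n ih =>
      rw [← ih]
      have e : u ^ (k + ((n + 1 : ℕ) : ℤ) * p) = u ^ (k + (n : ℤ) * p) * u ^ (p : ℤ) := by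
        rw [← zpow_add]
        congr 1
        push_cast
        ring
      rw [e, rep_mul_apply, hper]
  -- By periodicity any exponent can be moved past `k₀`, where negativity is known.
  obtain ⟨n, hn⟩ : ∃ n : ℕ, k₀ ≤ k + n * p := by
    refine ⟨(k₀ - k).toNat, ?_⟩
    have h1 : k₀ - k ≤ ((k₀ - k).toNat : ℤ) := Int.self_le_toNat _
    have h2 : (1 : ℤ) ≤ p := by exact_mod_cast hp
    nlinarith [Int.natCast_nonneg (k₀ - k).toNat]
  obtain ⟨m, hm⟩ := Int.eq_ofNat_of_zero_le (sub_nonneg.mpr hn)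
  have e : k + n * p = k₀ + m := by linarith
  rw [← hper' n, e]
  exact hforward m

/-- If `u = τ⁻¹ (τ u)` is a reduced product and `β` is a root whose `u`-orbit is positive, then `τ β`
is stable. -/
theorem rep_mem_stableRoots_of_length_sub {τ u u' : T.W} (hu' : τ * u * τ⁻¹ = u')
    (hsub : T.length (τ * u) + T.length τ = T.length u)
    {β : B →₀ ℝ} (hβ : β ∈ T.roots) (hpos : ∀ k : ℤ, 0 ≤ T.rep (u ^ k) β) :
    T.rep τ β ∈ T.stableRoots u' := by
  subst hu'
  rw [mem_stableRoots_iff]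
  refine ⟨T.rep_mem_roots hβ τ, Or.inl fun k => ?_⟩
  rw [rep_zpow_conj_apply]
  by_contra hneg
  have hroot (k : ℤ) : T.rep (u ^ k) β ∈ T.roots := T.rep_mem_roots hβ _
  have hneg' := (T.nonneg_or_nonpos_of_mem_roots (T.rep_mem_roots (hroot k) τ)).resolve_left hneg
  have ek (v : B →₀ ℝ) : T.rep (u ^ k) v = T.rep u (T.rep (u ^ (k - 1)) v) := by
    rw [← rep_mul_apply, ← zpow_one_add]
    congr 3
    ring
  -- The positive root `u ^ (k - 1) β` is an inversion of `τ u`, hence of `u = τ⁻¹ (τ u)`, which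
  -- contradicts the positivity of `u ^ k β`.
  have := T.rep_mul_nonpos_of_length_mul (u := τ⁻¹) (w := τ * u)
    (by rw [inv_mul_cancel_left, length_inv, ← hsub, add_comm]) (hroot (k - 1)) (hpos (k - 1))
    (by rwa [rep_mul_apply, ← ek])
  rw [inv_mul_cancel_left, ← ek] at this
  exact T.not_nonpos_of_mem_roots (hroot k) (hpos k) this

/-- Negation reduces to positive orbits. A condition on `u τ⁻¹` becomes one on `τ u⁻¹`, and `u`,
`u⁻¹` have the same stable roots. -/
theorem rep_mem_stableRoots_of_step {τ u u' : T.W}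
    (h : T.IsStrongConj τ u u' ∨ T.IsCyclicShift τ u u') {β : B →₀ ℝ}
    (hβ : β ∈ T.stableRoots u) : T.rep τ β ∈ T.stableRoots u' := by
  have main (β : B →₀ ℝ) (hβ : β ∈ T.roots) (hpos : ∀ k : ℤ, 0 ≤ T.rep (u ^ k) β) :
      T.rep τ β ∈ T.stableRoots u' := by
    have hpos' : ∀ k : ℤ, 0 ≤ T.rep (u⁻¹ ^ k) β := fun k => by simpa using hpos (-k)
    have hlen : T.length (u * τ⁻¹) = T.length (τ * u⁻¹) := by
      rw [← length_inv, mul_inv_rev, inv_inv]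
    rcases h with ⟨h1, h2, h3 | h3⟩ | ⟨h1, h2, h3 | h3⟩
    · exact T.rep_mem_stableRoots_of_length_add h1 h2 h3 hβ hpos
    · rw [← stableRoots_inv]
      refine T.rep_mem_stableRoots_of_length_add (u := u⁻¹) ?_ ?_ ?_ hβ hpos'
      · rw [← h1]
        group
      · rw [length_inv, length_inv, h2]
      · rw [← hlen, h3, length_inv, length_inv]
    · exact T.rep_mem_stableRoots_of_length_sub h1 h3 hβ hpos
    · rw [← stableRoots_inv]
      refine T.rep_mem_stableRoots_of_length_sub (u := u⁻¹) ?_ ?_ hβ hpos'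
      · rw [← h1]
        group
      · rw [← hlen, length_inv, ← h3, length_inv]
  obtain ⟨hroot, hpos | hneg⟩ := T.mem_stableRoots_iff.mp hβ
  · exact main β hroot hpos
  · have := main (-β) (T.neg_mem_roots hroot) fun k => by
      rw [map_neg]
      exact neg_nonneg.mpr (hneg k)
    simpa using T.neg_mem_stableRoots this

theorem step_symm {τ u u' : T.W} (h : T.IsStrongConj τ u u' ∨ T.IsCyclicShift τ u u') :
    T.IsStrongConj τ⁻¹ u' u ∨ T.IsCyclicShift τ⁻¹ u' u := by
  have conj (h1 : τ * u * τ⁻¹ = u') : τ⁻¹ * u' * τ⁻¹⁻¹ = u ∧ u' * τ⁻¹⁻¹ = τ * u ∧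
      τ⁻¹ * u' = u * τ⁻¹ := by
    subst h1
    refine ⟨?_, ?_, ?_⟩ <;> group
  rcases h with ⟨h1, h2, h3⟩ | ⟨h1, h2, h3⟩
  · obtain ⟨e1, e2, e3⟩ := conj h1
    refine Or.inl ⟨e1, h2.symm, ?_⟩
    rw [e2, e3, inv_inv, ← h2]
    exact h3.symm
  · obtain ⟨e1, e2, e3⟩ := conj h1
    refine Or.inr ⟨e1, h2.symm, ?_⟩
    rw [e2, e3, inv_inv, ← h2]
    exact h3.symm

theorem rep_image_stableRoots_of_step {τ u u' : T.W}
    (h : T.IsStrongConj τ u u' ∨ T.IsCyclicShift τ u u') :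
    T.rep τ '' T.stableRoots u = T.stableRoots u' := by
  apply Set.Subset.antisymm
  · rintro _ ⟨β, hβ, rfl⟩
    exact T.rep_mem_stableRoots_of_step h hβ
  · intro β hβ
    refine ⟨T.rep τ⁻¹ β, T.rep_mem_stableRoots_of_step (T.step_symm h) hβ, ?_⟩
    rw [← rep_mul_apply, mul_inv_cancel, rep_one_apply]

theorem rep_image_fixedRoots (τ u : T.W) :
    T.rep τ '' T.fixedRoots u = T.fixedRoots (τ * u * τ⁻¹) := by
  have h (τ u : T.W) {β : B →₀ ℝ} (hβ : β ∈ T.fixedRoots u) :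
      T.rep τ β ∈ T.fixedRoots (τ * u * τ⁻¹) := by
    refine ⟨T.rep_mem_roots hβ.1 τ, ?_⟩
    rw [← rep_mul_apply, inv_mul_cancel_right, rep_mul_apply, hβ.2]
  apply Set.Subset.antisymm
  · rintro _ ⟨β, hβ, rfl⟩
    exact h τ u hβ
  · intro β hβ
    refine ⟨T.rep τ⁻¹ β, ?_, by rw [← rep_mul_apply, mul_inv_cancel, rep_one_apply]⟩
    have := h τ⁻¹ _ hβ
    have e : τ⁻¹ * (τ * u * τ⁻¹) * τ⁻¹⁻¹ = u := by group
    rwa [e] at this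

theorem rep_prod_image_of_mixedTran {K : Subgroup T.W} {w w' : T.W} {L : List T.W}
    (hL : L ∈ T.mixedTran K w w') :
    T.rep L.prod '' T.stableRoots w = T.stableRoots w' ∧
      T.rep L.prod '' T.fixedRoots w = T.fixedRoots w' := by
  obtain ⟨-, hL⟩ := hL
  induction L generalizing w' with
  | nil =>
    have h : w = w' := hL
    subst h
    simp
  | cons τ L ih =>
    obtain ⟨u, h1, h2⟩ := hL
    have e (S : Set (B →₀ ℝ)) : T.rep (τ :: L).prod '' S = T.rep τ '' (T.rep L.prod '' S) := by
      rw [List.prod_cons, Set.image_image]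
      exact Set.image_congr fun v _ => T.rep_mul_apply _ _ v
    rw [e, e, (ih h1).1, (ih h1).2, T.rep_image_stableRoots_of_step h2, rep_image_fixedRoots]
    refine ⟨rfl, ?_⟩
    rcases h2 with h | h <;> rw [h.1]

theorem isFirmlyConvex_iff_of_mixedShift {K : Subgroup T.W} {w w' : T.W}
    (h : T.MixedShift K w w') (hw : T.IsConvex w) (hw' : T.IsConvex w') :
    T.IsFirmlyConvex w ↔ T.IsFirmlyConvex w' := by
  obtain ⟨L, hL⟩ := h
  obtain ⟨h1, h2⟩ := T.rep_prod_image_of_mixedTran hL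
  rw [IsFirmlyConvex, IsFirmlyConvex, and_iff_right hw, and_iff_right hw', ← h1, ← h2,
    (T.rep L.prod).injective.image_injective.eq_iff]

end TwistedCoxeterSystem

/-! ### Pairs of right descents and dihedral longest elements. -/

namespace CoxeterSystem

variable {B Wt : Type*} {M : CoxeterMatrix B} [Group Wt] (cs : CoxeterSystem M Wt)

theorem reverse_alternatingWord (i j : B) (k : ℕ) :
    (alternatingWord i j k).reverse =
      if Even k then alternatingWord j i k else alternatingWord i j k := by
  induction k generalizing i j with
  | zero => simp [alternatingWord]
  | succ k ih =>
    rw [alternatingWord_succ, List.concat_eq_append, List.reverse_append, ih j i,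
      List.reverse_singleton, List.singleton_append]
    by_cases hk : Even k
    · have hk' : ¬ Even (k + 1) := by simpa [Nat.even_add_one] using hk
      rw [if_pos hk, if_neg hk', ← List.concat_eq_append, ← alternatingWord_succ,
        alternatingWord_succ', if_pos hk]
    · have hk' : Even (k + 1) := by simpa [Nat.even_add_one] using hk
      rw [if_neg hk, if_pos hk', alternatingWord_succ', if_neg hk]

theorem wordProd_braidWord_inv (i j : B) :
    (cs.wordProd (braidWord M i j))⁻¹ = cs.wordProd (braidWord M i j) := by
  rw [← wordProd_reverse, reverse_alternatingWord]
  split_ifs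
  · rw [cs.wordProd_braidWord_eq i j, braidWord, M.symmetric j i]
  · rfl

/-- The roots met along the alternating word stay in the cone of `α_i` and `α_j`, on which `x` is
negative, so every further letter is a right descent. -/
theorem length_mul_alternatingWord {x : Wt} {i j : B} (hij : i ≠ j)
    (hi : cs.length (x * cs.simple i) < cs.length x)
    (hj : cs.length (x * cs.simple j) < cs.length x) {k : ℕ} (hk : M i j = 0 ∨ k ≤ M i j) :
    cs.length (x * cs.wordProd (alternatingWord i j k)) + k = cs.length x := by
  induction k generalizing i j with
  | zero => simp [alternatingWord]
  | succ k ih =>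
    have hk' : M j i = 0 ∨ k < M j i := by
      rw [M.symmetric j i]
      omega
    have h1 := ih hij.symm hj hi (by omega)
    obtain ⟨p, q, hp, hq, e⟩ := cs.geomRep_alternatingWord_simpleRoot hij.symm hk'
    have hneg : cs.geomRep (x * cs.wordProd (alternatingWord j i k)) (M.simpleRoot j) ≤ 0 := by
      rw [length_mul_simple_lt_iff] at hi hj
      rw [geomRep_mul_apply, e, map_add, map_smul, map_smul]
      exact add_nonpos (smul_nonpos_of_nonneg_of_nonpos hp hj)
        (smul_nonpos_of_nonneg_of_nonpos hq hi)
    rw [← length_mul_simple_lt_iff] at hneg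
    rw [alternatingWord_succ, wordProd_concat, ← mul_assoc]
    rcases cs.length_mul_simple (x * cs.wordProd (alternatingWord j i k)) j with h | h <;> omega

/-- An element with two different right descents is right divisible by the longest element of the
dihedral group which they generate. -/
theorem exists_eq_mul_braidWord {x : Wt} {i j : B} (hij : i ≠ j)
    (hi : cs.length (x * cs.simple i) < cs.length x)
    (hj : cs.length (x * cs.simple j) < cs.length x) :
    M i j ≠ 0 ∧ ∃ y, x = y * cs.wordProd (braidWord M i j) ∧ cs.length y + M i j = cs.length x := by
  constructor
  · intro h0
    -- Without a braid relation the descent never stops, but `x` cannot lose more than its own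
    -- length.
    have := cs.length_mul_alternatingWord hij hi hj (k := cs.length x + 1) (Or.inl h0)
    omega
  · refine ⟨x * cs.wordProd (braidWord M i j), ?_,
      cs.length_mul_alternatingWord hij hi hj (Or.inr le_rfl)⟩
    have h := mul_inv_cancel (cs.wordProd (braidWord M i j))
    rw [cs.wordProd_braidWord_inv] at h
    rw [mul_assoc, h, mul_one]

end CoxeterSystem

/-! ### The braid monoid: words, length, reversal, parabolic submonoids. -/

namespace CoxeterMatrix

variable {B : Type*} (M : CoxeterMatrix B)

/-- The product of the generators of the braid monoid along a word. -/
def braidOfWord (ω : List B) : M.BraidMonoid :=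
  PresentedMonoid.mk M.BraidRel (FreeMonoid.ofList ω)

theorem braidOfWord_nil : M.braidOfWord [] = 1 := rfl

theorem braidOfWord_append (ω ω' : List B) :
    M.braidOfWord (ω ++ ω') = M.braidOfWord ω * M.braidOfWord ω' := by
  rw [braidOfWord, FreeMonoid.ofList_append, map_mul]
  rfl

theorem braidOfWord_singleton (i : B) :
    M.braidOfWord [i] = PresentedMonoid.of M.BraidRel i := rfl

theorem braidOfWord_cons (i : B) (ω : List B) :
    M.braidOfWord (i :: ω) = PresentedMonoid.of M.BraidRel i * M.braidOfWord ω :=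
  M.braidOfWord_append [i] ω

theorem braidOfWord_surjective : Function.Surjective M.braidOfWord := fun a => by
  obtain ⟨ω, rfl⟩ := PresentedMonoid.surjective_mk a
  exact ⟨FreeMonoid.toList ω, rfl⟩

theorem braidOfWord_braidWord (i j : B) :
    M.braidOfWord (CoxeterSystem.braidWord M i j) =
      M.braidOfWord (CoxeterSystem.braidWord M j i) :=
  PresentedMonoid.mk_eq_mk_of_rel ⟨i, j, rfl, rfl⟩

/-- A homomorphism out of the braid monoid is a family of elements satisfying the braid
relations. -/
def braidLift {N : Type*} [Monoid N] (f : B → N)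
    (h : ∀ i j, ((CoxeterSystem.braidWord M i j).map f).prod =
      ((CoxeterSystem.braidWord M j i).map f).prod) : M.BraidMonoid →* N :=
  PresentedMonoid.lift f (by
    rintro _ _ ⟨i, j, rfl, rfl⟩
    rw [FreeMonoid.lift_ofList, FreeMonoid.lift_ofList]
    exact h i j)

theorem braidLift_braidOfWord {N : Type*} [Monoid N] (f : B → N)
    (h : ∀ i j, ((CoxeterSystem.braidWord M i j).map f).prod =
      ((CoxeterSystem.braidWord M j i).map f).prod) (ω : List B) :
    M.braidLift f h (M.braidOfWord ω) = (ω.map f).prod :=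
  FreeMonoid.lift_ofList f ω

theorem braid_induction {p : M.BraidMonoid → Prop} (a : M.BraidMonoid) (one : p 1)
    (of_mul : ∀ i a, p a → p (PresentedMonoid.of M.BraidRel i * a)) : p a := by
  obtain ⟨ω, rfl⟩ := M.braidOfWord_surjective a
  induction ω with
  | nil => exact one
  | cons i ω ih =>
    rw [braidOfWord_cons]
    exact of_mul i _ ih

/-! ### Length -/

/-- The length homomorphism of the braid monoid. -/
def braidLengthHom : M.BraidMonoid →* Multiplicative ℕ :=
  M.braidLift (fun _ => Multiplicative.ofAdd 1) (by
    intro i j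
    simp [M.symmetric j i])

/-- The length of an element of the braid monoid. -/
def braidLength (a : M.BraidMonoid) : ℕ := (M.braidLengthHom a).toAdd

theorem braidLength_one : M.braidLength 1 = 0 := by
  simp [braidLength]

theorem braidLength_mul (a b : M.BraidMonoid) :
    M.braidLength (a * b) = M.braidLength a + M.braidLength b := by
  simp [braidLength]

theorem braidLength_of (i : B) : M.braidLength (PresentedMonoid.of M.BraidRel i) = 1 := rfl

theorem braidLength_braidOfWord (ω : List B) : M.braidLength (M.braidOfWord ω) = ω.length := by
  induction ω with
  | nil => exact M.braidLength_one
  | cons i ω ih =>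
    rw [braidOfWord_cons, braidLength_mul, ih, braidLength_of, List.length_cons, add_comm]

theorem eq_one_of_braidLength_eq_zero {a : M.BraidMonoid} (h : M.braidLength a = 0) : a = 1 := by
  obtain ⟨ω, rfl⟩ := M.braidOfWord_surjective a
  rw [braidLength_braidOfWord, List.length_eq_zero_iff] at h
  rw [h, braidOfWord_nil]

theorem exists_eq_mul_of {a : M.BraidMonoid} (h : a ≠ 1) :
    ∃ a' i, a = a' * PresentedMonoid.of M.BraidRel i := by
  obtain ⟨ω, rfl⟩ := M.braidOfWord_surjective a
  rcases List.eq_nil_or_concat ω with rfl | ⟨ω', i, rfl⟩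
  · exact absurd M.braidOfWord_nil h
  · exact ⟨M.braidOfWord ω', i, by
      rw [List.concat_eq_append, braidOfWord_append, braidOfWord_singleton]⟩

/-! ### Reversal -/

theorem prod_map_of (ω : List B) :
    (ω.map (PresentedMonoid.of M.BraidRel)).prod = M.braidOfWord ω := by
  induction ω with
  | nil => rfl
  | cons i ω ih => rw [List.map_cons, List.prod_cons, ih, braidOfWord_cons]

/-- The anti-automorphism of the braid monoid that reverses words. -/
def braidRevHom : M.BraidMonoid →* M.BraidMonoidᵐᵒᵖ :=
  M.braidLift (fun i => MulOpposite.op (PresentedMonoid.of M.BraidRel i)) (by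
    have key (ω : List B) : (ω.map fun i => MulOpposite.op (PresentedMonoid.of M.BraidRel i)).prod =
        MulOpposite.op (M.braidOfWord ω.reverse) := by
      rw [← prod_map_of, List.map_reverse, ← MulOpposite.unop_inj, MulOpposite.unop_list_prod,
        List.map_map]
      rfl
    intro i j
    rw [key, key, CoxeterSystem.reverse_alternatingWord, CoxeterSystem.reverse_alternatingWord,
      M.symmetric j i]
    have h := M.braidOfWord_braidWord i j
    rw [CoxeterSystem.braidWord, CoxeterSystem.braidWord, M.symmetric j i] at h
    split_ifs
    · rw [h]
    · rw [h])

/-- The reversal of an element of the braid monoid. -/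
def braidRev (a : M.BraidMonoid) : M.BraidMonoid := (M.braidRevHom a).unop

theorem braidRev_one : M.braidRev 1 = 1 := by
  simp [braidRev]

theorem braidRev_mul (a b : M.BraidMonoid) :
    M.braidRev (a * b) = M.braidRev b * M.braidRev a := by
  simp [braidRev]

theorem braidRev_of (i : B) : M.braidRev (PresentedMonoid.of M.BraidRel i) =
    PresentedMonoid.of M.BraidRel i := rfl

theorem braidRev_braidRev (a : M.BraidMonoid) : M.braidRev (M.braidRev a) = a := by
  induction a using M.braid_induction with
  | one => rw [braidRev_one, braidRev_one]
  | of_mul i a ih => rw [braidRev_mul, braidRev_mul, ih, braidRev_of, braidRev_of]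

/-! ### Standard parabolic submonoids -/

/-- The standard parabolic submonoid of the braid monoid. -/
def braidParabolic (J : Set B) : Submonoid M.BraidMonoid :=
  Submonoid.closure (PresentedMonoid.of M.BraidRel '' J)

open Classical in
-- An alternating word with at least two letters contains both `i` and `j`. Hence the two sides of a
-- braid relation have the same support.
theorem prod_indicator_alternatingWord (J : Set B) (i j : B) (m : ℕ) :
    ((CoxeterSystem.alternatingWord i j (m + 2)).map fun k => if k ∈ J then 1 else 0).prod =
      (if i ∈ J then 1 else 0) * (if j ∈ J then 1 else 0) := by
  induction m generalizing i j with
  | zero => simp [CoxeterSystem.alternatingWord]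
  | succ m ih =>
    rw [CoxeterSystem.alternatingWord_succ, List.concat_eq_append, List.map_append,
      List.prod_append, ih j i]
    by_cases hj : j ∈ J <;> simp [hj]

open Classical in
/-- The homomorphism that detects membership in a standard parabolic submonoid. -/
noncomputable def braidIndicator (J : Set B) : M.BraidMonoid →* ℕ :=
  M.braidLift (fun i => if i ∈ J then 1 else 0) (by
    intro i j
    rcases eq_or_ne i j with rfl | hij
    · rfl
    have h1 : M i j ≠ 1 := M.off_diagonal i j hij
    rw [CoxeterSystem.braidWord, CoxeterSystem.braidWord, M.symmetric j i]
    rcases Nat.eq_zero_or_pos (M i j) with h0 | hpos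
    · rw [h0]
      rfl
    obtain ⟨m, hm⟩ : ∃ m, M i j = m + 2 := ⟨M i j - 2, by omega⟩
    rw [hm, prod_indicator_alternatingWord, prod_indicator_alternatingWord, mul_comm])

theorem mem_braidParabolic_iff {J : Set B} {a : M.BraidMonoid} :
    a ∈ M.braidParabolic J ↔ M.braidIndicator J a = 1 := by
  constructor
  · intro h
    induction h using Submonoid.closure_induction with
    | mem x hx =>
      obtain ⟨i, hi, rfl⟩ := hx
      exact if_pos hi
    | one => exact map_one _
    | mul x y _ _ hx hy => rw [map_mul, hx, hy]
  · intro h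
    induction a using M.braid_induction with
    | one => exact one_mem _
    | of_mul i a ih =>
      rw [map_mul, mul_eq_one] at h
      refine mul_mem (Submonoid.subset_closure ⟨i, ?_, rfl⟩) (ih h.2)
      by_contra hi
      have h1 : M.braidIndicator J (PresentedMonoid.of M.BraidRel i) = 0 := if_neg hi
      rw [h1] at h
      exact zero_ne_one h.1

/-- A product of natural numbers is 1 only if both factors are. Closure under factors is what keeps
all later factorizations inside the parabolic submonoid. -/
theorem mul_mem_braidParabolic_iff {J : Set B} {a b : M.BraidMonoid} :
    a * b ∈ M.braidParabolic J ↔ a ∈ M.braidParabolic J ∧ b ∈ M.braidParabolic J := by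
  rw [mem_braidParabolic_iff, mem_braidParabolic_iff, mem_braidParabolic_iff, map_mul,
    mul_eq_one]

theorem of_mem_braidParabolic {J : Set B} {i : B} (hi : i ∈ J) :
    PresentedMonoid.of M.BraidRel i ∈ M.braidParabolic J :=
  Submonoid.subset_closure ⟨i, hi, rfl⟩

theorem braidRev_mem_braidParabolic {J : Set B} {a : M.BraidMonoid}
    (h : a ∈ M.braidParabolic J) : M.braidRev a ∈ M.braidParabolic J := by
  induction h using Submonoid.closure_induction with
  | mem x hx =>
    obtain ⟨i, hi, rfl⟩ := hx
    exact M.of_mem_braidParabolic hi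
  | one =>
    rw [braidRev_one]
    exact one_mem _
  | mul x y _ _ hx hy =>
    rw [braidRev_mul]
    exact mul_mem hy hx

end CoxeterMatrix

/-! ### Matsumoto's theorem and reduced braids. -/

namespace CoxeterSystem

variable {B Wt : Type*} {M : CoxeterMatrix B} [Group Wt] (cs : CoxeterSystem M Wt)

theorem braidOfWord_braidWord_mul {i j : B} (hM : M i j ≠ 0) :
    ∃ ω : List B, braidWord M i j = ω ++ [j] := by
  obtain ⟨m, hm⟩ := Nat.exists_eq_succ_of_ne_zero hM
  exact ⟨alternatingWord j i m, by rw [braidWord, hm, alternatingWord_succ,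
    List.concat_eq_append]⟩

theorem length_wordProd_mul_simple_lt {ω : List B} {i : B} (h : cs.IsReduced (ω ++ [i])) :
    cs.length (cs.wordProd (ω ++ [i]) * cs.simple i) < cs.length (cs.wordProd (ω ++ [i])) := by
  rw [h.eq, wordProd_append, wordProd_singleton, simple_mul_simple_cancel_right]
  have := cs.length_wordProd_le ω
  simp
  omega

theorem isReduced_left_of_append {ω ω' : List B} (h : cs.IsReduced (ω ++ ω')) :
    cs.IsReduced ω := by
  simpa using h.take ω.length

/-- Matsumoto's theorem: two reduced words of the same element give the same braid. -/
theorem braidOfWord_eq_of_isReduced {ω ω' : List B} (h : cs.IsReduced ω) (h' : cs.IsReduced ω')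
    (e : cs.wordProd ω = cs.wordProd ω') : M.braidOfWord ω = M.braidOfWord ω' := by
  induction hn : ω.length generalizing ω ω' with
  | zero =>
    have hl : ω'.length = 0 := by rw [← h'.eq, ← e, h.eq, hn]
    rw [List.length_eq_zero_iff.mp hn, List.length_eq_zero_iff.mp hl]
  | succ n ih =>
    have hl : ω'.length = n + 1 := by rw [← h'.eq, ← e, h.eq, hn]
    rcases List.eq_nil_or_concat' ω with rfl | ⟨ω₁, i, rfl⟩
    · simp at hn
    rcases List.eq_nil_or_concat' ω' with rfl | ⟨ω₁', j, rfl⟩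
    · simp at hl
    have hi := cs.length_wordProd_mul_simple_lt h
    have hj := cs.length_wordProd_mul_simple_lt h'
    have hn₁ : ω₁.length = n := by simpa using hn
    have hn₁' : ω₁'.length = n := by simpa using hl
    have h₁ := cs.isReduced_left_of_append h
    have h₁' := cs.isReduced_left_of_append h'
    by_cases hij : i = j
    · subst hij
      rw [M.braidOfWord_append, M.braidOfWord_append, ih h₁ h₁' ?_ hn₁]
      simpa [wordProd_append] using e
    · rw [← e] at hj
      obtain ⟨hM, y, hy, hyl⟩ := cs.exists_eq_mul_braidWord hij hi hj
      obtain ⟨η, hη, rfl⟩ := cs.exists_isReduced y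
      -- When the last letters differ, each word is compared with a word that ends in the dihedral
      -- braid word with the same last letter. Induction applies after removing that letter, and the
      -- two comparison words differ by one braid relation.
      have key (ω₂ : List B) (k l : B) (h₂ : cs.IsReduced (ω₂ ++ [l])) (hn₂ : ω₂.length = n)
          (hM' : M k l = M i j)
          (e₂ : cs.wordProd (ω₂ ++ [l]) = cs.wordProd (η ++ braidWord M k l)) :
          M.braidOfWord (ω₂ ++ [l]) = M.braidOfWord (η ++ braidWord M k l) := by
        obtain ⟨ω₃, hω₃⟩ := braidOfWord_braidWord_mul (i := k) (j := l) (hM' ▸ hM)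
        rw [hω₃, ← List.append_assoc, M.braidOfWord_append, M.braidOfWord_append (η ++ ω₃)]
        rw [hω₃, ← List.append_assoc] at e₂
        have hred : cs.IsReduced (η ++ ω₃ ++ [l]) := by
          have e3 : ω₃.length + 1 = M k l := by
            rw [← length_alternatingWord k l (M k l), ← braidWord, hω₃]
            simp
          rw [IsReduced, ← e₂, h₂.eq]
          rw [hη.eq, h.eq, hn] at hyl
          simp
          omega
        rw [ih (cs.isReduced_left_of_append h₂) (cs.isReduced_left_of_append hred) ?_ hn₂]
        rw [wordProd_append, wordProd_append _ (η ++ ω₃)] at e₂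
        exact mul_right_cancel e₂
      rw [key ω₁ j i h hn₁ (M.symmetric j i) ?_, key ω₁' i j h' hn₁' rfl ?_,
        M.braidOfWord_append, M.braidOfWord_append, M.braidOfWord_braidWord]
      · rw [← e, hy, wordProd_append]
      · rw [hy, wordProd_append, cs.wordProd_braidWord_eq]

/-- The reduced braid of an element of a Coxeter group. -/
noncomputable def redBraid (x : Wt) : M.BraidMonoid :=
  M.braidOfWord (cs.exists_isReduced x).choose

theorem redBraid_wordProd {ω : List B} (h : cs.IsReduced ω) :
    cs.redBraid (cs.wordProd ω) = M.braidOfWord ω := by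
  have hs := (cs.exists_isReduced (cs.wordProd ω)).choose_spec
  exact cs.braidOfWord_eq_of_isReduced hs.1 h hs.2.symm

theorem redBraid_mul {x y : Wt} (h : cs.length (x * y) = cs.length x + cs.length y) :
    cs.redBraid (x * y) = cs.redBraid x * cs.redBraid y := by
  obtain ⟨ω, hω, rfl⟩ := cs.exists_isReduced x
  obtain ⟨ω', hω', rfl⟩ := cs.exists_isReduced y
  have hr : cs.IsReduced (ω ++ ω') := by
    rw [IsReduced, wordProd_append, h, hω.eq, hω'.eq, List.length_append]
  rw [cs.redBraid_wordProd hω, cs.redBraid_wordProd hω', ← M.braidOfWord_append,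
    ← cs.redBraid_wordProd hr, wordProd_append]

theorem redBraid_one : cs.redBraid 1 = 1 := by
  have : cs.IsReduced [] := by simp [IsReduced]
  rw [← cs.wordProd_nil, cs.redBraid_wordProd this, M.braidOfWord_nil]

theorem redBraid_simple (i : B) : cs.redBraid (cs.simple i) = PresentedMonoid.of M.BraidRel i := by
  have : cs.IsReduced [i] := by simp [IsReduced]
  rw [← cs.wordProd_singleton, cs.redBraid_wordProd this, M.braidOfWord_singleton]

/-- The projection of the braid monoid to the Coxeter group. -/
def braidProj : M.BraidMonoid →* Wt :=
  M.braidLift cs.simple fun i j => cs.wordProd_braidWord_eq i j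

theorem braidProj_braidOfWord (ω : List B) :
    cs.braidProj (M.braidOfWord ω) = cs.wordProd ω :=
  M.braidLift_braidOfWord _ _ ω

theorem braidProj_redBraid (x : Wt) : cs.braidProj (cs.redBraid x) = x := by
  rw [redBraid, braidProj_braidOfWord]
  exact (cs.exists_isReduced x).choose_spec.2.symm

theorem redBraid_injective : Function.Injective cs.redBraid :=
  Function.LeftInverse.injective cs.braidProj_redBraid

theorem braidLength_redBraid (x : Wt) : M.braidLength (cs.redBraid x) = cs.length x := by
  have h := (cs.exists_isReduced x).choose_spec
  rw [redBraid, M.braidLength_braidOfWord, ← h.1.eq, ← h.2]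

theorem length_braidProj_le (a : M.BraidMonoid) :
    cs.length (cs.braidProj a) ≤ M.braidLength a := by
  obtain ⟨ω, rfl⟩ := M.braidOfWord_surjective a
  rw [braidProj_braidOfWord, M.braidLength_braidOfWord]
  exact cs.length_wordProd_le ω

theorem eq_redBraid_of_braidLength {a : M.BraidMonoid}
    (h : M.braidLength a ≤ cs.length (cs.braidProj a)) : a = cs.redBraid (cs.braidProj a) := by
  obtain ⟨ω, rfl⟩ := M.braidOfWord_surjective a
  rw [braidProj_braidOfWord, M.braidLength_braidOfWord] at h
  rw [braidProj_braidOfWord]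
  exact (cs.redBraid_wordProd (le_antisymm (cs.length_wordProd_le ω) h)).symm

/-- The factors of a reduced braid are reduced. -/
theorem exists_of_mul_eq_redBraid {a b : M.BraidMonoid} {x : Wt} (h : a * b = cs.redBraid x) :
    ∃ y z, a = cs.redBraid y ∧ b = cs.redBraid z ∧ x = y * z ∧
      cs.length x = cs.length y + cs.length z := by
  have e := congrArg cs.braidProj h
  rw [map_mul, braidProj_redBraid] at e
  have el := congrArg M.braidLength h
  rw [M.braidLength_mul, braidLength_redBraid] at el
  have h1 := cs.length_braidProj_le a
  have h2 := cs.length_braidProj_le b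
  have h3 := cs.length_mul_le (cs.braidProj a) (cs.braidProj b)
  rw [e] at h3
  refine ⟨_, _, cs.eq_redBraid_of_braidLength ?_, cs.eq_redBraid_of_braidLength ?_, e.symm, ?_⟩ <;>
  omega

theorem length_mul_of_redBraid_mul {x y z : Wt}
    (h : cs.redBraid x * cs.redBraid y = cs.redBraid z) :
    z = x * y ∧ cs.length (x * y) = cs.length x + cs.length y := by
  have e := congrArg cs.braidProj h
  rw [map_mul, braidProj_redBraid, braidProj_redBraid, braidProj_redBraid] at e
  have el := congrArg M.braidLength h
  rw [M.braidLength_mul, braidLength_redBraid, braidLength_redBraid, braidLength_redBraid,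
    ← e] at el
  exact ⟨e.symm, el.symm⟩

/-- For the direction from the group to the monoid, generators are multiplied on one at a time; when
the length drops, the new reduced braid is a factor of the old one, and factors stay in the
submonoid. -/
theorem redBraid_mem_braidParabolic_iff {J : Set B} {x : Wt} :
    cs.redBraid x ∈ M.braidParabolic J ↔ x ∈ Subgroup.closure (cs.simple '' J) := by
  constructor
  · intro h
    have main : ∀ a ∈ M.braidParabolic J, cs.braidProj a ∈ Subgroup.closure (cs.simple '' J) := by
      intro a ha
      induction ha using Submonoid.closure_induction with
      | mem a ha =>
        obtain ⟨i, hi, rfl⟩ := ha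
        exact Subgroup.subset_closure ⟨i, hi, rfl⟩
      | one =>
        rw [map_one]
        exact one_mem _
      | mul a b _ _ ha hb =>
        rw [map_mul]
        exact mul_mem ha hb
    have := main _ h
    rwa [braidProj_redBraid] at this
  · intro h
    have main (i : B) (hi : i ∈ J) (y : Wt) (hy : cs.redBraid y ∈ M.braidParabolic J) :
        cs.redBraid (cs.simple i * y) ∈ M.braidParabolic J := by
      rcases cs.length_simple_mul y i with hl | hl
      · rw [redBraid_mul, redBraid_simple]
        · exact mul_mem (M.of_mem_braidParabolic hi) hy
        · rw [hl, length_simple, add_comm]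
      · have e : cs.redBraid y = cs.redBraid (cs.simple i) * cs.redBraid (cs.simple i * y) := by
          rw [← redBraid_mul, simple_mul_simple_cancel_left]
          rw [simple_mul_simple_cancel_left, length_simple]
          omega
        rw [e, M.mul_mem_braidParabolic_iff] at hy
        exact hy.2
    induction h using Subgroup.closure_induction_left with
    | one =>
      rw [redBraid_one]
      exact one_mem _
    | mul_left x hx y _ ih =>
      obtain ⟨i, hi, rfl⟩ := hx
      exact main i hi y ih
    | inv_mul_cancel x hx y _ ih =>
      obtain ⟨i, hi, rfl⟩ := hx
      rw [inv_simple]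
      exact main i hi y ih

end CoxeterSystem

/-! ### The lattice property of the weak order. -/

/-- A form of Newman's lemma: a graded set with a least element in which any two covers of an
element have a common upper bound has a greatest element. -/
theorem exists_greatest_of_locally_directed {X : Type*} {le cov : X → X → Prop} {len : X → ℕ}
    {D : Set X} {bot : X} {N : ℕ} (hrefl : ∀ u, le u u)
    (htrans : ∀ u v w, le u v → le v w → le u w)
    (hlt : ∀ u v, le u v → u ≠ v → len u < len v) (hcov : ∀ u v, cov u v → len u < len v)
    (hbot : bot ∈ D) (hbot_le : ∀ v ∈ D, le bot v) (hN : ∀ v ∈ D, len v ≤ N)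
    (hex : ∀ u ∈ D, ∀ v ∈ D, le u v → u ≠ v → ∃ c ∈ D, cov u c ∧ le c v)
    (hdir : ∀ u ∈ D, ∀ c ∈ D, ∀ c' ∈ D, cov u c → cov u c' → ∃ w ∈ D, le c w ∧ le c' w) :
    ∃ m ∈ D, ∀ v ∈ D, le v m := by
  have hmax (u : X) (hu : u ∈ D) : ∃ m ∈ D, le u m ∧ ∀ v ∈ D, le m v → v = m := by
    induction hn : N - len u using Nat.strong_induction_on generalizing u with
    | _ n ih =>
    by_cases h : ∀ v ∈ D, le u v → v = u
    · exact ⟨u, hu, hrefl u, h⟩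
    push Not at h
    obtain ⟨v, hv, huv, hne⟩ := h
    have h1 := hlt u v huv hne.symm
    have h2 := hN v hv
    obtain ⟨m, hm, hvm, hm'⟩ := ih (N - len v) (by omega) v hv rfl
    exact ⟨m, hm, htrans _ _ _ huv hvm, hm'⟩
  -- Diamond argument: with covers `c ≤ m` and `c' ≤ m'` of `u`, a maximal element above a common
  -- bound of `c` and `c'` equals both `m` and `m'` by induction.
  have huniq (u : X) (hu : u ∈ D) (m m' : X) (hm : m ∈ D) (hm' : m' ∈ D) (hum : le u m)
      (hum' : le u m') (h : ∀ v ∈ D, le m v → v = m) (h' : ∀ v ∈ D, le m' v → v = m') : m = m' := by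
    induction hn : N - len u using Nat.strong_induction_on generalizing u m m' with
    | _ n ih =>
    by_cases e : u = m
    · subst e
      exact (h m' hm' hum').symm
    by_cases e' : u = m'
    · subst e'
      exact h' m hm hum
    obtain ⟨c, hc, huc, hcm⟩ := hex u hu m hm hum e
    obtain ⟨c', hc', huc', hcm'⟩ := hex u hu m' hm' hum' e'
    obtain ⟨w, hw, hcw, hcw'⟩ := hdir u hu c hc c' hc' huc huc'
    obtain ⟨m₀, hm₀, hwm₀, h₀⟩ := hmax w hw
    have l1 := hcov _ _ huc
    have l2 := hcov _ _ huc'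
    have l3 := hN c hc
    have l4 := hN c' hc'
    rw [ih (N - len c) (by omega) c hc m m₀ hm hm₀ hcm (htrans _ _ _ hcw hwm₀) h h₀ rfl,
      ih (N - len c') (by omega) c' hc' m' m₀ hm' hm₀ hcm' (htrans _ _ _ hcw' hwm₀) h' h₀ rfl]
  obtain ⟨m, hm, -, h⟩ := hmax bot hbot
  refine ⟨m, hm, fun v hv => ?_⟩
  obtain ⟨m', hm', hvm', h'⟩ := hmax v hv
  rwa [huniq bot hbot m m' hm hm' (hbot_le m hm) (hbot_le m' hm') h h']

namespace CoxeterSystem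

variable {B Wt : Type*} {M : CoxeterMatrix B} [Group Wt] (cs : CoxeterSystem M Wt)

/-! ### The weak order -/

/-- The weak order: `x` is a suffix of a reduced word of `y`. -/
def SuffixLE (x y : Wt) : Prop := cs.length (y * x⁻¹) + cs.length x = cs.length y

theorem suffixLE_mul_iff {u x : Wt} :
    cs.SuffixLE x (u * x) ↔ cs.length (u * x) = cs.length u + cs.length x := by
  rw [SuffixLE, mul_inv_cancel_right, eq_comm]

theorem SuffixLE.exists_eq_mul {x y : Wt} (h : cs.SuffixLE x y) :
    ∃ u, y = u * x ∧ cs.length (u * x) = cs.length u + cs.length x := by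
  refine ⟨y * x⁻¹, by simp, ?_⟩
  rw [inv_mul_cancel_right]
  exact h.symm

theorem suffixLE_refl (x : Wt) : cs.SuffixLE x x := by
  simp [SuffixLE]

theorem one_suffixLE (x : Wt) : cs.SuffixLE 1 x := by
  simp [SuffixLE]

theorem SuffixLE.trans {x y z : Wt} (h : cs.SuffixLE x y) (h' : cs.SuffixLE y z) :
    cs.SuffixLE x z := by
  obtain ⟨u, rfl, hu⟩ := h.exists_eq_mul
  obtain ⟨v, rfl, hv⟩ := h'.exists_eq_mul
  rw [← mul_assoc, suffixLE_mul_iff]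
  have h1 := cs.length_mul_le v u
  have h2 := cs.length_mul_le (v * u) x
  rw [mul_assoc] at h2 ⊢
  omega

theorem SuffixLE.length_lt {x y : Wt} (h : cs.SuffixLE x y) (hne : x ≠ y) :
    cs.length x < cs.length y := by
  have : cs.length (y * x⁻¹) ≠ 0 := by
    rw [Ne, length_eq_zero_iff, mul_inv_eq_one]
    exact hne.symm
  have h' : cs.length (y * x⁻¹) + cs.length x = cs.length y := h
  omega

theorem SuffixLE.antisymm {x y : Wt} (h : cs.SuffixLE x y) (h' : cs.SuffixLE y x) : x = y := by
  by_contra hne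
  have := h.length_lt cs hne
  have := h'.length_lt cs (Ne.symm hne)
  omega

/-- Right multiplication by `y` identifies the suffixes of `t` with the interval from `y` to `t y`.
-/
theorem suffixLE_iff_mul_right {u t y : Wt} (h : cs.length (t * y) = cs.length t + cs.length y) :
    cs.SuffixLE u t ↔
      cs.length (u * y) = cs.length u + cs.length y ∧ cs.SuffixLE (u * y) (t * y) := by
  have e : t * y * (u * y)⁻¹ = t * u⁻¹ := by group
  simp only [SuffixLE, e, h]
  have h1 := cs.length_mul_le (t * u⁻¹) (u * y)
  have e1 : t * u⁻¹ * (u * y) = t * y := by group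
  have h2 := cs.length_mul_le u y
  rw [e1] at h1
  constructor
  · intro hu
    constructor <;> omega
  · rintro ⟨h3, h4⟩
    omega

theorem simple_suffixLE_iff {i : B} {x : Wt} :
    cs.SuffixLE (cs.simple i) x ↔ cs.length (x * cs.simple i) < cs.length x := by
  rw [SuffixLE, inv_simple, length_simple]
  rcases cs.length_mul_simple x i with h | h <;> omega

theorem length_wordProd_braidWord_mul_simple_lt {i j : B} (hM : M i j ≠ 0)
    (hl : cs.length (cs.wordProd (braidWord M i j)) = M i j) :
    cs.SuffixLE (cs.simple j) (cs.wordProd (braidWord M i j)) := by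
  obtain ⟨ω, hω⟩ := braidOfWord_braidWord_mul hM
  rw [simple_suffixLE_iff]
  rw [hω] at hl ⊢
  apply cs.length_wordProd_mul_simple_lt
  rw [IsReduced, hl, ← hω, length_alternatingWord]

theorem braidWord_suffixLE {x : Wt} {i j : B} (hij : i ≠ j) (hi : cs.SuffixLE (cs.simple i) x)
    (hj : cs.SuffixLE (cs.simple j) x) :
    M i j ≠ 0 ∧ cs.length (cs.wordProd (braidWord M i j)) = M i j ∧
      cs.SuffixLE (cs.wordProd (braidWord M i j)) x ∧
      cs.SuffixLE (cs.simple i) (cs.wordProd (braidWord M i j)) ∧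
      cs.SuffixLE (cs.simple j) (cs.wordProd (braidWord M i j)) := by
  rw [simple_suffixLE_iff] at hi hj
  obtain ⟨hM, y, rfl, hy⟩ := cs.exists_eq_mul_braidWord hij hi hj
  have h1 := cs.length_mul_le y (cs.wordProd (braidWord M i j))
  have h2 : cs.length (cs.wordProd (braidWord M i j)) ≤ M i j :=
    (cs.length_wordProd_le _).trans_eq (length_alternatingWord _ _ _)
  have hl : cs.length (cs.wordProd (braidWord M i j)) = M i j := by omega
  refine ⟨hM, hl, ?_, ?_, cs.length_wordProd_braidWord_mul_simple_lt hM hl⟩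
  · rw [suffixLE_mul_iff]
    omega
  · rw [cs.wordProd_braidWord_eq] at hl ⊢
    rw [M.symmetric i j] at hM hl
    exact cs.length_wordProd_braidWord_mul_simple_lt hM hl

theorem exists_simple_mul_suffixLE {u v : Wt} (h : cs.SuffixLE u v) (hne : u ≠ v) :
    ∃ i, cs.length (cs.simple i * u) = cs.length u + 1 ∧ cs.SuffixLE (cs.simple i * u) v := by
  obtain ⟨t, rfl, ht⟩ := h.exists_eq_mul
  have ht1 : t ≠ 1 := by
    rintro rfl
    simp at hne
  obtain ⟨i, hi⟩ := cs.exists_rightDescent_of_ne_one ht1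
  obtain ⟨h1, h2⟩ := (cs.suffixLE_iff_mul_right ht).mp (cs.simple_suffixLE_iff.mpr hi)
  exact ⟨i, by rw [h1, length_simple, add_comm], h2⟩

theorem wordProd_alternatingWord_mem {H : Subgroup Wt} {i j : B} (hi : cs.simple i ∈ H)
    (hj : cs.simple j ∈ H) (k : ℕ) : cs.wordProd (alternatingWord i j k) ∈ H := by
  induction k generalizing i j with
  | zero => simp [alternatingWord]
  | succ k ih =>
    rw [alternatingWord_succ, wordProd_concat]
    exact mul_mem (ih hj hi) hj

theorem SuffixLE.mem_parabolic {J : Set B} {x y : Wt} (h : cs.SuffixLE x y)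
    (hy : y ∈ Subgroup.closure (cs.simple '' J)) : x ∈ Subgroup.closure (cs.simple '' J) := by
  obtain ⟨u, rfl, hu⟩ := h.exists_eq_mul
  rw [← redBraid_mem_braidParabolic_iff, cs.redBraid_mul hu, M.mul_mem_braidParabolic_iff] at hy
  exact cs.redBraid_mem_braidParabolic_iff.mp hy.2

/-- Newman's lemma applies to the common suffixes lying in the parabolic subgroup: two covers `s_i
u` and `s_j u` are bounded by `w u`, with `w` the longest element of the dihedral group of `i` and
`j`. -/
theorem exists_greatest_lower_bound (J : Set B) {U : Set Wt} (hU : U.Nonempty) :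
    ∃ m ∈ Subgroup.closure (cs.simple '' J), (∀ u ∈ U, cs.SuffixLE m u) ∧
      ∀ v ∈ Subgroup.closure (cs.simple '' J), (∀ u ∈ U, cs.SuffixLE v u) → cs.SuffixLE v m := by
  obtain ⟨x₀, hx₀⟩ := hU
  have key := exists_greatest_of_locally_directed (le := cs.SuffixLE)
    (cov := fun u c => ∃ i, c = cs.simple i * u ∧ cs.length c = cs.length u + 1)
    (len := cs.length)
    (D := {v | v ∈ Subgroup.closure (cs.simple '' J) ∧ ∀ u ∈ U, cs.SuffixLE v u})
    (bot := 1) (N := cs.length x₀) cs.suffixLE_refl (fun u v w h h' => h.trans cs h')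
    (fun u v h hne => h.length_lt cs hne) ?_ ?_ ?_ ?_ ?_ ?_
  · obtain ⟨m, ⟨h1, h2⟩, h3⟩ := key
    exact ⟨m, h1, h2, fun v hv hv' => h3 v ⟨hv, hv'⟩⟩
  · rintro u v ⟨i, -, h⟩
    omega
  · exact ⟨one_mem _, fun u _ => cs.one_suffixLE u⟩
  · exact fun v _ => cs.one_suffixLE v
  · intro v hv
    have : cs.length (x₀ * v⁻¹) + cs.length v = cs.length x₀ := hv.2 x₀ hx₀
    omega
  · intro u hu v hv huv hne
    obtain ⟨i, h1, h2⟩ := cs.exists_simple_mul_suffixLE huv hne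
    exact ⟨_, ⟨h2.mem_parabolic cs hv.1, fun x hx => h2.trans cs (hv.2 x hx)⟩, ⟨i, rfl, h1⟩, h2⟩
  · rintro u hu c hc c' hc' ⟨i, rfl, hi⟩ ⟨j, rfl, hj⟩
    by_cases hij : i = j
    · subst hij
      exact ⟨_, hc, cs.suffixLE_refl _, cs.suffixLE_refl _⟩
    have key (x : Wt) (hx : x ∈ U) :
        cs.SuffixLE (cs.wordProd (braidWord M i j) * u) x ∧
        cs.SuffixLE (cs.simple i * u) (cs.wordProd (braidWord M i j) * u) ∧
        cs.SuffixLE (cs.simple j * u) (cs.wordProd (braidWord M i j) * u) := by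
      obtain ⟨t, rfl, ht⟩ := (hu.2 x hx).exists_eq_mul
      have hi' := (cs.suffixLE_iff_mul_right ht).mpr
        ⟨by rw [hi, length_simple, add_comm], hc.2 _ hx⟩
      have hj' := (cs.suffixLE_iff_mul_right ht).mpr
        ⟨by rw [hj, length_simple, add_comm], hc'.2 _ hx⟩
      obtain ⟨-, -, h1, h2, h3⟩ := cs.braidWord_suffixLE hij hi' hj'
      obtain ⟨h4, h5⟩ := (cs.suffixLE_iff_mul_right ht).mp h1
      exact ⟨h5, ((cs.suffixLE_iff_mul_right h4).mp h2).2,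
        ((cs.suffixLE_iff_mul_right h4).mp h3).2⟩
    have hmem := cs.wordProd_alternatingWord_mem ((Subgroup.mul_mem_cancel_right _ hu.1).mp hc.1)
      ((Subgroup.mul_mem_cancel_right _ hu.1).mp hc'.1) (M i j)
    exact ⟨_, ⟨mul_mem hmem hu.1, fun x hx => (key x hx).1⟩, (key x₀ hx₀).2⟩

theorem geomRep_nonpos_of_simpleRoot {x : Wt} (h : ∀ i, cs.geomRep x (M.simpleRoot i) ≤ 0)
    {v : B →₀ ℝ} (hv : 0 ≤ v) : cs.geomRep x v ≤ 0 := by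
  have e : v = v.sum fun i a => a • M.simpleRoot i := by
    conv_lhs => rw [← Finsupp.sum_single v]
    exact Finsupp.sum_congr fun i _ => by simp [CoxeterMatrix.simpleRoot]
  rw [e, map_finsuppSum]
  apply Finset.sum_nonpos
  intro i _
  beta_reduce
  rw [map_smul]
  exact smul_nonpos_of_nonneg_of_nonpos (hv i) (h i)

section Finite

variable [Finite Wt]

/-- An element of maximal length makes all simple roots negative, hence all positive roots. So it
can be stripped on the right along any reduced word, each letter being a descent. -/
theorem exists_longest : ∃ w : Wt, ∀ x, cs.SuffixLE x w := by
  obtain ⟨w, hw⟩ := Finite.exists_max cs.length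
  have hdesc (i : B) : cs.geomRep w (M.simpleRoot i) ≤ 0 := by
    rw [← length_mul_simple_lt_iff]
    have := hw (w * cs.simple i)
    rcases cs.length_mul_simple w i with h | h <;> omega
  refine ⟨w, fun x => ?_⟩
  induction hn : cs.length x generalizing x with
  | zero =>
    rw [length_eq_zero_iff] at hn
    rw [hn]
    exact cs.one_suffixLE w
  | succ n ih =>
    have hx : x ≠ 1 := by
      rintro rfl
      simp at hn
    obtain ⟨i, hi⟩ := cs.exists_leftDescent_of_ne_one hx
    have hi' := cs.isLeftDescent_iff.mp hi
    have h1 := ih (cs.simple i * x) (by omega)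
    have hlt : cs.length (cs.simple i * x)⁻¹ <
        cs.length ((cs.simple i * x)⁻¹ * cs.simple i) := by
      rw [mul_inv_rev, inv_simple, simple_mul_simple_cancel_right, ← cs.length_inv x⁻¹, inv_inv,
        ← cs.length_inv (x⁻¹ * _), mul_inv_rev, inv_inv, inv_simple]
      omega
    have h2 := cs.geomRep_nonpos_of_simpleRoot hdesc (cs.geomRep_simpleRoot_nonneg _ _ hlt)
    rw [← geomRep_mul_apply, ← length_mul_simple_lt_iff] at h2
    have h3 : cs.length (w * (cs.simple i * x)⁻¹) + cs.length (cs.simple i * x) = cs.length w := h1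
    have e : w * (cs.simple i * x)⁻¹ * cs.simple i = w * x⁻¹ := by
      rw [mul_inv_rev, inv_simple, ← mul_assoc, simple_mul_simple_cancel_right]
    rw [e] at h2
    have h4 := cs.length_mul_simple (w * (cs.simple i * x)⁻¹) i
    rw [e] at h4
    rw [SuffixLE]
    omega

/-- All simple reflections are right descents of the longest element, so for `i ≠ j` the dihedral
longest element is one of its suffixes. -/
theorem isReduced_braidWord (i j : B) : cs.IsReduced (braidWord M i j) := by
  rw [IsReduced, length_alternatingWord]
  rcases eq_or_ne i j with rfl | hij
  · rw [braidWord, M.diagonal]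
    simp [alternatingWord]
  obtain ⟨w, hw⟩ := cs.exists_longest
  exact (cs.braidWord_suffixLE hij (hw _) (hw _)).2.1

theorem exists_join (x y : Wt) : ∃ m, cs.SuffixLE x m ∧ cs.SuffixLE y m ∧
    ∀ z, cs.SuffixLE x z → cs.SuffixLE y z → cs.SuffixLE m z := by
  obtain ⟨w, hw⟩ := cs.exists_longest
  obtain ⟨m, -, h1, h2⟩ := cs.exists_greatest_lower_bound Set.univ
    (U := {z | cs.SuffixLE x z ∧ cs.SuffixLE y z}) ⟨w, hw x, hw y⟩
  rw [Set.image_univ, cs.subgroup_closure_range_simple] at h2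
  exact ⟨m, h2 x trivial fun u hu => hu.1, h2 y trivial fun u hu => hu.2,
    fun z hx hy => h1 z ⟨hx, hy⟩⟩

/-- The join in the weak order of a finite Coxeter group. -/
noncomputable def join (x y : Wt) : Wt := (cs.exists_join x y).choose

theorem suffixLE_join_left (x y : Wt) : cs.SuffixLE x (cs.join x y) :=
  (cs.exists_join x y).choose_spec.1

theorem suffixLE_join_right (x y : Wt) : cs.SuffixLE y (cs.join x y) :=
  (cs.exists_join x y).choose_spec.2.1

theorem join_suffixLE {x y z : Wt} (hx : cs.SuffixLE x z) (hy : cs.SuffixLE y z) :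
    cs.SuffixLE (cs.join x y) z :=
  (cs.exists_join x y).choose_spec.2.2 z hx hy

theorem join_comm (x y : Wt) : cs.join x y = cs.join y x :=
  (cs.join_suffixLE (cs.suffixLE_join_right y x) (cs.suffixLE_join_left y x)).antisymm cs
    (cs.join_suffixLE (cs.suffixLE_join_right x y) (cs.suffixLE_join_left x y))

/-- The largest parabolic suffix of the join lies above `x` and `y`, so it is the join. -/
theorem join_mem_parabolic {J : Set B} {x y : Wt} (hx : x ∈ Subgroup.closure (cs.simple '' J))
    (hy : y ∈ Subgroup.closure (cs.simple '' J)) :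
    cs.join x y ∈ Subgroup.closure (cs.simple '' J) := by
  obtain ⟨m, hm, h1, h2⟩ := cs.exists_greatest_lower_bound J (U := {cs.join x y}) ⟨_, rfl⟩
  have hxm := h2 x hx fun u hu => by
    rw [Set.mem_singleton_iff.mp hu]
    exact cs.suffixLE_join_left x y
  have hym := h2 y hy fun u hu => by
    rw [Set.mem_singleton_iff.mp hu]
    exact cs.suffixLE_join_right x y
  rwa [(cs.join_suffixLE hxm hym).antisymm cs (h1 _ rfl)]

/-- The residue of `x` modulo `y`: the element which `y` has to be multiplied with to obtain the
join of `x` and `y`. -/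
noncomputable def residue (x y : Wt) : Wt := cs.join x y * y⁻¹

theorem residue_mul (x y : Wt) : cs.residue x y * y = cs.join x y := by
  simp [residue]

theorem length_residue_mul (x y : Wt) :
    cs.length (cs.residue x y * y) = cs.length (cs.residue x y) + cs.length y := by
  rw [← suffixLE_mul_iff, residue_mul]
  exact cs.suffixLE_join_right x y

theorem residue_mul_comm (x y : Wt) : cs.residue x y * y = cs.residue y x * x := by
  rw [residue_mul, residue_mul, join_comm]

theorem join_self (x : Wt) : cs.join x x = x :=
  (cs.join_suffixLE (cs.suffixLE_refl x) (cs.suffixLE_refl x)).antisymm cs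
    (cs.suffixLE_join_left x x)

theorem join_one (x : Wt) : cs.join x 1 = x :=
  (cs.join_suffixLE (cs.suffixLE_refl x) (cs.one_suffixLE x)).antisymm cs
    (cs.suffixLE_join_left x 1)

theorem residue_self (x : Wt) : cs.residue x x = 1 := by
  rw [residue, join_self, mul_inv_cancel]

theorem residue_one_left (x : Wt) : cs.residue 1 x = 1 := by
  rw [residue, join_comm, join_one, mul_inv_cancel]

theorem residue_one_right (x : Wt) : cs.residue x 1 = x := by
  rw [residue, join_one, inv_one, mul_one]

/-- Elements above `y` correspond to their left quotients by `y`; under this correspondence the join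
of `x` and `z y` becomes the join of `residue x y` and `z`. -/
theorem join_mul {x y z : Wt} (h : cs.length (z * y) = cs.length z + cs.length y) :
    cs.join x (z * y) = cs.join (cs.residue x y) z * y ∧
      cs.length (cs.join (cs.residue x y) z * y) =
        cs.length (cs.join (cs.residue x y) z) + cs.length y := by
  have hy : cs.SuffixLE y (z * y) := cs.suffixLE_mul_iff.mpr h
  obtain ⟨t, ht, htl⟩ := (hy.trans cs (cs.suffixLE_join_right x (z * y))).exists_eq_mul
  have h1 : cs.SuffixLE (cs.residue x y) t := by
    rw [cs.suffixLE_iff_mul_right htl]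
    refine ⟨cs.length_residue_mul x y, ?_⟩
    rw [residue_mul, ← ht]
    exact cs.join_suffixLE (cs.suffixLE_join_left _ _)
      (hy.trans cs (cs.suffixLE_join_right _ _))
  have h2 : cs.SuffixLE z t := by
    rw [cs.suffixLE_iff_mul_right htl]
    exact ⟨h, ht ▸ cs.suffixLE_join_right _ _⟩
  obtain ⟨h3, h4⟩ := (cs.suffixLE_iff_mul_right htl).mp (cs.join_suffixLE h1 h2)
  refine ⟨?_, h3⟩
  rw [← ht] at h4
  refine (cs.join_suffixLE ?_ ?_).antisymm cs h4
  · have h5 := ((cs.suffixLE_iff_mul_right h3).mp (cs.suffixLE_join_left (cs.residue x y) z)).2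
    rw [residue_mul] at h5
    exact (cs.suffixLE_join_left x y).trans cs h5
  · exact ((cs.suffixLE_iff_mul_right h3).mp (cs.suffixLE_join_right (cs.residue x y) z)).2

theorem residue_mul_right {x y z : Wt} (h : cs.length (z * y) = cs.length z + cs.length y) :
    cs.residue x (z * y) = cs.residue (cs.residue x y) z := by
  rw [residue, (cs.join_mul h).1, mul_inv_rev, mul_assoc, mul_inv_cancel_left]
  rfl

/-- The square of `x` and `y` is stacked with the square of `residue x y` and `z`; the composite
side remains reduced. -/
theorem residue_mul_left {x y z : Wt} (h : cs.length (z * y) = cs.length z + cs.length y) :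
    cs.residue (z * y) x = cs.residue z (cs.residue x y) * cs.residue y x ∧
      cs.length (cs.residue z (cs.residue x y) * cs.residue y x) =
        cs.length (cs.residue z (cs.residue x y)) + cs.length (cs.residue y x) := by
  have e : cs.residue (z * y) x = cs.residue z (cs.residue x y) * cs.residue y x := by
    apply mul_right_cancel (b := x)
    rw [residue_mul, join_comm, (cs.join_mul h).1, mul_assoc, ← residue_mul_comm, join_comm,
      ← residue_mul, mul_assoc]
  refine ⟨e, ?_⟩
  rw [← e]
  have h1 := cs.length_residue_mul (z * y) x
  have h2 := cs.length_residue_mul z (cs.residue x y)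
  have h3 := cs.length_residue_mul x y
  have h4 := cs.length_residue_mul y x
  have h5 := (cs.join_mul (x := x) h).2
  rw [← residue_mul_comm] at h4
  rw [residue_mul, join_comm] at h2
  rw [residue_mul, join_comm, (cs.join_mul h).1] at h1
  omega

/-! ### The action of the braid monoid by residues -/

/-- The action of a generator of the braid monoid by residues. -/
noncomputable def residueMap (i : B) : Function.End (Wt × M.BraidMonoid) :=
  fun p => (cs.residue p.1 (cs.simple i), cs.redBraid (cs.residue (cs.simple i) p.1) * p.2)

/-- Along a reduced word the operators depend only on the element it represents. Braid words being
reduced, this gives the braid relations. -/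
theorem prod_map_residueMap {ω : List B} (h : cs.IsReduced ω) (p : Wt × M.BraidMonoid) :
    (ω.map cs.residueMap).prod p = (cs.residue p.1 (cs.wordProd ω),
      cs.redBraid (cs.residue (cs.wordProd ω) p.1) * p.2) := by
  induction ω generalizing p with
  | nil =>
    rw [wordProd_nil, residue_one_right, residue_one_left, redBraid_one, one_mul]
    rfl
  | cons i ω ih =>
    have hω : cs.IsReduced ω := by simpa using h.drop 1
    have hl : cs.length (cs.simple i * cs.wordProd ω) =
        cs.length (cs.simple i) + cs.length (cs.wordProd ω) := by
      rw [← wordProd_cons, h.eq, hω.eq, length_simple, List.length_cons, add_comm]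
    rw [List.map_cons, List.prod_cons]
    change cs.residueMap i ((ω.map cs.residueMap).prod p) = _
    rw [ih hω, wordProd_cons, cs.residue_mul_right hl, (cs.residue_mul_left hl).1,
      cs.redBraid_mul (cs.residue_mul_left hl).2, mul_assoc]
    rfl

theorem prod_map_residueMap_braidWord (i j : B) :
    ((braidWord M i j).map cs.residueMap).prod = ((braidWord M j i).map cs.residueMap).prod := by
  funext p
  rw [cs.prod_map_residueMap (cs.isReduced_braidWord i j),
    cs.prod_map_residueMap (cs.isReduced_braidWord j i), cs.wordProd_braidWord_eq]

/-- The action of the braid monoid by residues. -/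
noncomputable def residueAct : M.BraidMonoid →* Function.End (Wt × M.BraidMonoid) :=
  M.braidLift cs.residueMap cs.prod_map_residueMap_braidWord

theorem residueAct_redBraid (y : Wt) (p : Wt × M.BraidMonoid) :
    cs.residueAct (cs.redBraid y) p =
      (cs.residue p.1 y, cs.redBraid (cs.residue y p.1) * p.2) := by
  obtain ⟨ω, hω, rfl⟩ := cs.exists_isReduced y
  rw [cs.redBraid_wordProd hω, residueAct, M.braidLift_braidOfWord, cs.prod_map_residueMap hω]

theorem residueAct_of (i : B) (p : Wt × M.BraidMonoid) :
    cs.residueAct (PresentedMonoid.of M.BraidRel i) p = (cs.residue p.1 (cs.simple i),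
      cs.redBraid (cs.residue (cs.simple i) p.1) * p.2) := rfl

theorem residueAct_mul (a b : M.BraidMonoid) (p : Wt × M.BraidMonoid) :
    cs.residueAct (a * b) p = cs.residueAct a (cs.residueAct b p) := by
  rw [map_mul]
  rfl

theorem residueAct_one (p : Wt × M.BraidMonoid) : cs.residueAct 1 p = p := by
  rw [map_one]
  rfl

theorem residueAct_fst_one (a c : M.BraidMonoid) : cs.residueAct a (1, c) = (1, a * c) := by
  induction a using M.braid_induction with
  | one => rw [residueAct_one, one_mul]
  | of_mul i a ih =>
    rw [residueAct_mul, ih, residueAct_of, residue_one_left, residue_one_right, redBraid_simple,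
      mul_assoc]

/-- Stacking commuting squares, one per letter of `a`, completes `a` and `b_x` to a common left
multiple. The second coordinate records the side `b` opposite to `a`. -/
theorem redBraid_residueAct_mul (a c : M.BraidMonoid) (x : Wt) :
    ∃ b, cs.residueAct a (x, c) = ((cs.residueAct a (x, 1)).1, b * c) ∧
      cs.redBraid (cs.residueAct a (x, 1)).1 * a = b * cs.redBraid x := by
  induction a using M.braid_induction with
  | one => exact ⟨1, by rw [residueAct_one, residueAct_one, one_mul], by
      rw [residueAct_one, mul_one, one_mul]⟩
  | of_mul i a ih =>
    obtain ⟨b, h1, h2⟩ := ih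
    set r := (cs.residueAct a (x, 1)).1 with hr
    refine ⟨cs.redBraid (cs.residue (cs.simple i) r) * b, ?_, ?_⟩
    · rw [residueAct_mul, residueAct_mul, h1, residueAct_of, residueAct_of, mul_assoc]
    · rw [residueAct_mul, residueAct_of, ← hr, mul_assoc, ← h2, ← mul_assoc, ← mul_assoc,
        ← cs.redBraid_simple, ← cs.redBraid_mul (cs.length_residue_mul _ _), residue_mul_comm,
        cs.redBraid_mul (cs.length_residue_mul _ _)]

/-- The action recovers `a` from `a s_i`: the generator sends `(s_i, 1)` to `(1, 1)`, which `a`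
sends to `(1, a)`. -/
theorem braid_mul_right_cancel (cs : CoxeterSystem M Wt) {a b c : M.BraidMonoid}
    (h : a * c = b * c) : a = b := by
  induction c using M.braid_induction generalizing a b with
  | one => simpa using h
  | of_mul i c ih =>
    rw [← mul_assoc, ← mul_assoc] at h
    have h' := congrArg (fun z => cs.residueAct z (cs.simple i, 1)) (ih h)
    simp only [cs.residueAct_mul, cs.residueAct_of, cs.residue_self, cs.redBraid_one,
      cs.residueAct_fst_one,
      mul_one] at h'
    exact congrArg Prod.snd h'

theorem braid_mul_left_cancel (cs : CoxeterSystem M Wt) {a b c : M.BraidMonoid}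
    (h : c * a = c * b) : a = b := by
  have h' := congrArg M.braidRev h
  rw [M.braidRev_mul, M.braidRev_mul] at h'
  have h'' := congrArg M.braidRev (cs.braid_mul_right_cancel h')
  rwa [M.braidRev_braidRev, M.braidRev_braidRev] at h''

end Finite

end CoxeterSystem

/-! ### Right divisibility and greatest common right divisors. -/

/-- Right divisibility. -/
def RightDivides {A : Type*} [Mul A] (d a : A) : Prop := ∃ c, a = c * d

theorem RightDivides.refl {A : Type*} [Monoid A] (a : A) : RightDivides a a :=
  ⟨1, (one_mul a).symm⟩

theorem RightDivides.trans {A : Type*} [Monoid A] {a b c : A} (h : RightDivides a b)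
    (h' : RightDivides b c) :
    RightDivides a c := by
  obtain ⟨u, rfl⟩ := h
  obtain ⟨v, rfl⟩ := h'
  exact ⟨v * u, (mul_assoc _ _ _).symm⟩

theorem RightDivides.mul_left {A : Type*} [Monoid A] {a b : A} (h : RightDivides a b) (c : A) :
    RightDivides a (c * b) := h.trans ⟨c, rfl⟩

theorem RightDivides.mul_right {A : Type*} [Monoid A] {a b : A} (h : RightDivides a b) (c : A) :
    RightDivides (a * c) (b * c) := by
  obtain ⟨u, rfl⟩ := h
  exact ⟨u, mul_assoc _ _ _⟩

theorem RightDivides.map {A A' : Type*} [Monoid A] [Monoid A'] (φ : A →* A') {a b : A}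
    (h : RightDivides a b) : RightDivides (φ a) (φ b) := by
  obtain ⟨u, rfl⟩ := h
  exact ⟨φ u, map_mul _ _ _⟩

namespace CoxeterSystem

variable {B Wt : Type*} {M : CoxeterMatrix B} [Group Wt] (cs : CoxeterSystem M Wt)

theorem SuffixLE.rightDivides {x y : Wt} (h : cs.SuffixLE x y) :
    RightDivides (cs.redBraid x) (cs.redBraid y) := by
  obtain ⟨u, rfl, hu⟩ := h.exists_eq_mul
  exact ⟨_, cs.redBraid_mul hu⟩

variable [Finite Wt]

/-- The first coordinate is the part of `x` that `a` does not absorb. -/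
theorem redBraid_rightDivides_iff {x : Wt} {a : M.BraidMonoid} :
    RightDivides (cs.redBraid x) a ↔ (cs.residueAct a (x, 1)).1 = 1 := by
  constructor
  · rintro ⟨c, rfl⟩
    rw [residueAct_mul, residueAct_redBraid, residue_self, residueAct_fst_one]
  · intro h
    obtain ⟨b, -, h2⟩ := cs.redBraid_residueAct_mul a 1 x
    rw [h, redBraid_one, one_mul] at h2
    exact ⟨b, h2⟩

/-- Write `a = c b_x`. The divisibility criterion for `y` and `a` turns into the criterion for
`residue y x` and `c`. -/
theorem redBraid_join_rightDivides {x y : Wt} {a : M.BraidMonoid}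
    (hx : RightDivides (cs.redBraid x) a)
    (hy : RightDivides (cs.redBraid y) a) : RightDivides (cs.redBraid (cs.join x y)) a := by
  obtain ⟨c, rfl⟩ := hx
  rw [redBraid_rightDivides_iff, residueAct_mul, residueAct_redBraid] at hy
  obtain ⟨b, h1, -⟩ := cs.redBraid_residueAct_mul c (cs.redBraid (cs.residue x y) * 1)
    (cs.residue y x)
  rw [h1] at hy
  rw [join_comm, ← residue_mul, cs.redBraid_mul (cs.length_residue_mul y x)]
  exact (cs.redBraid_rightDivides_iff.mpr hy).mul_right _

/-- Greatest common right divisors exist in the braid monoid of a finite Coxeter group. -/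
theorem exists_rightGcd (cs : CoxeterSystem M Wt) (a b : M.BraidMonoid) :
    ∃ d, RightDivides d a ∧ RightDivides d b ∧
      ∀ e, RightDivides e a → RightDivides e b → RightDivides e d := by
  have key := exists_greatest_of_locally_directed (le := RightDivides)
    (cov := fun u c => ∃ i, c = PresentedMonoid.of M.BraidRel i * u)
    (len := M.braidLength) (D := {v | RightDivides v a ∧ RightDivides v b}) (bot := 1)
    (N := M.braidLength a) RightDivides.refl (fun u v w => RightDivides.trans) ?_ ?_ ?_ ?_ ?_ ?_ ?_
  · obtain ⟨d, ⟨h1, h2⟩, h3⟩ := key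
    exact ⟨d, h1, h2, fun e h h' => h3 e ⟨h, h'⟩⟩
  · rintro u _ ⟨c, rfl⟩ hne
    rw [M.braidLength_mul]
    have : M.braidLength c ≠ 0 := by
      intro h0
      rw [M.eq_one_of_braidLength_eq_zero h0, one_mul] at hne
      exact hne rfl
    omega
  · rintro u _ ⟨i, rfl⟩
    rw [M.braidLength_mul, M.braidLength_of]
    omega
  · exact ⟨⟨a, (mul_one a).symm⟩, ⟨b, (mul_one b).symm⟩⟩
  · exact fun v _ => ⟨v, (mul_one v).symm⟩
  · rintro v ⟨⟨c, rfl⟩, -⟩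
    rw [M.braidLength_mul]
    omega
  · rintro u hu _ hv ⟨c, rfl⟩ hne
    have hc : c ≠ 1 := by
      rintro rfl
      rw [one_mul] at hne
      exact hne rfl
    obtain ⟨c', i, rfl⟩ := M.exists_eq_mul_of hc
    have h1 : RightDivides (PresentedMonoid.of M.BraidRel i * u)
        (c' * PresentedMonoid.of M.BraidRel i * u) := ⟨c', mul_assoc _ _ _⟩
    exact ⟨_, ⟨h1.trans hv.1, h1.trans hv.2⟩, ⟨i, rfl⟩, h1⟩
  · rintro u hu _ hc _ hc' ⟨i, rfl⟩ ⟨j, rfl⟩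
    have main {x : M.BraidMonoid} (hu : RightDivides u x)
        (hi : RightDivides (PresentedMonoid.of M.BraidRel i * u) x)
        (hj : RightDivides (PresentedMonoid.of M.BraidRel j * u) x) :
        RightDivides (cs.redBraid (cs.join (cs.simple i) (cs.simple j)) * u) x := by
      obtain ⟨x', rfl⟩ := hu
      obtain ⟨p, hp⟩ := hi
      obtain ⟨q, hq⟩ := hj
      rw [← mul_assoc] at hp hq
      apply RightDivides.mul_right
      apply cs.redBraid_join_rightDivides
      · rw [redBraid_simple]
        exact ⟨p, cs.braid_mul_right_cancel hp⟩
      · rw [redBraid_simple]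
        exact ⟨q, cs.braid_mul_right_cancel hq⟩
    refine ⟨_, ⟨main hu.1 hc.1 hc'.1, main hu.2 hc.2 hc'.2⟩, ?_, ?_⟩
    · rw [← cs.redBraid_simple]
      exact ((cs.suffixLE_join_left _ _).rightDivides cs).mul_right u
    · rw [← cs.redBraid_simple]
      exact ((cs.suffixLE_join_right _ _).rightDivides cs).mul_right u

/-- A common right divisor of `b X` and `c X` divides `d X`, for `d` the greatest common right
divisor of `b` and `c`. -/
theorem rightDivides_gcd_mul (cs : CoxeterSystem M Wt) {b c d X e : M.BraidMonoid}
    (hd : ∀ e, RightDivides e b → RightDivides e c → RightDivides e d)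
    (h1 : RightDivides e (b * X)) (h2 : RightDivides e (c * X)) : RightDivides e (d * X) := by
  obtain ⟨g, g1, g2, g3⟩ := cs.exists_rightGcd (b * X) (c * X)
  refine (g3 e h1 h2).trans ?_
  -- The greatest common divisor of `b X` and `c X` is a multiple `f X`; cancelling `X` shows that
  -- `f` divides `b` and `c`.
  obtain ⟨f, rfl⟩ := g3 X ⟨b, rfl⟩ ⟨c, rfl⟩
  obtain ⟨u, hu⟩ := g1
  obtain ⟨v, hv⟩ := g2
  rw [← mul_assoc] at hu hv
  exact (hd f ⟨u, cs.braid_mul_right_cancel hu⟩ ⟨v, cs.braid_mul_right_cancel hv⟩).mul_right X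

end CoxeterSystem

namespace CoxeterSystem

variable {B Wt : Type*} {M : CoxeterMatrix B} [Group Wt] (cs : CoxeterSystem M Wt) [Finite Wt]

/-! ### The Garside element -/

/-- The longest element of a finite Coxeter group. -/
noncomputable def longest : Wt := cs.exists_longest.choose

theorem suffixLE_longest (x : Wt) : cs.SuffixLE x cs.longest := cs.exists_longest.choose_spec x

theorem eq_longest_of_length {x : Wt} (h : cs.length x = cs.length cs.longest) :
    x = cs.longest := by
  by_contra hne
  have := (cs.suffixLE_longest x).length_lt cs hne
  omega

theorem longest_inv : cs.longest⁻¹ = cs.longest :=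
  cs.eq_longest_of_length (cs.length_inv _)

theorem length_longest_mul (x : Wt) :
    cs.length (cs.longest * x) + cs.length x = cs.length cs.longest := by
  have h : cs.length (cs.longest * x⁻¹⁻¹) + cs.length x⁻¹ = cs.length cs.longest :=
    cs.suffixLE_longest x⁻¹
  rwa [inv_inv, length_inv] at h

theorem length_mul_longest (x : Wt) :
    cs.length (x * cs.longest) + cs.length x = cs.length cs.longest := by
  rw [← cs.length_inv (x * _), mul_inv_rev, longest_inv, ← cs.length_inv x]
  exact cs.length_longest_mul x⁻¹

/-- The Garside element of the braid monoid. -/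
noncomputable def garside : M.BraidMonoid := cs.redBraid cs.longest

theorem exists_mul_redBraid_eq_garside (x : Wt) :
    ∃ y, cs.redBraid y * cs.redBraid x = cs.garside := by
  obtain ⟨u, hu, hl⟩ := (cs.suffixLE_longest x).exists_eq_mul
  exact ⟨u, by rw [← cs.redBraid_mul hl, ← hu, garside]⟩

theorem exists_redBraid_mul_eq_garside (x : Wt) :
    ∃ y, cs.redBraid x * cs.redBraid y = cs.garside := by
  refine ⟨x⁻¹ * cs.longest, ?_⟩
  rw [← redBraid_mul, mul_inv_cancel_left, garside]
  rw [mul_inv_cancel_left, ← cs.length_mul_longest x⁻¹, length_inv, add_comm]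

/-- Multiplying by the longest element on either side complements lengths, so conjugation by it
sends `s_i` to an element of length 1. -/
theorem exists_of_mul_garside (i : B) : ∃ j,
    PresentedMonoid.of M.BraidRel i * cs.garside = cs.garside * PresentedMonoid.of M.BraidRel j ∧
    PresentedMonoid.of M.BraidRel j * cs.garside =
      cs.garside * PresentedMonoid.of M.BraidRel i := by
  have hl : cs.length (cs.longest * (cs.simple i * cs.longest)) = 1 := by
    have h1 := cs.length_longest_mul (cs.simple i * cs.longest)
    have h2 := cs.length_mul_longest (cs.simple i)
    rw [length_simple] at h2
    omega
  obtain ⟨j, hj⟩ := cs.length_eq_one_iff.mp hl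
  have hw : cs.longest * cs.longest = 1 := by
    nth_rw 1 [← cs.longest_inv]
    exact inv_mul_cancel _
  have key (i j : B) (h : cs.longest * (cs.simple i * cs.longest) = cs.simple j) :
      PresentedMonoid.of M.BraidRel i * cs.garside =
        cs.garside * PresentedMonoid.of M.BraidRel j := by
    have e1 : cs.simple i * (cs.simple i * cs.longest) = cs.longest :=
      cs.simple_mul_simple_cancel_left i
    have e2 : cs.simple i * cs.longest * cs.simple j = cs.longest := by
      rw [← h, ← mul_assoc, mul_assoc (cs.simple i), hw, mul_one, e1]
    have h2 := cs.length_mul_longest (cs.simple i)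
    rw [length_simple] at h2
    have g1 : cs.garside = cs.redBraid (cs.simple i) * cs.redBraid (cs.simple i * cs.longest) := by
      rw [← redBraid_mul, e1, garside]
      rw [e1, length_simple]
      omega
    have g2 : cs.garside = cs.redBraid (cs.simple i * cs.longest) * cs.redBraid (cs.simple j) := by
      rw [← redBraid_mul, e2, garside]
      rw [e2, length_simple]
      omega
    nth_rw 1 [g2]
    rw [← cs.redBraid_simple, ← cs.redBraid_simple, ← mul_assoc, ← g1]
  refine ⟨j, key i j hj, key j i ?_⟩
  rw [← hj, mul_assoc, mul_assoc, hw, mul_one, ← mul_assoc, hw, one_mul]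

theorem exists_mul_garside (a : M.BraidMonoid) : ∃ a', a * cs.garside = cs.garside * a' := by
  induction a using M.braid_induction with
  | one => exact ⟨1, by rw [one_mul, mul_one]⟩
  | of_mul i a ih =>
    obtain ⟨a', h⟩ := ih
    obtain ⟨j, hj, -⟩ := cs.exists_of_mul_garside i
    exact ⟨PresentedMonoid.of M.BraidRel j * a', by rw [mul_assoc, h, ← mul_assoc, hj, mul_assoc]⟩

/-- Conjugation by the Garside element, as a function. -/
noncomputable def garsideConjFun (a : M.BraidMonoid) : M.BraidMonoid :=
  (cs.exists_mul_garside a).choose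

theorem mul_garside_eq (a : M.BraidMonoid) : a * cs.garside = cs.garside * cs.garsideConjFun a :=
  (cs.exists_mul_garside a).choose_spec

/-- Conjugation by the Garside element. -/
noncomputable def garsideConj : M.BraidMonoid →* M.BraidMonoid where
  toFun := cs.garsideConjFun
  map_one' := by
    apply cs.braid_mul_left_cancel (c := cs.garside)
    rw [← mul_garside_eq, one_mul, mul_one]
  map_mul' a b := by
    apply cs.braid_mul_left_cancel (c := cs.garside)
    rw [← mul_garside_eq, ← mul_assoc, ← mul_garside_eq, mul_assoc, mul_assoc, mul_garside_eq]

theorem mul_garside (a : M.BraidMonoid) : a * cs.garside = cs.garside * cs.garsideConj a :=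
  cs.mul_garside_eq a

theorem garsideConj_garside : cs.garsideConj cs.garside = cs.garside :=
  cs.braid_mul_left_cancel (cs.mul_garside cs.garside).symm

theorem garsideConj_mul_garside (a : M.BraidMonoid) :
    cs.garsideConj a * cs.garside = cs.garside * a := by
  induction a using M.braid_induction with
  | one => rw [map_one, one_mul, mul_one]
  | of_mul i a ih =>
    obtain ⟨j, h1, h2⟩ := cs.exists_of_mul_garside i
    rw [mul_garside] at h1
    rw [map_mul, cs.braid_mul_left_cancel h1, mul_assoc, ih, ← mul_assoc, h2, mul_assoc]

/-- The square of the Garside element is central. -/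
theorem garside_sq_comm (a : M.BraidMonoid) :
    a * (cs.garside * cs.garside) = cs.garside * cs.garside * a := by
  rw [← mul_assoc, cs.mul_garside a, mul_assoc, garsideConj_mul_garside, mul_assoc]

theorem garside_sq_pow_comm (a : M.BraidMonoid) (k : ℕ) :
    a * (cs.garside * cs.garside) ^ k = (cs.garside * cs.garside) ^ k * a :=
  (Commute.pow_right (cs.garside_sq_comm a) k).eq

theorem exists_of_mul_eq_garside_sq (i : B) :
    ∃ c, PresentedMonoid.of M.BraidRel i * c = cs.garside * cs.garside := by
  obtain ⟨y, hy⟩ := cs.exists_redBraid_mul_eq_garside (cs.simple i)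
  refine ⟨cs.redBraid y * cs.garside, ?_⟩
  rw [← mul_assoc, ← cs.redBraid_simple, hy]

/-- Every element of the braid monoid divides a power of a central element. -/
theorem exists_mul_eq_garside_sq_pow (a : M.BraidMonoid) :
    ∃ a' k, a * a' = (cs.garside * cs.garside) ^ k := by
  induction a using M.braid_induction with
  | one => exact ⟨1, 0, by rw [mul_one, pow_zero]⟩
  | of_mul i a ih =>
    obtain ⟨a', k, h⟩ := ih
    obtain ⟨c, hc⟩ := cs.exists_of_mul_eq_garside_sq i
    refine ⟨a' * c, k + 1, ?_⟩
    rw [mul_assoc, ← mul_assoc a, h, ← cs.garside_sq_pow_comm, ← mul_assoc, hc, pow_succ']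

/-! ### The embedding of the braid monoid into the braid group -/

/-- The powers of the square of the Garside element admit a calculus of fractions. -/
@[reducible]
noncomputable def oreSetGarside :
    OreLocalization.OreSet (Submonoid.powers (cs.garside * cs.garside)) where
  ore_right_cancel r₁ r₂ s h := ⟨1, by rw [cs.braid_mul_right_cancel h]⟩
  oreNum r _ := r
  oreDenom _ s := s
  ore_eq r s := by
    obtain ⟨_, k, rfl⟩ := s
    exact (cs.garside_sq_pow_comm r k).symm

theorem braidMonoidToGroup_of (i : B) :
    M.braidMonoidToGroup (PresentedMonoid.of M.BraidRel i) = PresentedGroup.of i := rfl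

/-- Every generator divides the central element `Δ²`, so it becomes invertible when `Δ²` is
inverted. The braid group therefore maps to the units of this localization, into which the monoid
embeds by cancellation. -/
theorem braidMonoidToGroup_injective (cs : CoxeterSystem M Wt) :
    Function.Injective M.braidMonoidToGroup := by
  let := cs.oreSetGarside
  let S := Submonoid.powers (cs.garside * cs.garside)
  let num : M.BraidMonoid →* OreLocalization S M.BraidMonoid := OreLocalization.numeratorHom
  have hnum : Function.Injective num := by
    intro a b h
    obtain ⟨u, v, h1, h2⟩ := OreLocalization.oreDiv_eq_iff.mp h
    have h2' : (u : M.BraidMonoid) = v := by simpa using h2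
    have h1' : (u : M.BraidMonoid) * b = v * a := h1
    rw [← h2'] at h1'
    exact (cs.braid_mul_left_cancel h1').symm
  have hunit (i : B) : IsUnit (num (PresentedMonoid.of M.BraidRel i)) := by
    obtain ⟨c, hc⟩ := cs.exists_of_mul_eq_garside_sq i
    have hc' : c * PresentedMonoid.of M.BraidRel i = cs.garside * cs.garside := by
      apply cs.braid_mul_left_cancel (c := PresentedMonoid.of M.BraidRel i)
      rw [← mul_assoc, hc, cs.garside_sq_comm]
    obtain ⟨z, hz⟩ : IsUnit (num (cs.garside * cs.garside)) :=
      OreLocalization.numerator_isUnit (S := S) ⟨_, Submonoid.mem_powers _⟩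
    refine isUnit_iff_exists.mpr ⟨num c * ↑z⁻¹, ?_, ?_⟩
    · rw [← mul_assoc, ← map_mul, hc, ← hz, Units.mul_inv]
    · have hcomm : Commute (num c) ↑z⁻¹ := by
        apply Commute.units_inv_right
        rw [hz]
        exact (Commute.map (cs.garside_sq_comm c : Commute c _) num)
      rw [hcomm.eq, mul_assoc, ← map_mul, hc', ← hz, Units.inv_mul]
  choose f hf using hunit
  have key (ω : List B) : (((ω.map f).prod : (OreLocalization S M.BraidMonoid)ˣ) :
      OreLocalization S M.BraidMonoid) = num (M.braidOfWord ω) := by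
    induction ω with
    | nil => simp [M.braidOfWord_nil]
    | cons i ω ih => rw [List.map_cons, List.prod_cons, Units.val_mul, ih, hf, M.braidOfWord_cons,
        map_mul]
  let F : M.BraidGroup →* (OreLocalization S M.BraidMonoid)ˣ :=
    PresentedGroup.toGroup (f := f) (by
      rintro _ ⟨i, j, rfl⟩
      rw [map_mul, map_inv, mul_inv_eq_one, map_list_prod, map_list_prod, List.map_map,
        List.map_map]
      have e : (FreeGroup.lift f) ∘ FreeGroup.of = f := by
        funext i
        simp
      rw [e, Units.ext_iff, key, key, M.braidOfWord_braidWord])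
  have hF (a : M.BraidMonoid) : (F (M.braidMonoidToGroup a) : OreLocalization S M.BraidMonoid) =
      num a := by
    induction a using M.braid_induction with
    | one => simp
    | of_mul i a ih =>
      rw [map_mul, map_mul, Units.val_mul, ih, map_mul, ← hf, braidMonoidToGroup_of]
      congr 2
      exact PresentedGroup.toGroup.of _
  intro a b h
  apply hnum
  rw [← hF, ← hF, h]

/-! ### Fractions in standard parabolic subgroups -/

theorem residueAct_fst_mem_parabolic {J : Set B} {a : M.BraidMonoid} (ha : a ∈ M.braidParabolic J)
    {x : Wt} (hx : x ∈ Subgroup.closure (cs.simple '' J)) :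
    (cs.residueAct a (x, 1)).1 ∈ Subgroup.closure (cs.simple '' J) := by
  induction a using M.braid_induction with
  | one =>
    rw [residueAct_one]
    exact hx
  | of_mul i a ih =>
    rw [M.mul_mem_braidParabolic_iff] at ha
    rw [residueAct_mul, residueAct_of]
    have hi : cs.simple i ∈ Subgroup.closure (cs.simple '' J) := by
      rw [← redBraid_mem_braidParabolic_iff, redBraid_simple]
      exact ha.1
    exact mul_mem (cs.join_mem_parabolic (ih ha.2) hi) (inv_mem hi)

/-- The Ore condition inside a parabolic submonoid: the residue of `s_i` stays parabolic because
joins do, and the other cofactor does by closure under factors. -/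
theorem exists_mul_of_eq_mul (cs : CoxeterSystem M Wt) {J : Set B} {a : M.BraidMonoid}
    (ha : a ∈ M.braidParabolic J) {i : B} (hi : i ∈ J) :
    ∃ b ∈ M.braidParabolic J, ∃ c ∈ M.braidParabolic J,
      b * a = c * PresentedMonoid.of M.BraidRel i := by
  obtain ⟨c, -, h⟩ := cs.redBraid_residueAct_mul a 1 (cs.simple i)
  have hb := cs.redBraid_mem_braidParabolic_iff.mpr
    (cs.residueAct_fst_mem_parabolic ha (Subgroup.subset_closure ⟨i, hi, rfl⟩))
  rw [redBraid_simple] at h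
  exact ⟨_, hb, c, (M.mul_mem_braidParabolic_iff.mp (h ▸ mul_mem hb ha)).1, h⟩

theorem exists_mul_eq_of_mul (cs : CoxeterSystem M Wt) {J : Set B} {a : M.BraidMonoid}
    (ha : a ∈ M.braidParabolic J) {i : B} (hi : i ∈ J) :
    ∃ b ∈ M.braidParabolic J, ∃ c ∈ M.braidParabolic J,
      a * b = PresentedMonoid.of M.BraidRel i * c := by
  obtain ⟨b, hb, c, hc, h⟩ := cs.exists_mul_of_eq_mul (M.braidRev_mem_braidParabolic ha) hi
  refine ⟨_, M.braidRev_mem_braidParabolic hb, _, M.braidRev_mem_braidParabolic hc, ?_⟩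
  have h' := congrArg M.braidRev h
  rwa [M.braidRev_mul, M.braidRev_mul, M.braidRev_braidRev, M.braidRev_of] at h'

/-- A leading `s_i⁻¹` is moved past the numerator `a` by `s_i⁻¹ a = d c⁻¹`, where `a c = s_i d`. -/
theorem exists_eq_mul_inv (cs : CoxeterSystem M Wt) {J : Set B} {g : M.BraidGroup}
    (hg : g ∈ Subgroup.closure (PresentedGroup.of (rels := M.braidRelators) '' J)) :
    ∃ a ∈ M.braidParabolic J, ∃ b ∈ M.braidParabolic J,
      g = M.braidMonoidToGroup a * (M.braidMonoidToGroup b)⁻¹ := by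
  induction hg using Subgroup.closure_induction_left with
  | one => exact ⟨1, one_mem _, 1, one_mem _, by simp⟩
  | mul_left x hx y _ ih =>
    obtain ⟨i, hi, rfl⟩ := hx
    obtain ⟨a, ha, b, hb, rfl⟩ := ih
    refine ⟨_, mul_mem (M.of_mem_braidParabolic hi) ha, b, hb, ?_⟩
    rw [map_mul, braidMonoidToGroup_of, mul_assoc]
  | inv_mul_cancel x hx y _ ih =>
    obtain ⟨i, hi, rfl⟩ := hx
    obtain ⟨a, ha, b, hb, rfl⟩ := ih
    obtain ⟨c, hc, d, hd, h⟩ := cs.exists_mul_eq_of_mul ha hi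
    refine ⟨d, hd, _, mul_mem hb hc, ?_⟩
    have h' := congrArg M.braidMonoidToGroup h
    rw [map_mul, map_mul, braidMonoidToGroup_of] at h'
    rw [eq_mul_inv_iff_mul_eq, map_mul, mul_assoc, mul_assoc, inv_mul_cancel_left, h',
      inv_mul_cancel_left]

/-- If the fraction `q m⁻¹` conjugates `X` to `X'` (twisted by `φ`), then the denominator and the
numerator of its reduced form are positive conjugators starting at a common element. -/
theorem exists_of_fraction_conj (cs : CoxeterSystem M Wt) (φ : M.BraidMonoid →* M.BraidMonoid)
    {q m X X' e : M.BraidMonoid}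
    (he : ∀ f, RightDivides f (m * e) → RightDivides f (q * e) → RightDivides f e)
    (h : M.braidMonoidToGroup (q * e) * (M.braidMonoidToGroup (m * e))⁻¹ *
      M.braidMonoidToGroup X * M.braidMonoidToGroup (φ (m * e)) =
        M.braidMonoidToGroup X' * M.braidMonoidToGroup (φ (q * e))) :
    ∃ y, m * y = X * φ m ∧ q * y = X' * φ q := by
  -- Since `m'` is `(m e)⁻¹` up to a central factor, `m' X φ(m e)` is a positive substitute for `(m
  -- e)⁻¹ X φ(m e)`.
  obtain ⟨m', k, hm'⟩ := cs.exists_mul_eq_garside_sq_pow (m * e)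
  have hmY : m * e * (m' * X * φ (m * e)) =
      X * φ (m * e) * (cs.garside * cs.garside) ^ k := by
    rw [mul_assoc m' X, ← mul_assoc (m * e), hm', ← cs.garside_sq_pow_comm]
  have hqY : q * e * (m' * X * φ (m * e)) =
      X' * φ (q * e) * (cs.garside * cs.garside) ^ k := by
    apply cs.braidMonoidToGroup_injective
    have hP := congrArg M.braidMonoidToGroup (cs.garside_sq_pow_comm (m * e) k)
    have hQ := congrArg M.braidMonoidToGroup (cs.garside_sq_pow_comm (q * e) k)
    have hN := congrArg M.braidMonoidToGroup hm'
    rw [map_mul] at hP hQ hN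
    rw [map_mul M.braidMonoidToGroup _ (m * e)] at hP
    rw [map_mul M.braidMonoidToGroup _ (q * e)] at hQ
    rw [cs.garside_sq_pow_comm, map_mul M.braidMonoidToGroup (q * e), map_mul _ (m' * X),
      map_mul _ m' X, map_mul M.braidMonoidToGroup _ (X' * φ (q * e)),
      map_mul M.braidMonoidToGroup X', ← h]
    have e1 : M.braidMonoidToGroup (q * e) * M.braidMonoidToGroup m' =
        M.braidMonoidToGroup ((cs.garside * cs.garside) ^ k) *
          (M.braidMonoidToGroup (q * e) * (M.braidMonoidToGroup (m * e))⁻¹) := by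
      rw [eq_inv_mul_of_mul_eq hN, ← mul_assoc _ (M.braidMonoidToGroup (q * e)), ← hQ, mul_assoc,
        ((Commute.inv_left hP : Commute _ _).eq)]
    rw [← mul_assoc, ← mul_assoc, e1]
    simp only [mul_assoc]
  have hdvd {p Y Z : M.BraidMonoid} (hp : p * e * Y = Z * φ (p * e) *
      (cs.garside * cs.garside) ^ k) :
      RightDivides (φ e * (cs.garside * cs.garside) ^ k) (p * e * Y) :=
    ⟨Z * φ p, by rw [hp, map_mul]; simp only [mul_assoc]⟩
  -- As `e` is the greatest common divisor of `m e` and `q e`, the common divisor `φ(e) Δ^(2k)`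
  -- already divides `e` times the substitute; the quotient is the desired `y`.
  obtain ⟨y, hy⟩ := cs.rightDivides_gcd_mul he (hdvd hmY) (hdvd hqY)
  have hfin {p Z : M.BraidMonoid} (hp : p * e * (m' * X * φ (m * e)) = Z * φ (p * e) *
      (cs.garside * cs.garside) ^ k) : p * y = Z * φ p := by
    apply cs.braid_mul_right_cancel (c := φ e * (cs.garside * cs.garside) ^ k)
    rw [mul_assoc, ← hy, ← mul_assoc, hp, map_mul]
    simp only [mul_assoc]
  exact ⟨y, hfin hmY, hfin hqY⟩

end CoxeterSystem

namespace TwistedCoxeterSystem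

variable {B Wt Ω : Type*} {M : CoxeterMatrix B} [Group Wt] [Group Ω]
  (T : TwistedCoxeterSystem M Wt Ω)

/-! ### Reduced braids in the twisted setting -/

theorem braidMonoidMap_braidOfWord (δ : Ω) (ω : List B) :
    T.braidMonoidMap δ (M.braidOfWord ω) = M.braidOfWord (ω.map (T.perm δ)) := by
  induction ω with
  | nil => exact map_one _
  | cons i ω ih =>
    rw [M.braidOfWord_cons, map_mul, ih, List.map_cons, M.braidOfWord_cons, braidMonoidMap_of]

theorem braidMonoidMap_redBraid (δ : Ω) (x : Wt) :
    T.braidMonoidMap δ (T.cs.redBraid x) = T.cs.redBraid (T.act δ x) := by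
  obtain ⟨ω, hω, rfl⟩ := T.cs.exists_isReduced x
  have hω' : T.cs.IsReduced (ω.map (T.perm δ)) := by
    rw [CoxeterSystem.IsReduced, ← act_wordProd, length_act, hω.eq, List.length_map]
  rw [T.cs.redBraid_wordProd hω, braidMonoidMap_braidOfWord, act_wordProd,
    T.cs.redBraid_wordProd hω']

theorem braidMonoidMap_inv_apply (δ : Ω) (a : M.BraidMonoid) :
    T.braidMonoidMap δ⁻¹ (T.braidMonoidMap δ a) = a := by
  rw [← MonoidHom.comp_apply, ← braidMonoidMap_mul, inv_mul_cancel, braidMonoidMap_one,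
    MonoidHom.id_apply]

theorem braidMonoidMap_apply_inv (δ : Ω) (a : M.BraidMonoid) :
    T.braidMonoidMap δ (T.braidMonoidMap δ⁻¹ a) = a := by
  rw [← MonoidHom.comp_apply, ← braidMonoidMap_mul, mul_inv_cancel, braidMonoidMap_one,
    MonoidHom.id_apply]

theorem braidMonoidToGroup_braidMonoidMap (δ : Ω) (a : M.BraidMonoid) :
    M.braidMonoidToGroup (T.braidMonoidMap δ a) = T.braidGroupMap δ (M.braidMonoidToGroup a) := by
  induction a using M.braid_induction with
  | one => simp
  | of_mul i a ih =>
    rw [map_mul, map_mul, map_mul, map_mul, ih, braidMonoidMap_of]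
    exact congrArg (· * _) (T.braidGroupMap_of δ i).symm

theorem twistedBraid_mul (a b : T.TwistedBraidMonoid) :
    a * b = ⟨a.left * T.braidMonoidMap a.right b.left, a.right * b.right⟩ := rfl

theorem braid_mul {u w : T.W} (h : T.length (u * w) = T.length u + T.length w) :
    T.braid (u * w) = T.braid u * T.braid w := by
  rw [twistedBraid_mul]
  apply TwistedBraidMonoid.ext
  · change T.cs.redBraid (u.left * T.act u.right w.left) =
      T.cs.redBraid u.left * T.braidMonoidMap u.right (T.cs.redBraid w.left)
    rw [braidMonoidMap_redBraid, CoxeterSystem.redBraid_mul]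
    rw [length_act]
    exact h
  · rfl

/-- The natural homomorphism from the twisted braid monoid to the twisted braid group. -/
def twistedBraidToGroup : T.TwistedBraidMonoid →* T.TwistedBraidGroup where
  toFun a := ⟨M.braidMonoidToGroup a.left, a.right⟩
  map_one' := by
    apply SemidirectProduct.ext
    · exact map_one M.braidMonoidToGroup
    · rfl
  map_mul' a b := by
    apply SemidirectProduct.ext
    · change M.braidMonoidToGroup (a.left * T.braidMonoidMap a.right b.left) =
        M.braidMonoidToGroup a.left * T.braidGroupMap a.right (M.braidMonoidToGroup b.left)
      rw [map_mul, braidMonoidToGroup_braidMonoidMap]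
    · rfl

/-- In the strong case both sides of `τ u = u' τ` are reduced. In the cyclic case `u = (u τ⁻¹) τ`
and `u' = τ (u τ⁻¹)` are reduced. -/
theorem braid_mul_of_isDirectMixedShift {τ u u' : T.W} (h : T.IsDirectMixedShift τ u u') :
    T.braid τ * T.braid u = T.braid u' * T.braid τ := by
  rcases h with ⟨⟨h1, h2, -⟩, h3⟩ | ⟨⟨h1, h2, -⟩, h3⟩
  · have e : u' * τ = τ * u := by rw [← h1, inv_mul_cancel_right]
    rw [← braid_mul, ← braid_mul, e]
    · rw [e, h3, h2]
    · rw [h3, add_comm]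
  · have e1 : u * τ⁻¹ * τ = u := inv_mul_cancel_right _ _
    have e2 : τ * (u * τ⁻¹) = u' := by rw [← h1, mul_assoc]
    rw [length_inv] at h3
    have b1 : T.braid u = T.braid (u * τ⁻¹) * T.braid τ := by
      rw [← braid_mul, e1]
      rw [e1, h3]
    have b2 : T.braid u' = T.braid τ * T.braid (u * τ⁻¹) := by
      rw [← braid_mul, e2]
      rw [e2, ← h2, ← h3, add_comm]
    rw [b1, b2, mul_assoc]

/-- Inverting a step exchanges `τ u` with `u τ⁻¹`, so the two length conditions that are not direct
become direct. -/
theorem direct_or_direct_inv_of_step {τ u u' : T.W}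
    (h : T.IsStrongConj τ u u' ∨ T.IsCyclicShift τ u u') :
    T.IsDirectMixedShift τ u u' ∨ T.IsDirectMixedShift τ⁻¹ u' u := by
  have hsymm := T.step_symm h
  have conj (h1 : τ * u * τ⁻¹ = u') : u' * τ⁻¹⁻¹ = τ * u ∧ τ⁻¹ * u' = u * τ⁻¹ := by
    subst h1
    constructor <;> group
  have hne : τ⁻¹ * u' * τ⁻¹⁻¹ = u := by rcases hsymm with h | h <;> exact h.1
  rcases h with ⟨h1, h2, h3 | h3⟩ | ⟨h1, h2, h3 | h3⟩
  · exact Or.inl (Or.inl ⟨⟨h1, h2, Or.inl h3⟩, h3⟩)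
  · have h4 : T.length (τ⁻¹ * u') = T.length u' + T.length τ⁻¹ := by
      rw [(conj h1).2, h3, h2]
    exact Or.inr (Or.inl ⟨⟨hne, h2.symm, Or.inl h4⟩, h4⟩)
  · have h4 : T.length (u' * τ⁻¹⁻¹) + T.length τ⁻¹⁻¹ = T.length u' := by
      rw [(conj h1).1, inv_inv, h3, h2]
    exact Or.inr (Or.inr ⟨⟨hne, h2.symm, Or.inr h4⟩, h4⟩)
  · exact Or.inl (Or.inr ⟨⟨h1, h2, Or.inr h3⟩, h3⟩)

/-! ### Sequences of mixed shifts -/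

theorem isChain_append {G : Type*} {R : G → G → G → Prop} {L L' : List G} {u v w : G}
    (h : IsChain R L' u v) (h' : IsChain R L v w) : IsChain R (L ++ L') u w := by
  induction L generalizing w with
  | nil =>
    have e : v = w := h'
    exact e ▸ h
  | cons τ L ih =>
    obtain ⟨x, h1, h2⟩ := h'
    exact ⟨x, ih h1, h2⟩

theorem isChain_mono {G : Type*} {R R' : G → G → G → Prop} (hR : ∀ τ u v, R τ u v → R' τ u v)
    {L : List G} {u v : G} (h : IsChain R L u v) : IsChain R' L u v := by
  induction L generalizing v with
  | nil => exact h
  | cons τ L ih =>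
    obtain ⟨x, h1, h2⟩ := h
    exact ⟨x, ih h1, hR _ _ _ h2⟩

theorem isChain_singleton {G : Type*} {R : G → G → G → Prop} {τ u v : G} (h : R τ u v) :
    IsChain R [τ] u v := ⟨u, rfl, h⟩

theorem mem_directMixedTran_of_isChain {K : Subgroup T.W} {w w' : T.W} {L : List T.W}
    (hK : ∀ τ ∈ L, τ ∈ K) (h : IsChain T.IsDirectMixedShift L w w') :
    L ∈ T.directMixedTran K w w' :=
  ⟨⟨hK, isChain_mono (fun _ _ _ h => h.imp And.left And.left) h⟩, h⟩

theorem MixedShift.trans {K : Subgroup T.W} {u v w : T.W} (h : T.MixedShift K u v)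
    (h' : T.MixedShift K v w) : T.MixedShift K u w := by
  obtain ⟨L, hL, hc⟩ := h
  obtain ⟨L', hL', hc'⟩ := h'
  refine ⟨L' ++ L, fun τ hτ => ?_, isChain_append hc hc'⟩
  rcases List.mem_append.mp hτ with h | h
  · exact hL' τ h
  · exact hL τ h

theorem MixedShift.symm {K : Subgroup T.W} {w w' : T.W} (h : T.MixedShift K w w') :
    T.MixedShift K w' w := by
  obtain ⟨L, hL, hc⟩ := h
  induction L generalizing w' with
  | nil =>
    have e : w = w' := hc
    exact ⟨[], by simp, e.symm⟩
  | cons τ L ih =>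
    obtain ⟨x, h1, h2⟩ := hc
    have hx := ih (fun σ hσ => hL σ (List.mem_cons_of_mem _ hσ)) h1
    refine MixedShift.trans T ⟨[τ⁻¹], ?_, isChain_singleton (T.step_symm h2)⟩ hx
    intro σ hσ
    rw [List.mem_singleton.mp hσ]
    exact inv_mem (hL τ List.mem_cons_self)

theorem braidProd_mem_braidTran {J : Set B} {w w' : T.W} {L : List T.W}
    (hL : ∀ τ ∈ L, τ ∈ T.parabolic J) (hc : IsChain T.IsDirectMixedShift L w w') :
    T.braidProd L ∈ T.braidTran J w w' := by
  induction L generalizing w' with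
  | nil =>
    have e : w = w' := hc
    refine ⟨one_mem _, ?_⟩
    rw [e, braidProd, List.map_nil, List.prod_nil, one_mul, mul_one]
  | cons τ L ih =>
    obtain ⟨x, h1, h2⟩ := hc
    obtain ⟨h3, h4⟩ := ih (fun σ hσ => hL σ (List.mem_cons_of_mem _ hσ)) h1
    have e : T.braidProd (τ :: L) = T.braid τ * T.braidProd L := by
      rw [braidProd, List.map_cons, List.prod_cons, braidProd]
    rw [e]
    refine ⟨mul_mem ?_ h3, ?_⟩
    · obtain ⟨y, hy, rfl⟩ := hL τ List.mem_cons_self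
      exact ⟨_, T.cs.redBraid_mem_braidParabolic_iff.mpr hy, rfl⟩
    · rw [mul_assoc, h4, ← mul_assoc, T.braid_mul_of_isDirectMixedShift h2, mul_assoc]

theorem braidInGroup_mem_parabolicBraidGroup {J : Set B} {τ : T.W} (hτ : τ ∈ T.parabolic J) :
    T.braidInGroup τ ∈ T.parabolicBraidGroup J := by
  obtain ⟨y, hy, rfl⟩ := hτ
  refine ⟨M.braidMonoidToGroup (T.cs.redBraid y), ?_, rfl⟩
  suffices main : ∀ a ∈ M.braidParabolic J, M.braidMonoidToGroup a ∈
      Subgroup.closure (PresentedGroup.of (rels := M.braidRelators) '' J) from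
    main _ (T.cs.redBraid_mem_braidParabolic_iff.mpr hy)
  intro a ha
  induction ha using Submonoid.closure_induction with
  | mem a ha =>
    obtain ⟨i, hi, rfl⟩ := ha
    exact Subgroup.subset_closure ⟨i, hi, rfl⟩
  | one =>
    rw [map_one]
    exact one_mem _
  | mul a b _ _ ha hb =>
    rw [map_mul]
    exact mul_mem ha hb

theorem exists_conj_of_mixedShift {J : Set B} {w w' : T.W}
    (h : T.MixedShift (T.parabolic J) w w') :
    ∃ g ∈ T.parabolicBraidGroup J, g * T.braidInGroup w * g⁻¹ = T.braidInGroup w' := by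
  obtain ⟨L, hL, hc⟩ := h
  have direct {τ u u' : T.W} (h : T.IsDirectMixedShift τ u u') :
      T.braidInGroup τ * T.braidInGroup u * (T.braidInGroup τ)⁻¹ = T.braidInGroup u' := by
    rw [mul_inv_eq_iff_eq_mul]
    have := congrArg T.twistedBraidToGroup (T.braid_mul_of_isDirectMixedShift h)
    rwa [map_mul, map_mul] at this
  induction L generalizing w' with
  | nil =>
    have e : w = w' := hc
    exact ⟨1, one_mem _, by rw [e, one_mul, inv_one, mul_one]⟩
  | cons τ L ih =>
    obtain ⟨x, h1, h2⟩ := hc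
    obtain ⟨g, hg, e⟩ := ih (fun σ hσ => hL σ (List.mem_cons_of_mem _ hσ)) h1
    have hτ := hL τ List.mem_cons_self
    rcases T.direct_or_direct_inv_of_step h2 with h | h
    · refine ⟨T.braidInGroup τ * g, mul_mem (T.braidInGroup_mem_parabolicBraidGroup hτ) hg, ?_⟩
      rw [← direct h, ← e]
      group
    · refine ⟨(T.braidInGroup τ⁻¹)⁻¹ * g,
        mul_mem (inv_mem (T.braidInGroup_mem_parabolicBraidGroup (inv_mem hτ))) hg, ?_⟩
      have h' := direct h
      rw [← e] at h'
      have h'' : T.braidInGroup w' =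
          (T.braidInGroup τ⁻¹)⁻¹ * (g * T.braidInGroup w * g⁻¹) * T.braidInGroup τ⁻¹ := by
        rw [← h']
        group
      rw [h'']
      group

/-! ### Finite Coxeter groups -/

theorem isDirectMixedShift_of_redBraid {δ : Ω} {τ x u : Wt}
    (h : T.cs.redBraid τ * T.cs.redBraid x =
      T.cs.redBraid u * T.braidMonoidMap δ (T.cs.redBraid τ))
    (h' : (∃ y, T.cs.redBraid τ * T.cs.redBraid x = T.cs.redBraid y) ∨
        ∃ y, T.cs.redBraid x = T.cs.redBraid y * T.braidMonoidMap δ (T.cs.redBraid τ)) :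
    T.IsDirectMixedShift (SemidirectProduct.inl τ) ⟨x, δ⟩ ⟨u, δ⟩ := by
  rw [braidMonoidMap_redBraid] at h h'
  have hp := congrArg T.cs.braidProj h
  have hl := congrArg M.braidLength h
  rw [map_mul, map_mul] at hp
  simp only [T.cs.braidProj_redBraid] at hp
  simp only [M.braidLength_mul, T.cs.braidLength_redBraid, length_act] at hl
  have h1 : SemidirectProduct.inl τ * (⟨x, δ⟩ : T.W) * (SemidirectProduct.inl τ)⁻¹ =
      ⟨u, δ⟩ := by
    rw [mul_inv_eq_iff_eq_mul]
    apply SemidirectProduct.ext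
    · simpa using hp
    · simp
  have h2 : T.length ⟨x, δ⟩ = T.length ⟨u, δ⟩ := by
    rw [length_mk, length_mk]
    omega
  rcases h' with ⟨y, hy⟩ | ⟨y, hy⟩
  · have h3 : T.length (SemidirectProduct.inl τ * (⟨x, δ⟩ : T.W)) =
        T.length ⟨x, δ⟩ + T.length (SemidirectProduct.inl τ) := by
      rw [add_comm]
      simpa [length] using (T.cs.length_mul_of_redBraid_mul hy).2
    exact Or.inl ⟨⟨h1, h2, Or.inl h3⟩, h3⟩
  · obtain ⟨hxy, hlen⟩ := T.cs.length_mul_of_redBraid_mul hy.symm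
    have h3 : T.length ((⟨x, δ⟩ : T.W) * (SemidirectProduct.inl τ)⁻¹) +
        T.length (SemidirectProduct.inl τ)⁻¹ = T.length ⟨x, δ⟩ := by
      rw [length_inv]
      have e : (⟨x, δ⟩ : T.W) * (SemidirectProduct.inl τ)⁻¹ = ⟨y, δ⟩ := by
        rw [mul_inv_eq_iff_eq_mul]
        apply SemidirectProduct.ext
        · simpa using hxy
        · simp
      rw [← hxy, length_act] at hlen
      rw [e]
      change T.cs.length y + T.cs.length τ = T.cs.length x
      omega
    exact Or.inr ⟨⟨h1, h2, Or.inr h3⟩, h3⟩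

/-! ### Positive conjugators as products of direct mixed shifts. -/

section Finite

variable [Finite Wt]

theorem act_longest (δ : Ω) : T.act δ T.cs.longest = T.cs.longest :=
  T.cs.eq_longest_of_length (T.length_act δ _)

theorem braidMonoidMap_garside (δ : Ω) : T.braidMonoidMap δ T.cs.garside = T.cs.garside := by
  rw [CoxeterSystem.garside, braidMonoidMap_redBraid, act_longest]

/-- Conjugation by the Garside element, followed by the inverse of a twist. -/
noncomputable def garsideConjTwist (δ : Ω) : M.BraidMonoid →* M.BraidMonoid :=
  (T.braidMonoidMap δ⁻¹).comp T.cs.garsideConj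

theorem garsideConjTwist_garside (δ : Ω) : T.garsideConjTwist δ T.cs.garside = T.cs.garside := by
  rw [garsideConjTwist, MonoidHom.comp_apply, CoxeterSystem.garsideConj_garside,
    braidMonoidMap_garside]

/-- Multiplication of a conjugation equation with complements to the Garside element. -/
theorem conj_complement {δ : Ω} {b X X' Y Y' : M.BraidMonoid} (hX : X * Y = T.cs.garside)
    (hX' : X' * Y' = T.cs.garside) (h : b * X = X' * T.braidMonoidMap δ b) :
    b * T.braidMonoidMap δ⁻¹ Y = T.braidMonoidMap δ⁻¹ Y' * T.garsideConjTwist δ b := by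
  have h1 : T.braidMonoidMap δ b * Y = Y' * T.cs.garsideConj b := by
    apply T.cs.braid_mul_left_cancel (c := X')
    rw [← mul_assoc, ← h, mul_assoc, hX, T.cs.mul_garside, ← mul_assoc, hX']
  have h2 := congrArg (T.braidMonoidMap δ⁻¹) h1
  rwa [map_mul, map_mul, braidMonoidMap_inv_apply] at h2

/-- A positive braid conjugating one reduced braid to another one starts with a reduced braid that
performs a direct mixed shift. -/
theorem exists_direct_first_step {δ : Ω} {b : M.BraidMonoid} (hb : b ≠ 1) {x x' : Wt}
    (h : b * T.cs.redBraid x = T.cs.redBraid x' * T.braidMonoidMap δ b) :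
    ∃ (τ u : Wt) (c : M.BraidMonoid), τ ≠ 1 ∧ b = c * T.cs.redBraid τ ∧
      T.cs.redBraid τ * T.cs.redBraid x = T.cs.redBraid u * T.braidMonoidMap δ (T.cs.redBraid τ) ∧
      ((∃ y, T.cs.redBraid τ * T.cs.redBraid x = T.cs.redBraid y) ∨
        ∃ y, T.cs.redBraid x = T.cs.redBraid y * T.braidMonoidMap δ (T.cs.redBraid τ)) := by
  obtain ⟨d, hd⟩ := T.cs.exists_mul_redBraid_eq_garside x
  obtain ⟨ρ, ⟨c, hc⟩, ⟨f, hf⟩, hρ⟩ := T.cs.exists_rightGcd b (T.cs.redBraid d)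
  obtain ⟨σ, hσb, ⟨f', hf'⟩, hσ⟩ := T.cs.exists_rightGcd b T.cs.garside
  -- With `X = b_x`, `δ(σ)` divides `b X = b_x' δ(b)` and `b_d X = Δ = δ(Δ)`, while `ρ` is the
  -- greatest common divisor of `b` and `b_d`.
  have hσx : RightDivides (T.braidMonoidMap δ σ) (ρ * T.cs.redBraid x) := by
    apply T.cs.rightDivides_gcd_mul hρ
    · rw [h]
      exact (hσb.map _).mul_left _
    · rw [hd, ← T.braidMonoidMap_garside δ]
      exact RightDivides.map _ ⟨f', hf'⟩
  obtain ⟨-, τ, -, rfl, -, -⟩ := T.cs.exists_of_mul_eq_redBraid hf.symm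
  by_cases hτ : τ = 1
  · subst hτ
    rw [T.cs.redBraid_one, one_mul] at hσx
    obtain ⟨v, hv⟩ := hσx
    obtain ⟨-, τ, -, rfl, -, -⟩ := T.cs.exists_of_mul_eq_redBraid hf'.symm
    obtain ⟨y, -, rfl, -, -, -⟩ := T.cs.exists_of_mul_eq_redBraid hv.symm
    obtain ⟨z, hz⟩ := T.cs.exists_redBraid_mul_eq_garside x
    obtain ⟨z', hz'⟩ := T.cs.exists_redBraid_mul_eq_garside x'
    have hX := T.conj_complement hz hz' h
    -- The same divisibility for complements, where the twist becomes `garsideConjTwist`, and `σ` is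
    -- the greatest common divisor of `b` and `Δ`.
    have hdvd : RightDivides (T.garsideConjTwist δ (T.cs.redBraid τ))
        (T.cs.redBraid τ * T.braidMonoidMap δ⁻¹ (T.cs.redBraid z)) := by
      apply T.cs.rightDivides_gcd_mul hσ
      · rw [hX]
        exact (hσb.map _).mul_left _
      · rw [← T.cs.garsideConj_mul_garside, ← T.garsideConjTwist_garside δ]
        exact (RightDivides.map _ ⟨f', hf'⟩).mul_left _
    obtain ⟨ζ, hζ⟩ := hdvd
    have hζ' := congrArg (T.braidMonoidMap δ) hζ
    rw [map_mul, map_mul, braidMonoidMap_apply_inv, garsideConjTwist, MonoidHom.comp_apply,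
      braidMonoidMap_apply_inv] at hζ'
    -- Here `b_x = b_y δ(σ)` with `σ = b_τ`. Being a left factor of `Δ`, the product `b_τ b_y` is
    -- reduced, as a cyclic shift requires.
    have hsimple : T.cs.redBraid τ * T.cs.redBraid y * T.braidMonoidMap δ ζ = T.cs.garside := by
      apply T.cs.braid_mul_right_cancel (c := T.cs.garsideConj (T.cs.redBraid τ))
      rw [← T.cs.mul_garside, mul_assoc _ (T.braidMonoidMap δ ζ), ← hζ', mul_assoc,
        ← mul_assoc (T.cs.redBraid y), ← hv, hz]
    obtain ⟨u, -, hu, -, -, -⟩ := T.cs.exists_of_mul_eq_redBraid hsimple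
    obtain ⟨c', hc'⟩ := hσb
    refine ⟨τ, u, c', ?_, hc', ?_, Or.inr ⟨y, hv⟩⟩
    -- The last letter of `b` divides `Δ`, hence `σ`, so `σ` is not trivial.
    · rintro rfl
      obtain ⟨b', i, rfl⟩ := M.exists_eq_mul_of hb
      obtain ⟨g, hg⟩ := hσ (PresentedMonoid.of M.BraidRel i) ⟨b', rfl⟩ (by
        rw [← T.cs.redBraid_simple]
        exact (T.cs.suffixLE_longest _).rightDivides T.cs)
      have hl := congrArg M.braidLength hg
      rw [T.cs.redBraid_one, M.braidLength_one, M.braidLength_mul, M.braidLength_of] at hl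
      omega
    · rw [← hu, mul_assoc, ← hv]
  · obtain ⟨-, y, -, hy, -, -⟩ := T.cs.exists_of_mul_eq_redBraid (x := T.cs.longest)
      (a := f) (b := T.cs.redBraid τ * T.cs.redBraid x) (by rw [← mul_assoc, ← hf]; exact hd)
    -- Since `ρ = b_τ` divides `σ`, also `δ(b_τ)` divides `b_τ b_x`, which is reduced as a right
    -- factor of `Δ`.
    have hτσ : RightDivides (T.cs.redBraid τ) σ :=
      hσ _ ⟨c, hc⟩ ((T.cs.suffixLE_longest τ).rightDivides T.cs)
    obtain ⟨u, hu⟩ := (hτσ.map (T.braidMonoidMap δ)).trans hσx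
    obtain ⟨u', -, rfl, -, -, -⟩ := T.cs.exists_of_mul_eq_redBraid (hu.symm.trans hy)
    exact ⟨τ, u', c, hτ, hc, hu, Or.inl ⟨y, hy⟩⟩

/-- The first step is split off on the right and cancelled from the equation; the remaining
conjugator is shorter, and both factors of `b` stay parabolic. -/
theorem exists_directMixedTran {J : Set B} {δ : Ω} {b : M.BraidMonoid}
    (hb : b ∈ M.braidParabolic J) {x x' : Wt}
    (h : b * T.cs.redBraid x = T.cs.redBraid x' * T.braidMonoidMap δ b) :
    ∃ L ∈ T.directMixedTran (T.parabolic J) ⟨x, δ⟩ ⟨x', δ⟩, T.braidProd L = T.braidInl b := by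
  induction hn : M.braidLength b using Nat.strong_induction_on generalizing b x with
  | _ n ih =>
  by_cases hb1 : b = 1
  · subst hb1
    rw [one_mul, map_one, mul_one] at h
    rw [T.cs.redBraid_injective h]
    exact ⟨[], T.mem_directMixedTran_of_isChain (by simp) rfl, rfl⟩
  obtain ⟨τ, u, c, hτ, rfl, hu, hdir⟩ := T.exists_direct_first_step hb1 h
  rw [M.mul_mem_braidParabolic_iff] at hb
  have hc : c * T.cs.redBraid u = T.cs.redBraid x' * T.braidMonoidMap δ c := by
    apply T.cs.braid_mul_right_cancel (c := T.braidMonoidMap δ (T.cs.redBraid τ))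
    rw [mul_assoc, ← hu, ← mul_assoc, h, map_mul, mul_assoc]
  have hlen : M.braidLength c < n := by
    rw [← hn, M.braidLength_mul, T.cs.braidLength_redBraid]
    have : T.cs.length τ ≠ 0 := fun h0 => hτ (T.cs.length_eq_zero_iff.mp h0)
    omega
  obtain ⟨L, ⟨⟨hL, -⟩, hL'⟩, e⟩ := ih _ hlen hb.1 hc rfl
  refine ⟨L ++ [SemidirectProduct.inl τ], T.mem_directMixedTran_of_isChain ?_
    (isChain_append (isChain_singleton (T.isDirectMixedShift_of_redBraid hu hdir)) hL'), ?_⟩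
  · intro σ hσ
    rcases List.mem_append.mp hσ with h | h
    · exact hL σ h
    · rw [List.mem_singleton.mp h]
      exact ⟨τ, T.cs.redBraid_mem_braidParabolic_iff.mp hb.2, rfl⟩
  · have e1 : T.braidProd (L ++ [SemidirectProduct.inl τ]) =
        T.braidProd L * T.braid (SemidirectProduct.inl τ) := by
      simp [braidProd]
    rw [e1, e, map_mul]
    rfl

theorem surjOn_braidProd (J : Set B) (w w' : T.W) :
    Set.SurjOn T.braidProd (T.directMixedTran (T.parabolic J) w w') (T.braidTran J w w') := by
  rintro _ ⟨⟨b, hb, rfl⟩, h⟩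
  obtain ⟨x, δ⟩ := w
  obtain ⟨x', δ'⟩ := w'
  rw [twistedBraid_mul, twistedBraid_mul] at h
  have hδ : 1 * δ = δ' * 1 := congrArg TwistedBraidMonoid.right h
  have hl : b * T.braidMonoidMap 1 (T.cs.redBraid x) = T.cs.redBraid x' * T.braidMonoidMap δ' b :=
    congrArg TwistedBraidMonoid.left h
  rw [one_mul, mul_one] at hδ
  subst hδ
  rw [braidMonoidMap_one, MonoidHom.id_apply] at hl
  exact T.exists_directMixedTran hb hl

/-! ### Conjugacy in the braid group. -/

/-- The counterpart of `conj_complement` for a fraction `q p⁻¹`, with `g` in the role of the Garside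
element. -/
theorem mul_complement_eq {G : Type*} [Group G] {p q d d' x x' z z' g a a' : G}
    (h : q * p⁻¹ * x * d = x' * d') (hp : p * g = g * a) (hq : q * g = g * a')
    (hz : x * z = g) (hz' : x' * z' = g) : d' * d⁻¹ * z * a = z' * a' := by
  have h1 : x' * d' * d⁻¹ = q * p⁻¹ * x := by rw [← h, mul_inv_cancel_right]
  apply mul_left_cancel (a := x')
  rw [← mul_assoc, ← mul_assoc, ← mul_assoc, h1, mul_assoc _ x, hz, mul_assoc _ g, ← hp,
    mul_assoc q, inv_mul_cancel_left, hq, ← mul_assoc, hz']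

theorem mixedShift_of_conj {J : Set B} {w w' : T.W} {g : T.TwistedBraidGroup}
    (hg : g ∈ T.parabolicBraidGroup J) (h : g * T.braidInGroup w * g⁻¹ = T.braidInGroup w') :
    T.MixedShift (T.parabolic J) w w' := by
  obtain ⟨g, hg, rfl⟩ := hg
  obtain ⟨x, δ⟩ := w
  obtain ⟨x', δ'⟩ := w'
  obtain ⟨q, hq, m, hm, rfl⟩ := T.cs.exists_eq_mul_inv hg
  obtain ⟨e, ⟨m₁, rfl⟩, ⟨q₁, rfl⟩, he⟩ := T.cs.exists_rightGcd m q
  rw [mul_inv_eq_iff_eq_mul] at h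
  have hδ : 1 * δ = δ' * 1 := congrArg SemidirectProduct.right h
  rw [one_mul, mul_one] at hδ
  subst hδ
  have hl : M.braidMonoidToGroup (q₁ * e) * (M.braidMonoidToGroup (m₁ * e))⁻¹ *
      T.braidGroupAct 1 (M.braidMonoidToGroup (T.cs.redBraid x)) =
        M.braidMonoidToGroup (T.cs.redBraid x') * T.braidGroupMap δ
          (M.braidMonoidToGroup (q₁ * e) * (M.braidMonoidToGroup (m₁ * e))⁻¹) :=
    congrArg SemidirectProduct.left h
  rw [map_one, MulAut.one_apply, map_mul (T.braidGroupMap δ), map_inv (T.braidGroupMap δ),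
    ← braidMonoidToGroup_braidMonoidMap, ← braidMonoidToGroup_braidMonoidMap, ← mul_assoc,
    eq_mul_inv_iff_mul_eq] at hl
  obtain ⟨y, hy, hy'⟩ := T.cs.exists_of_fraction_conj (T.braidMonoidMap δ) he hl
  obtain ⟨z, hz⟩ := T.cs.exists_redBraid_mul_eq_garside x
  obtain ⟨z', hz'⟩ := T.cs.exists_redBraid_mul_eq_garside x'
  have hl' : M.braidMonoidToGroup (q₁ * e) * (M.braidMonoidToGroup (m₁ * e))⁻¹ *
      M.braidMonoidToGroup (T.braidMonoidMap δ⁻¹ (T.cs.redBraid z)) *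
        M.braidMonoidToGroup (T.garsideConjTwist δ (m₁ * e)) =
      M.braidMonoidToGroup (T.braidMonoidMap δ⁻¹ (T.cs.redBraid z')) *
        M.braidMonoidToGroup (T.garsideConjTwist δ (q₁ * e)) := by
    have key : M.braidMonoidToGroup (T.braidMonoidMap δ (q₁ * e)) *
        (M.braidMonoidToGroup (T.braidMonoidMap δ (m₁ * e)))⁻¹ *
          M.braidMonoidToGroup (T.cs.redBraid z) *
            M.braidMonoidToGroup (T.cs.garsideConj (m₁ * e)) =
        M.braidMonoidToGroup (T.cs.redBraid z') *
          M.braidMonoidToGroup (T.cs.garsideConj (q₁ * e)) := by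
      have g1 := congrArg M.braidMonoidToGroup (T.cs.mul_garside (m₁ * e))
      have g2 := congrArg M.braidMonoidToGroup (T.cs.mul_garside (q₁ * e))
      rw [map_mul, map_mul _ T.cs.garside] at g1 g2
      have k1 := congrArg M.braidMonoidToGroup hz
      have k2 := congrArg M.braidMonoidToGroup hz'
      rw [map_mul] at k1 k2
      exact mul_complement_eq hl g1 g2 k1 k2
    have key' := congrArg (T.braidGroupMap δ⁻¹) key
    rw [garsideConjTwist, MonoidHom.comp_apply, MonoidHom.comp_apply]
    simpa only [map_mul (T.braidGroupMap δ⁻¹), map_inv (T.braidGroupMap δ⁻¹),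
      ← braidMonoidToGroup_braidMonoidMap, braidMonoidMap_inv_apply] using key'
  -- The complements of `x` and `x'` are conjugated by the same fraction, so its denominator `m₁`
  -- also starts at a positive element `v` there.
  obtain ⟨v, hv, -⟩ := T.cs.exists_of_fraction_conj (T.garsideConjTwist δ) he hl'
  have hv' := congrArg (T.braidMonoidMap δ) hv
  rw [map_mul, map_mul, braidMonoidMap_apply_inv, garsideConjTwist, MonoidHom.comp_apply,
    braidMonoidMap_apply_inv] at hv'
  -- The two common elements are complementary in `Δ`, so `y` is a reduced braid and links `x` to
  -- `x'` through `m₁` and `q₁`.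
  have hsimple : y * T.braidMonoidMap δ v = T.cs.garside := by
    apply T.cs.braid_mul_left_cancel (c := m₁)
    rw [← mul_assoc, hy, mul_assoc, hv', ← mul_assoc, hz, T.cs.mul_garside]
  obtain ⟨u, -, rfl, -, -, -⟩ := T.cs.exists_of_mul_eq_redBraid hsimple
  obtain ⟨L, hL, -⟩ := T.exists_directMixedTran (M.mul_mem_braidParabolic_iff.mp hm).1 hy
  obtain ⟨L', hL', -⟩ := T.exists_directMixedTran (M.mul_mem_braidParabolic_iff.mp hq).1 hy'
  exact MixedShift.trans T (MixedShift.symm T ⟨L, hL.1⟩) ⟨L', hL'.1⟩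

end Finite

end TwistedCoxeterSystem

theorem propositionA {B Wt Ω : Type*} {M : CoxeterMatrix B} [Group Wt] [Group Ω]
    (T : TwistedCoxeterSystem M Wt Ω) (w w' : T.W) :
    (∀ L ∈ T.mixedTran ⊤ w w', T.rep L.prod '' T.stableRoots w = T.stableRoots w') ∧
    (T.MixedShift ⊤ w w' → T.IsConvex w → T.IsConvex w' →
      (T.IsFirmlyConvex w ↔ T.IsFirmlyConvex w')) ∧
    (Finite Wt → ∀ J : Set B,
      (Set.MapsTo T.braidProd (T.directMixedTran (T.parabolic J) w w') (T.braidTran J w w') ∧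
        Set.SurjOn T.braidProd (T.directMixedTran (T.parabolic J) w w') (T.braidTran J w w')) ∧
      Set.SurjOn T.braidProd (T.mixedTran (T.parabolic J) w w') (T.braidTran J w w') ∧
      (T.MixedShift (T.parabolic J) w w' ↔
        ∃ g ∈ T.parabolicBraidGroup J, g * T.braidInGroup w * g⁻¹ = T.braidInGroup w')) := by
  refine ⟨fun L hL => (T.rep_prod_image_of_mixedTran hL).1,
    fun h hw hw' => T.isFirmlyConvex_iff_of_mixedShift h hw hw', fun hfin J => ?_⟩
  refine ⟨⟨fun L hL => T.braidProd_mem_braidTran hL.1.1 hL.2, T.surjOn_braidProd J w w'⟩,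
    (T.surjOn_braidProd J w w').mono (fun L hL => hL.1) subset_rfl,
    fun h => T.exists_conj_of_mixedShift h, fun ⟨g, hg, h⟩ => T.mixedShift_of_conj hg h⟩
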